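/- Let $r,q\ge 1$ and $k\ge 0$ be integers, with $r\ge 2$ if $k=0$. Let $\Lambda=\mathbb{Q}[p_1,p_2,\dots]$ be the bosonic Fock space, with $J_{j}=j\,\partial/\partial p_j$, $J_{-j}=p_j$ for $j>0$, vacuum $|0\rangle = 1$ and covacuum $\langle 0|\colon f\mapsto f(0)$; write $\langle A\rangle=\langle 0|A|0\rangle$. Let $\varsigma(u)=e^{u/2}-e^{-u/2}$ and let the $k$-leaky $r$-completed cycles operator $\mathcal{F}^k_r$ be the coefficient of $u^r/r!$ in $$\mathcal{E}_{-k}(u)=\frac{1}{\varsigma(u)}\sum_{n\ge 1}\frac{1}{n!}\sum_{\substack{j_1,\dots,j_n\in\mathbb{Z}\setminus\{0\}\\ j_1+\dots+j_n=-k}}\ \prod_{i=1}^n\varsigma(j_iu)\ :\prod_{i=1}^n\frac{J_{j_i}}{j_i}:$$ (for $k=0$ the scalar term $1/\varsigma(u)$ is omitted). For a tuple $\mu=(\mu_1,\dots,\mu_n)$ of positive integers and $b,d\ge0$, the disconnected $q$-orbifold number is $$h^{\bullet}_{\mu;b,d}=\frac{1}{d!}\Big\langle \prod_{i=1}^n\frac{J_{\mu_i}}{\mu_i}\Big(\frac{\mathcal{F}^k_r}{r}\Big)^{b}\Big(\frac{J_{-q}}{q}\Big)^{d}\Big\rangle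 ,$$ and the connected numbers for one and two parts are $$h_{(m);b,d}=h^{\bullet}_{(m);b,d},\qquad h_{(l,m);b,d}=h^{\bullet}_{(l,m);b,d}-\sum_{b_1+b_2=b}\ \sum_{d_1+d_2=d}\binom{b}{b_1}h^{\bullet}_{(l);b_1,d_1}h^{\bullet}_{(m);b_2,d_2}.$$ The genus-$0$ numbers are $h_{0;(m)}=h_{(m);b,(r-1)b+1}$ if $m=(q(r-1)+k)b+q$ for some integer $b\ge 0$, and $h_{0;(l,m)}=h_{(l,m);b,(r-1)b}$ if $l+m=(q(r-1)+k)b$ for some integer $b\ge0$; they are $0$ if there is no such $b$. Consider the formal power series $$W_{0,1}(X)=\sum_{m\ge 1}\frac{h_{0;(m)}}{b!}X^m,\qquad Y(X)=\frac{dW_{0,1}}{dX},\qquad W_{0,2}(X_1,X_2)=\sum_{l,m\ge1}\frac{h_{0;(l,m)}}{b!}X_1^lX_2^m,$$ $$z(X)=X\Big(1-\frac{k}{r}\,Y^{r-1}X^{r-1+k}\Big)^{-r/k},$$ where for $k=0$ the last formula is read as its limit $z=X\exp(Y^{r-1}X^{r-1})$. Put $z_i=z(X_i)$. Then, as an identity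 of bidifferentials with coefficients in the field of fractions of $\mathbb{Q}[[X_1,X_2]]$, $$d_1d_2W_{0,2}(X_1,X_2)=\frac{dz_1\,dz_2}{(z_1-z_2)^2}-\frac{dX_1\,dX_2}{(X_1-X_2)^2}.$$ -/

import Mathlib

namespace LeakyHurwitz

open scoped Nat

noncomputable section

/-! ### Bosonic Fock space and the leaky completed cycles operators -/

/-- Bosonic Fock space (charge zero): the ring of symmetric functions, i.e. the polynomial ring
in the power sums `p_1, p_2, …`. The vacuum is `1`, the covacuum is `f ↦ f(0)`. -/
abbrev Fock : Type := MvPolynomial ℕ+ ℚ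

/-- The Heisenberg operators: `J_k = k ∂/∂p_k` and `J_{-k} = p_k` for `k > 0`, and `J_0 = 0`. -/
def J (j : ℤ) : Module.End ℚ Fock :=
  if 0 < j then (j : ℚ) • (MvPolynomial.pderiv (R := ℚ) j.toNat.toPNat').toLinearMap
  else if j < 0 then LinearMap.mulLeft ℚ (MvPolynomial.X (-j).toNat.toPNat')
  else 0

/-- The normally ordered product `: J_{j_1} ⋯ J_{j_n} :`, all creation operators standing to the
left of all annihilation operators. It vanishes if some `j_i = 0`. -/
def normalOrdered {n : ℕ} (j : Fin n → ℤ) : Module.End ℚ Fock :=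
  (List.ofFn fun i => if j i < 0 then J (j i) else 1).prod *
    (List.ofFn fun i => if 0 ≤ j i then J (j i) else 1).prod

/-- `S(u) = ς(u)/u = (e^{u/2} - e^{-u/2})/u = ∑ u^{2i} / (4^i (2i+1)!)`. -/
def serS : PowerSeries ℚ :=
  PowerSeries.mk fun i => if Even i then 1 / (2 ^ i * ((i + 1)! : ℚ)) else 0

/-- The coefficient of `u^r` in `(1/ς(u)) ∏_{i=1}^n ς(j_i u)/j_i`, for `1 ≤ n ≤ r + 1`.
Since `ς(j u)/j = u S(j u)`, it is the coefficient of `u^{r+1-n}` in `∏ S(j_i u) / S(u)`. -/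
def opCoeff (r : ℕ) {n : ℕ} (j : Fin n → ℤ) : ℚ :=
  PowerSeries.coeff (r + 1 - n) ((∏ i, PowerSeries.rescale (j i : ℚ) serS) * serS⁻¹)

theorem pderiv_mem_supported (s : Set ℕ+) (i : ℕ+) (f : Fock)
    (hf : f ∈ MvPolynomial.supported ℚ s) :
    MvPolynomial.pderiv i f ∈ MvPolynomial.supported ℚ s := by
  refine Algebra.adjoin_induction (p := fun g _ =>
    MvPolynomial.pderiv i g ∈ MvPolynomial.supported ℚ s) ?_ ?_ ?_ ?_ hf
  · rintro _ ⟨m, hm, rfl⟩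
    by_cases h : m = i
    · subst h
      simp
    · rw [MvPolynomial.pderiv_X_of_ne h]
      exact (MvPolynomial.supported ℚ s).zero_mem
  · intro c
    simp [MvPolynomial.algebraMap_eq]
  · intro x y _ _ hx hy
    rw [map_add]
    exact add_mem hx hy
  · intro x y hx' hy' hx hy
    rw [Derivation.leibniz, smul_eq_mul, smul_eq_mul]
    exact add_mem (mul_mem hx' hy) (mul_mem hy' hx)

theorem J_pos_mem {s : Set ℕ+} {j : ℤ} (hj : 0 ≤ j) {f : Fock}
    (hf : f ∈ MvPolynomial.supported ℚ s) : J j f ∈ MvPolynomial.supported ℚ s := by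
  unfold J
  split_ifs with h1 h2
  · exact Subalgebra.smul_mem _ (pderiv_mem_supported s _ f hf) _
  · omega
  · exact zero_mem _

theorem J_eq_zero_of_large {N : ℕ} {j : ℤ} (hj : (N : ℤ) < j) {f : Fock}
    (hf : f ∈ MvPolynomial.supported ℚ {m : ℕ+ | (m : ℕ) ≤ N}) : J j f = 0 := by
  have h0 : 0 < j := by omega
  rw [J, if_pos h0]
  have : MvPolynomial.pderiv (R := ℚ) j.toNat.toPNat' f = 0 := by
    apply MvPolynomial.pderiv_eq_zero_of_notMem_vars
    intro hm
    have hle := (MvPolynomial.mem_supported.1 hf) (Finset.mem_coe.2 hm)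
    simp only [Set.mem_ofPred_eq, Nat.toPNat'_coe] at hle
    split_ifs at hle <;> omega
  simp [this]

theorem annihilators_eq_zero {N : ℕ} {l : List ℤ} (hl : ∃ j ∈ l, (N : ℤ) < j) {f : Fock}
    (hf : f ∈ MvPolynomial.supported ℚ {m : ℕ+ | (m : ℕ) ≤ N}) :
    (l.map fun j => if 0 ≤ j then J j else 1).prod f = 0 := by
  have hmem : ∀ l : List ℤ, (l.map fun j => if 0 ≤ j then J j else 1).prod f ∈
      MvPolynomial.supported ℚ {m : ℕ+ | (m : ℕ) ≤ N} := by
    intro l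
    induction l with
    | nil => simpa using hf
    | cons a l ih =>
      rw [List.map_cons, List.prod_cons, Module.End.mul_apply]
      split_ifs with h
      · exact J_pos_mem h ih
      · simpa using ih
  induction l with
  | nil => simp at hl
  | cons a l ih =>
    rw [List.map_cons, List.prod_cons, Module.End.mul_apply]
    obtain ⟨j, hj, hN⟩ := hl
    rcases List.mem_cons.1 hj with rfl | hj
    · rw [if_pos (by omega)]
      exact J_eq_zero_of_large hN (hmem l)
    · rw [ih ⟨j, hj, hN⟩, map_zero]

/-- For every `f`, only finitely many normally ordered monomials of length `n` and total index
`-k` act non-trivially on `f`. -/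
theorem finite_support_normalOrdered (k r n : ℕ) (f : Fock) :
    (Function.support fun j : {j : Fin n → ℤ // ∑ i, j i = -(k : ℤ)} =>
      opCoeff r j.1 • normalOrdered j.1 f).Finite := by
  obtain ⟨N, hN⟩ : ∃ N : ℕ, f ∈ MvPolynomial.supported ℚ {m : ℕ+ | (m : ℕ) ≤ N} := by
    refine ⟨f.vars.sup fun m => (m : ℕ), MvPolynomial.mem_supported.2 ?_⟩
    intro m hm
    exact Finset.le_sup (f := fun m : ℕ+ => (m : ℕ)) (Finset.mem_coe.1 hm)
  have hfin : (Set.pi Set.univ fun _ : Fin n =>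
      Set.Icc (-(k : ℤ) - n * N) (N : ℤ)).Finite :=
    Set.Finite.pi fun _ => Set.finite_Icc _ _
  refine Set.Finite.of_finite_image (f := Subtype.val) (hfin.subset ?_)
    Subtype.val_injective.injOn
  rintro _ ⟨⟨j, hj⟩, hne, rfl⟩
  have hle : ∀ i, j i ≤ N := by
    intro i
    by_contra hlt
    apply hne
    have h0 : (List.ofFn fun i => if 0 ≤ j i then J (j i) else 1).prod f = 0 := by
      have := annihilators_eq_zero (l := List.ofFn j) ⟨j i, by simp, not_le.1 hlt⟩ hN
      rw [List.map_ofFn] at this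
      exact this
    simp only [normalOrdered, Module.End.mul_apply, h0, map_zero, smul_zero]
  intro i _
  refine ⟨?_, hle i⟩
  have h1 : ∑ m, ((N : ℤ) - j m) = n * N + k := by
    rw [Finset.sum_sub_distrib, hj]
    simp
  have h2 : (N : ℤ) - j i ≤ ∑ m, ((N : ℤ) - j m) :=
    Finset.single_le_sum (f := fun m => (N : ℤ) - j m)
      (fun m _ => sub_nonneg.2 (hle m)) (Finset.mem_univ i)
  show -(k : ℤ) - n * N ≤ j i
  have : (0 : ℤ) ≤ N := by positivity
  linarith

/-- The `k`-leaky `r`-completed cycles operator `F_r^k` on bosonic Fock space: the coefficient of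
`u^r / r!` in
`E_{-k}(u) = (1/ς(u)) ∑_{n ≥ 1} (1/n!) ∑_{j_1 + ⋯ + j_n = -k} ∏ ς(j_i u) : ∏ J_{j_i}/j_i :`.
The scalar term `1/ς(u)` of `E_0(u)`, present only for `k = 0`, is left out, as usual; it does not
affect connected numbers. -/
def leakyOp (k r : ℕ) : Module.End ℚ Fock where
  toFun f := (r ! : ℚ) • ∑ n ∈ Finset.Icc 1 (r + 1), (1 / (n ! : ℚ)) •
    ∑ᶠ j : {j : Fin n → ℤ // ∑ i, j i = -(k : ℤ)}, opCoeff r j.1 • normalOrdered j.1 f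
  map_add' f g := by
    rw [← smul_add, ← Finset.sum_add_distrib]
    congr 1
    refine Finset.sum_congr rfl fun n _ => ?_
    rw [← smul_add, ← finsum_add_distrib (finite_support_normalOrdered k r n f)
      (finite_support_normalOrdered k r n g)]
    simp only [map_add, smul_add]
  map_smul' c f := by
    rw [RingHom.id_apply, smul_comm c (r ! : ℚ), Finset.smul_sum (r := c)]
    congr 1
    refine Finset.sum_congr rfl fun n _ => ?_
    rw [smul_comm c (1 / (n ! : ℚ)), smul_finsum' c (finite_support_normalOrdered k r n f)]
    congr 1
    refine finsum_congr fun j => ?_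
    rw [map_smul, smul_comm]

/-! ### Leaky orbifold completed cycles numbers -/

/-- The vacuum expectation value `⟨ A ⟩ = ⟨0| A |0⟩`. -/
def vev (A : Module.End ℚ Fock) : ℚ := MvPolynomial.constantCoeff (A 1)

/-- The disconnected `q`-orbifold `k`-leaky `r`-completed cycles number with left profile `μ`
(ordered), right profile `ν = (q, …, q)` of length `d`, and `b` vertices:
`(1 / |Aut ν|) ⟨ ∏ J_{μ_i}/μ_i (F_r^k / r)^b (J_{-q}/q)^d ⟩`, where `|Aut ν| = d!`. -/
def disconnectedNumber (k r q : ℕ) (μ : List ℕ) (b d : ℕ) : ℚ :=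
  vev ((μ.map fun m : ℕ => (1 / (m : ℚ)) • J (m : ℤ)).prod * ((1 / (r : ℚ)) • leakyOp k r) ^ b *
    ((1 / (q : ℚ)) • J (-(q : ℤ))) ^ d) / (d ! : ℚ)

/-- Connected numbers with left profile `(m)`: for one part the inclusion-exclusion relation
reads `H_1 = H_1^•`. -/
def connectedNumber₁ (k r q m b d : ℕ) : ℚ := disconnectedNumber k r q [m] b d

/-- Connected numbers with left profile `(l, m)`: the inclusion-exclusion relation
`H_2(X_1, X_2) = H_2^•(X_1, X_2) - H_1^•(X_1) H_1^•(X_2)` for the generating series in which a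
number with `b` vertices is divided by `b!`. -/
def connectedNumber₂ (k r q l m b d : ℕ) : ℚ :=
  disconnectedNumber k r q [l, m] b d -
    ∑ β ∈ Finset.HasAntidiagonal.antidiagonal b, ∑ δ ∈ Finset.HasAntidiagonal.antidiagonal d,
      (b.choose β.1 : ℚ) * disconnectedNumber k r q [l] β.1 δ.1 *
        disconnectedNumber k r q [m] β.2 δ.2

/-- In genus `0` with one left part, `(r-1) b = 2·0 - 2 + 1 + d` gives `d = (r-1) b + 1`. -/
def genusZeroNumber₁ (k r q m b : ℕ) : ℚ := connectedNumber₁ k r q m b ((r - 1) * b + 1)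

/-- In genus `0` with two left parts, `(r-1) b = 2·0 - 2 + 2 + d` gives `d = (r-1) b`. -/
def genusZeroNumber₂ (k r q l m b : ℕ) : ℚ := connectedNumber₂ k r q l m b ((r - 1) * b)

/-- `W_{0,1}(X) = ∑_m (h_{0;(m)} / b!) X^m`, where `b` is determined by `m` through
`m = q d + k b` with `d = (r-1) b + 1`, i.e. `m = (q (r-1) + k) b + q`
(no such `b`: coefficient `0`). -/
def W01 (k r q : ℕ) : PowerSeries ℚ :=
  PowerSeries.mk fun m =>
    ∑ b ∈ (Finset.range (m + 1)).filter (fun b => (q * (r - 1) + k) * b + q = m),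
      genusZeroNumber₁ k r q m b / (b ! : ℚ)

/-- `W_{0,2}(X_1, X_2) = ∑_{l, m ≥ 1} (h_{0;(l,m)} / b!) X_1^l X_2^m`, where `b` is determined by
`l + m = q d + k b` with `d = (r-1) b`, i.e. `l + m = (q (r-1) + k) b`
(no such `b`: coefficient `0`). -/
def W02 (k r q : ℕ) : MvPowerSeries (Fin 2) ℚ := fun e =>
  if 1 ≤ e 0 ∧ 1 ≤ e 1 then
    ∑ b ∈ (Finset.range (e 0 + e 1 + 1)).filter (fun b => (q * (r - 1) + k) * b = e 0 + e 1),
      genusZeroNumber₂ k r q (e 0) (e 1) b / (b ! : ℚ)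
  else 0

/-! ### The coordinate `z` and the bidifferentials -/

/-- `Y(X) = dW_{0,1}/dX`. -/
def serY (k r q : ℕ) : PowerSeries ℚ := PowerSeries.derivative ℚ (W01 k r q)

/-- The series `(1 - (k/r) T)^{-r/k}` in `T`; for `k = 0` its limit `e^T`. -/
def powerFactor (k r : ℕ) : PowerSeries ℚ :=
  if k = 0 then PowerSeries.exp ℚ
  else PowerSeries.rescale (-((k : ℚ) / r)) (PowerSeries.binomialSeries ℚ (-((r : ℚ) / k)))

/-- `z(X) = X (1 - (k/r) Y^{r-1} X^{r-1+k})^{-r/k}`. -/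
def serZ (k r q : ℕ) : PowerSeries ℚ :=
  PowerSeries.X *
    (powerFactor k r).subst (serY k r q ^ (r - 1) * PowerSeries.X ^ (r - 1 + k) : PowerSeries ℚ)

/-- The field of fractions of `ℚ⟦X_1, X_2⟧` (the variables are indexed by `0, 1 : Fin 2`).
A bidifferential `f dX_1 dX_2` is represented by its coefficient `f`. -/
abbrev Frac : Type := FractionRing (MvPowerSeries (Fin 2) ℚ)

/-- The inclusion `ℚ⟦X_1, X_2⟧ → Frac`. -/
abbrev toFrac : MvPowerSeries (Fin 2) ℚ →+* Frac := algebraMap _ _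

/-- The series `f(X_1)` (for `i = 0`) and `f(X_2)` (for `i = 1`). -/
def atVar (i : Fin 2) (f : PowerSeries ℚ) : MvPowerSeries (Fin 2) ℚ :=
  f.subst (MvPowerSeries.X i : MvPowerSeries (Fin 2) ℚ)

/-- The coefficient of `dX_1 dX_2` in `d_1 d_2 F`. -/
def mixedDifferential (F : MvPowerSeries (Fin 2) ℚ) : MvPowerSeries (Fin 2) ℚ :=
  MvPowerSeries.pderiv ℚ 0 (MvPowerSeries.pderiv ℚ 1 F)

/-- The coefficient of `dX_1 dX_2` in `df_1 df_2 / (f_1 - f_2)^2`, where `f_i = f(X_i)`. -/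
def bidifferential (f : PowerSeries ℚ) : Frac :=
  toFrac (MvPowerSeries.pderiv ℚ 0 (atVar 0 f)) * toFrac (MvPowerSeries.pderiv ℚ 1 (atVar 1 f)) /
    (toFrac (atVar 0 f) - toFrac (atVar 1 f)) ^ 2

end

end LeakyHurwitz

namespace LeakyHurwitz

open scoped Nat

noncomputable section

/-! ### Adjoints with respect to the Hall pairing -/

/-! For the Hall pairing `J a` is adjoint to `J (-a)`, so a vacuum expectation becomes the
coefficient of `p_q^d` in `leakyAdj ^ b` applied to `p_l` or `p_l p_m`. A vertex with `n` legs, `c`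
of them acting as derivatives, shifts the polynomial degree by `n - 2c`. Terms with `c = 0` vanish
because the indices add up to `-k ≤ 0`, and terms with `n = r` vanish because `serS` is even. Hence
the operator is a derivation `leadingOp` of degree `r - 1`, plus `subleadingOp` of degree `r - 3`
and differential order at most two, plus terms too low in degree to contribute in genus zero
(`leakyAdj_pow_sub_mem`).

Sum over `b` with a time variable `t` and evaluate at `p_q = 1`. The flow of the derivation becomes
a ring homomorphism (`leadingSeries_mul`), and its first correction, with the disconnected products
removed, is a biderivation over it (`connectedSeries_mul_left`). Both are therefore governed by
their values on the `p_l`, which satisfy closed evolution equations in `t`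
(`derivative_leadingHom_X`, `derivative_connectedSeries_X`). With `N = q(r-1)+k`, energy
conservation forces `N b + q = l`, respectively `N b = l + m`, so at `t = 1` the time derivative
turns into an Euler operator in `X`: this gives `one_point_equation` and `two_point_equation`.

Let `G = X^k (XY)^(r-1)` and `H = N G`. The one-point equation yields `X(1-H) z' = z`. The two-point
equation says that `L = X_1(1-H_1) ∂_1 + X_2(1-H_2) ∂_2` sends `W02` to `K - H_1 - H_2`, where `K`
is the divided difference of `X H`. Since `L log(z_1 - z_2) = 1` and `L log(X_1 - X_2) = 1 - K`, the
logarithm of `(z_1 - z_2)/(X_1 - X_2)` is sent to `K`. The operator `∂_1 ∂_2` kills `H_1 + H_2`, so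
the mixed derivatives of `W02` and of this logarithm solve the same equation, whose solution is
unique (`transport_unique`). The mixed derivative of the logarithm is the right-hand side of the
theorem. -/

theorem J_coe_pos (i : ℕ+) :
    J ((i : ℕ) : ℤ) = ((i : ℕ) : ℚ) • (MvPolynomial.pderiv (R := ℚ) i).toLinearMap := by
  rw [J, if_pos (by exact_mod_cast i.pos)]
  simp

theorem J_neg_coe (i : ℕ+) : J (-((i : ℕ) : ℤ)) = LinearMap.mulLeft ℚ (MvPolynomial.X i) := by
  have := i.pos
  rw [J, if_neg (by omega), if_pos (by omega)]
  simp

theorem J_coe_pos_apply (i : ℕ+) (f : Fock) :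
    J ((i : ℕ) : ℤ) f = ((i : ℕ) : ℚ) • MvPolynomial.pderiv i f := by
  rw [J_coe_pos]; rfl

theorem J_neg_coe_apply (i : ℕ+) (f : Fock) :
    J (-((i : ℕ) : ℤ)) f = MvPolynomial.X i * f := by
  rw [J_neg_coe]; rfl

@[simp] theorem J_zero : J 0 = 0 := by simp [J]

theorem int_cases_pnat (a : ℤ) :
    a = 0 ∨ (∃ i : ℕ+, a = ((i : ℕ) : ℤ)) ∨ ∃ i : ℕ+, a = -((i : ℕ) : ℤ) := by
  rcases lt_trichotomy a 0 with h | h | h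
  · refine Or.inr (Or.inr ⟨⟨(-a).toNat, by omega⟩, ?_⟩)
    simp only [PNat.mk_coe]
    omega
  · exact Or.inl h
  · refine Or.inr (Or.inl ⟨⟨a.toNat, by omega⟩, ?_⟩)
    simp only [PNat.mk_coe]
    omega

/-- The squared norm of the monomial `p^s` for the Hall pairing. -/
def hallNorm (s : ℕ+ →₀ ℕ) : ℚ := s.prod fun i n => ((i : ℕ) : ℚ) ^ n * (n ! : ℚ)

/-- The Hall pairing, for which monomials are orthogonal. -/
def pairing : Fock →ₗ[ℚ] Fock →ₗ[ℚ] ℚ :=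
  (MvPolynomial.basisMonomials ℕ+ ℚ).constr ℚ fun s => hallNorm s • MvPolynomial.lcoeff ℚ s

theorem pairing_monomial (s : ℕ+ →₀ ℕ) (g : Fock) :
    pairing (MvPolynomial.monomial s 1) g = hallNorm s * MvPolynomial.coeff s g := by
  have := (MvPolynomial.basisMonomials ℕ+ ℚ).constr_basis ℚ
    (fun s => hallNorm s • MvPolynomial.lcoeff ℚ s) s
  rw [MvPolynomial.coe_basisMonomials] at this
  rw [pairing, this]
  rfl

theorem fock_linearMap_ext {M : Type*} [AddCommMonoid M] [Module ℚ M] {S T : Fock →ₗ[ℚ] M}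
    (h : ∀ s, S (MvPolynomial.monomial s 1) = T (MvPolynomial.monomial s 1)) : S = T :=
  (MvPolynomial.basisMonomials ℕ+ ℚ).ext fun s => by simpa using h s

theorem pairing_comm (f g : Fock) : pairing f g = pairing g f := by
  have : pairing = pairing.flip := by
    refine fock_linearMap_ext fun s => fock_linearMap_ext fun t => ?_
    rw [LinearMap.flip_apply, pairing_monomial, pairing_monomial, MvPolynomial.coeff_monomial,
      MvPolynomial.coeff_monomial]
    by_cases h : s = t
    · simp [h]
    · simp [h, Ne.symm h]
  conv_lhs => rw [this]
  rfl

theorem hallNorm_add_single (s : ℕ+ →₀ ℕ) (i : ℕ+) :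
    hallNorm (s + Finsupp.single i 1) = ((i : ℕ) : ℚ) * (s i + 1) * hallNorm s := by
  classical
  have key : ∀ t : ℕ+ →₀ ℕ, hallNorm t = ((i : ℕ) : ℚ) ^ t i * ((t i)! : ℚ) *
      hallNorm (t.erase i) := by
    intro t
    exact (Finsupp.mul_prod_erase' t i (fun i n => ((i : ℕ) : ℚ) ^ n * (n ! : ℚ))
      fun _ => by simp).symm
  rw [key, key s]
  have : (s + Finsupp.single i 1).erase i = s.erase i := by
    rw [Finsupp.erase_add, Finsupp.erase_single, add_zero]
  rw [this]
  simp only [Finsupp.add_apply, Finsupp.single_eq_same, Nat.factorial_succ, pow_succ]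
  push_cast
  ring

/-- The weights `i^n n!` in `hallNorm` are chosen so that this adjunction holds. -/
theorem pairing_X_mul (i : ℕ+) (f g : Fock) :
    pairing (MvPolynomial.X i * f) g = pairing f (((i : ℕ) : ℚ) • MvPolynomial.pderiv i g) := by
  have : pairing ∘ₗ LinearMap.mulLeft ℚ (MvPolynomial.X i) =
      (pairing.flip ∘ₗ (((i : ℕ) : ℚ) • (MvPolynomial.pderiv (R := ℚ) i).toLinearMap)).flip := by
    refine fock_linearMap_ext fun s => LinearMap.ext fun g => ?_
    simp only [LinearMap.comp_apply, LinearMap.flip_apply, LinearMap.mulLeft_apply,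
      LinearMap.smul_apply, Derivation.coeFn_coe]
    rw [show (MvPolynomial.X i * MvPolynomial.monomial s 1 : Fock) =
        MvPolynomial.monomial (s + Finsupp.single i 1) 1 by
      rw [MvPolynomial.X, MvPolynomial.monomial_mul, add_comm, one_mul], pairing_monomial,
      pairing_monomial, hallNorm_add_single, MvPolynomial.coeff_smul, MvPolynomial.coeff_pderiv,
      smul_eq_mul]
    ring
  exact LinearMap.congr_fun (LinearMap.congr_fun this f) g

theorem pairing_J (a : ℤ) (f g : Fock) : pairing (J a f) g = pairing f (J (-a) g) := by
  rcases int_cases_pnat a with rfl | ⟨i, rfl⟩ | ⟨i, rfl⟩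
  · simp
  · rw [J_coe_pos_apply, J_neg_coe_apply, pairing_comm, pairing_comm f, pairing_X_mul]
  · rw [neg_neg, J_coe_pos_apply, J_neg_coe_apply, pairing_X_mul]

theorem pderiv_comm (i j : ℕ+) (f : Fock) :
    MvPolynomial.pderiv i (MvPolynomial.pderiv j f) =
      MvPolynomial.pderiv j (MvPolynomial.pderiv i f) := by
  classical
  ext s
  simp only [MvPolynomial.coeff_pderiv, Finsupp.add_apply]
  by_cases h : i = j
  · subst h; rfl
  · rw [Finsupp.single_eq_of_ne h, Finsupp.single_eq_of_ne (Ne.symm h), add_right_comm]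
    push_cast
    ring

theorem commute_J_of_nonneg {a b : ℤ} (ha : 0 ≤ a) (hb : 0 ≤ b) : Commute (J a) (J b) := by
  rcases int_cases_pnat a with rfl | ⟨i, rfl⟩ | ⟨i, rfl⟩
  · simp
  · rcases int_cases_pnat b with rfl | ⟨j, rfl⟩ | ⟨j, rfl⟩
    · simp
    · refine LinearMap.ext fun f => ?_
      simp only [Module.End.mul_apply, J_coe_pos_apply, map_smul]
      rw [pderiv_comm, smul_comm]
    · have := j.pos
      omega
  · have := i.pos
    omega

/-- The adjoint of the creation part of `J a`. -/
def annihilationAdj (a : ℤ) : Module.End ℚ Fock := if a < 0 then J (-a) else 1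

/-- The adjoint of the annihilation part of `J a`. -/
def creationAdj (a : ℤ) : Module.End ℚ Fock := if 0 ≤ a then J (-a) else 1

/-- The adjoint of the normally ordered product of the `J a`, for `a` in a list. -/
def adjOrdered : List ℤ → Module.End ℚ Fock
  | [] => 1
  | a :: l => creationAdj a * adjOrdered l * annihilationAdj a

/-- Taking adjoints exchanges multiplications and derivatives and reverses products, so a normally
ordered product stays normally ordered. The recursion puts the head's annihilator last instead of
first; this is harmless because annihilators commute. -/
theorem pairing_adjOrdered (l : List ℤ) (f g : Fock) :
    pairing (adjOrdered l f) g = pairing f (((l.map fun a => if a < 0 then J a else 1).prod *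
      (l.map fun a => if 0 ≤ a then J a else 1).prod) g) := by
  have hann : ∀ (l : List ℤ) (a : ℤ), Commute (if 0 ≤ a then J a else 1)
      (l.map fun a => if 0 ≤ a then J a else 1).prod := by
    intro l a
    refine Commute.list_prod_right _ _ fun x hx => ?_
    obtain ⟨b, -, rfl⟩ := List.mem_map.1 hx
    split_ifs with h1 h2
    · exact commute_J_of_nonneg h1 h2
    all_goals simp
  induction l generalizing f g with
  | nil => simp [adjOrdered]
  | cons a l ih =>
    rw [List.map_cons, List.map_cons, List.prod_cons, List.prod_cons, (hann l a).eq, adjOrdered,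
      ← mul_assoc, mul_assoc _ _ (List.prod _), ← mul_assoc]
    simp only [Module.End.mul_apply]
    have h1 : ∀ f g, pairing (creationAdj a f) g =
        pairing f ((if 0 ≤ a then J a else 1 : Module.End ℚ Fock) g) := by
      intro f g
      rw [creationAdj]
      split_ifs
      · rw [pairing_J, neg_neg]
      · rfl
    have h2 : ∀ f g, pairing (annihilationAdj a f) g =
        pairing f ((if a < 0 then J a else 1 : Module.End ℚ Fock) g) := by
      intro f g
      rw [annihilationAdj]
      split_ifs
      · rw [pairing_J, neg_neg]
      · rfl
    rw [h1, ih, h2]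
    rfl

theorem pairing_normalOrdered {n : ℕ} (j : Fin n → ℤ) (f g : Fock) :
    pairing f (normalOrdered j g) = pairing (adjOrdered (List.ofFn j) f) g := by
  rw [pairing_adjOrdered, List.map_ofFn, List.map_ofFn]
  rfl

/-! ### Structure of the adjoint normally ordered products -/

@[simp] theorem adjOrdered_nil (f : Fock) : adjOrdered [] f = f := rfl

theorem adjOrdered_cons_zero (l : List ℤ) (f : Fock) : adjOrdered (0 :: l) f = 0 := by
  simp [adjOrdered, creationAdj]

theorem adjOrdered_cons_pos (i : ℕ+) (l : List ℤ) (f : Fock) :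
    adjOrdered (((i : ℕ) : ℤ) :: l) f = MvPolynomial.X i * adjOrdered l f := by
  have := i.pos
  rw [adjOrdered, creationAdj, annihilationAdj, if_pos (by omega), if_neg (by omega),
    mul_one, Module.End.mul_apply, J_neg_coe_apply]

theorem adjOrdered_cons_neg (i : ℕ+) (l : List ℤ) (f : Fock) :
    adjOrdered (-((i : ℕ) : ℤ) :: l) f =
      ((i : ℕ) : ℚ) • adjOrdered l (MvPolynomial.pderiv i f) := by
  have := i.pos
  rw [adjOrdered, creationAdj, annihilationAdj, if_neg (by omega), if_pos (by omega),
    one_mul, Module.End.mul_apply, neg_neg, J_coe_pos_apply, map_smul]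

/-- The number of negative entries of a list, i.e. of derivatives in `adjOrdered`. -/
def negCount (l : List ℤ) : ℕ := l.countP fun a => decide (a < 0)

@[simp] theorem negCount_nil : negCount [] = 0 := rfl

theorem negCount_cons_nonneg {a : ℤ} (ha : 0 ≤ a) (l : List ℤ) :
    negCount (a :: l) = negCount l := by
  simp [negCount, not_lt.2 ha]

theorem negCount_cons_pos (i : ℕ+) (l : List ℤ) :
    negCount (((i : ℕ) : ℤ) :: l) = negCount l := negCount_cons_nonneg (by omega) l

theorem negCount_cons_neg (i : ℕ+) (l : List ℤ) :
    negCount (-((i : ℕ) : ℤ) :: l) = negCount l + 1 := by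
  have := i.pos
  simp [negCount]

/-- Multiplication operators. -/
def IsMultiplication (T : Module.End ℚ Fock) : Prop := ∀ f g, T (f * g) = f * T g

/-- Derivations. -/
def IsFirstOrder (T : Module.End ℚ Fock) : Prop := ∀ f g, T (f * g) = f * T g + g * T f

/-- Differential operators of order at most two without constant term. -/
def IsSecondOrder (T : Module.End ℚ Fock) : Prop := ∀ f g h,
  T (f * g * h) = f * T (g * h) + g * T (f * h) + h * T (f * g) -
    f * g * T h - f * h * T g - g * h * T f

theorem IsFirstOrder.isSecondOrder {T : Module.End ℚ Fock} (h : IsFirstOrder T) :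
    IsSecondOrder T := by
  intro f g e
  simp only [h _ _]
  ring

/-- In `adjOrdered` every derivative acts before every multiplication, so the differential order is
`negCount`. The cases of order zero, one and two are each reduced to the preceding one by the
Leibniz rule for the head. -/
theorem isMultiplication_adjOrdered {l : List ℤ} (hl : negCount l = 0) :
    IsMultiplication (adjOrdered l) := by
  induction l with
  | nil => intro f g; rfl
  | cons a l ih =>
    intro f g
    rcases int_cases_pnat a with rfl | ⟨i, rfl⟩ | ⟨i, rfl⟩
    · simp [adjOrdered_cons_zero]
    · rw [negCount_cons_pos] at hl
      rw [adjOrdered_cons_pos, adjOrdered_cons_pos, ih hl, mul_left_comm]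
    · rw [negCount_cons_neg] at hl
      omega

theorem isFirstOrder_adjOrdered {l : List ℤ} (hl : negCount l = 1) :
    IsFirstOrder (adjOrdered l) := by
  induction l with
  | nil => simp at hl
  | cons a l ih =>
    intro f g
    rcases int_cases_pnat a with rfl | ⟨i, rfl⟩ | ⟨i, rfl⟩
    · simp [adjOrdered_cons_zero]
    · rw [negCount_cons_pos] at hl
      simp only [adjOrdered_cons_pos, ih hl _ _]
      ring
    · rw [negCount_cons_neg] at hl
      have h0 := isMultiplication_adjOrdered (l := l) (by omega)
      simp only [adjOrdered_cons_neg, Derivation.leibniz, smul_eq_mul, map_add, h0 _ _,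
        mul_smul_comm, smul_add]

theorem isSecondOrder_adjOrdered {l : List ℤ} (hl : negCount l = 2) :
    IsSecondOrder (adjOrdered l) := by
  induction l with
  | nil => simp at hl
  | cons a l ih =>
    intro f g e
    rcases int_cases_pnat a with rfl | ⟨i, rfl⟩ | ⟨i, rfl⟩
    · simp [adjOrdered_cons_zero]
    · rw [negCount_cons_pos] at hl
      simp only [adjOrdered_cons_pos, ih hl f g e]
      ring
    · rw [negCount_cons_neg] at hl
      have h0 := isFirstOrder_adjOrdered (l := l) (by omega)
      simp only [adjOrdered_cons_neg, Derivation.leibniz, smul_eq_mul, map_add, h0 _ _,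
        MvPolynomial.smul_eq_C_mul]
      ring

theorem adjOrdered_C {l : List ℤ} (hl : 1 ≤ negCount l) (c : ℚ) :
    adjOrdered l (MvPolynomial.C c) = 0 := by
  induction l with
  | nil => simp at hl
  | cons a l ih =>
    rcases int_cases_pnat a with rfl | ⟨i, rfl⟩ | ⟨i, rfl⟩
    · exact adjOrdered_cons_zero _ _
    · rw [negCount_cons_pos] at hl
      rw [adjOrdered_cons_pos, ih hl, mul_zero]
    · rw [adjOrdered_cons_neg, MvPolynomial.pderiv_C, map_zero, smul_zero]

theorem adjOrdered_X {l : List ℤ} (hl : 2 ≤ negCount l) (m : ℕ+) :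
    adjOrdered l (MvPolynomial.X m) = 0 := by
  classical
  induction l with
  | nil => simp at hl
  | cons a l ih =>
    rcases int_cases_pnat a with rfl | ⟨i, rfl⟩ | ⟨i, rfl⟩
    · exact adjOrdered_cons_zero _ _
    · rw [negCount_cons_pos] at hl
      rw [adjOrdered_cons_pos, ih hl, mul_zero]
    · rw [negCount_cons_neg] at hl
      have h0 := adjOrdered_C (l := l) (by omega) 1
      rw [MvPolynomial.C_1] at h0
      rw [adjOrdered_cons_neg, MvPolynomial.pderiv_X, Pi.single_apply]
      split_ifs
      · rw [h0, smul_zero]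
      · rw [map_zero, smul_zero]

theorem adjOrdered_X_mul_X {l : List ℤ} (hl : 3 ≤ negCount l) (m m' : ℕ+) :
    adjOrdered l (MvPolynomial.X m * MvPolynomial.X m') = 0 := by
  classical
  induction l with
  | nil => simp at hl
  | cons a l ih =>
    rcases int_cases_pnat a with rfl | ⟨i, rfl⟩ | ⟨i, rfl⟩
    · exact adjOrdered_cons_zero _ _
    · rw [negCount_cons_pos] at hl
      rw [adjOrdered_cons_pos, ih hl, mul_zero]
    · rw [negCount_cons_neg] at hl
      have h0 := adjOrdered_X (l := l) (by omega) m
      have h0' := adjOrdered_X (l := l) (by omega) m'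
      rw [adjOrdered_cons_neg, Derivation.leibniz, MvPolynomial.pderiv_X, MvPolynomial.pderiv_X,
        Pi.single_apply, Pi.single_apply]
      split_ifs <;> simp [h0, h0']

/-! ### Gradings -/

/-- The weighted degree of a monomial. -/
def grade (w : ℕ+ → ℤ) : (ℕ+ →₀ ℕ) →+ ℤ :=
  Finsupp.liftAddHom fun i => (AddMonoidHom.mulLeft (w i)).comp (Nat.castAddMonoidHom ℤ)

@[simp] theorem grade_single (w : ℕ+ → ℤ) (i : ℕ+) (n : ℕ) :
    grade w (Finsupp.single i n) = w i * n := by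
  simp [grade]

/-- The number of factors of a monomial. -/
def degGrade : (ℕ+ →₀ ℕ) →+ ℤ := grade fun _ => 1

/-- The energy of a monomial. -/
def wtGrade : (ℕ+ →₀ ℕ) →+ ℤ := grade fun i => ((i : ℕ) : ℤ)

theorem mem_restrictSupport {S : Set (ℕ+ →₀ ℕ)} {f : Fock} :
    f ∈ MvPolynomial.restrictSupport ℚ S ↔ ∀ s, MvPolynomial.coeff s f ≠ 0 → s ∈ S := by
  rw [MvPolynomial.mem_restrictSupport_iff]
  exact forall_congr' fun s => by simp [MvPolynomial.mem_support_iff]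

/-- Polynomials that are homogeneous of degree `d` and energy `e`. -/
def bihomogeneous (d e : ℤ) : Submodule ℚ Fock :=
  MvPolynomial.restrictSupport ℚ {s | degGrade s = d ∧ wtGrade s = e}

/-- Polynomials all of whose monomials have degree less than `d`. -/
def degreeBelow (d : ℤ) : Submodule ℚ Fock :=
  MvPolynomial.restrictSupport ℚ {s | degGrade s < d}

theorem bihomogeneous_le_degreeBelow {d d' : ℤ} (h : d < d') (e : ℤ) :
    bihomogeneous d e ≤ degreeBelow d' :=
  MvPolynomial.restrictSupport_mono _ fun _ hs => hs.1.trans_lt h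

theorem degreeBelow_mono {d d' : ℤ} (h : d ≤ d') : degreeBelow d ≤ degreeBelow d' :=
  MvPolynomial.restrictSupport_mono _ fun _ hs => lt_of_lt_of_le hs h

theorem X_mem_bihomogeneous (i : ℕ+) :
    (MvPolynomial.X i : Fock) ∈ bihomogeneous 1 ((i : ℕ) : ℤ) := by
  rw [MvPolynomial.X, bihomogeneous, MvPolynomial.monomial_mem_restrictSupport]
  left
  simp [degGrade, wtGrade]

theorem X_mul_mem_bihomogeneous {d e : ℤ} {f : Fock} (hf : f ∈ bihomogeneous d e) (i : ℕ+) :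
    MvPolynomial.X i * f ∈ bihomogeneous (d + 1) (e + ((i : ℕ) : ℤ)) := by
  classical
  rw [bihomogeneous, mem_restrictSupport] at hf ⊢
  intro s hs
  rw [MvPolynomial.coeff_X_mul'] at hs
  split_ifs at hs with hi
  · have h := hf _ hs
    have hsum : s = (s - Finsupp.single i 1) + Finsupp.single i 1 := by
      refine (tsub_add_cancel_of_le ?_).symm
      rw [Finsupp.single_le_iff]
      exact Nat.one_le_iff_ne_zero.2 (Finsupp.mem_support_iff.1 hi)
    constructor
    · rw [hsum, map_add, h.1]
      simp [degGrade]
    · rw [hsum, map_add, h.2]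
      simp [wtGrade]
  · exact absurd rfl hs

theorem pderiv_mem_bihomogeneous {d e : ℤ} {f : Fock} (hf : f ∈ bihomogeneous d e) (i : ℕ+) :
    MvPolynomial.pderiv i f ∈ bihomogeneous (d - 1) (e - ((i : ℕ) : ℤ)) := by
  rw [bihomogeneous, mem_restrictSupport] at hf ⊢
  intro s hs
  rw [MvPolynomial.coeff_pderiv] at hs
  obtain ⟨h1, h2⟩ := hf _ (left_ne_zero_of_mul hs)
  rw [map_add] at h1 h2
  constructor
  · rw [← h1]
    simp [degGrade]
  · rw [← h2]
    simp [wtGrade]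

/-- A multiplication raises the degree by one and a derivative lowers it by one. This count carries
the genus grading. -/
theorem adjOrdered_mem_bihomogeneous (l : List ℤ) {d e : ℤ} {f : Fock}
    (hf : f ∈ bihomogeneous d e) :
    adjOrdered l f ∈ bihomogeneous (d + l.length - 2 * negCount l) (e + l.sum) := by
  induction l generalizing f d e with
  | nil => simpa using hf
  | cons a l ih =>
    rcases int_cases_pnat a with rfl | ⟨i, rfl⟩ | ⟨i, rfl⟩
    · rw [adjOrdered_cons_zero]
      exact zero_mem _
    · rw [adjOrdered_cons_pos, negCount_cons_pos, List.length_cons, List.sum_cons]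
      convert X_mul_mem_bihomogeneous (ih hf) i using 1
      push_cast
      congr 1 <;> ring
    · rw [adjOrdered_cons_neg, negCount_cons_neg, List.length_cons, List.sum_cons]
      refine Submodule.smul_mem _ _ ?_
      convert ih (pderiv_mem_bihomogeneous hf i) using 1
      push_cast
      congr 1 <;> ring

/-! ### Local finiteness -/

theorem adjOrdered_eq_zero_of_lt {N : ℕ} {l : List ℤ} (hl : ∃ a ∈ l, a < -(N : ℤ)) {f : Fock}
    (hf : f ∈ MvPolynomial.supported ℚ {m : ℕ+ | (m : ℕ) ≤ N}) : adjOrdered l f = 0 := by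
  induction l generalizing f with
  | nil => simp at hl
  | cons a l ih =>
    obtain ⟨b, hb, hN⟩ := hl
    rcases int_cases_pnat a with rfl | ⟨i, rfl⟩ | ⟨i, rfl⟩
    · exact adjOrdered_cons_zero _ _
    · rw [adjOrdered_cons_pos]
      rcases List.mem_cons.1 hb with rfl | hb
      · omega
      · rw [ih ⟨b, hb, hN⟩ hf, mul_zero]
    · rw [adjOrdered_cons_neg]
      rcases List.mem_cons.1 hb with rfl | hb
      · have := J_eq_zero_of_large (N := N) (j := ((i : ℕ) : ℤ)) (by omega) hf
        rw [J_coe_pos_apply] at this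
        rw [← map_smul, this, map_zero]
      · rw [ih ⟨b, hb, hN⟩ (pderiv_mem_supported _ _ _ hf), smul_zero]

/-- An index below `-N` differentiates by a variable absent from `f`. Once all indices are at least
`-N`, the fixed total `-k` also bounds each of them from above. -/
theorem exists_box_adjOrdered (k n : ℕ) (f : Fock) : ∃ M : ℕ, ∀ j : Fin n → ℤ,
    ∑ i, j i = -(k : ℤ) → adjOrdered (List.ofFn j) f ≠ 0 →
      ∀ i, j i ∈ Finset.Icc (-(M : ℤ)) (M : ℤ) := by
  obtain ⟨N, hN⟩ : ∃ N : ℕ, f ∈ MvPolynomial.supported ℚ {m : ℕ+ | (m : ℕ) ≤ N} := by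
    refine ⟨f.vars.sup fun m => (m : ℕ), MvPolynomial.mem_supported.2 ?_⟩
    intro m hm
    exact Finset.le_sup (f := fun m : ℕ+ => (m : ℕ)) (Finset.mem_coe.1 hm)
  refine ⟨N + n * N, fun j hj hne => ?_⟩
  have hle : ∀ i, -(N : ℤ) ≤ j i := by
    intro i
    by_contra hlt
    exact hne (adjOrdered_eq_zero_of_lt ⟨j i, by simp, not_le.1 hlt⟩ hN)
  intro i
  have h1 : ∑ m, (j m + (N : ℤ)) = n * N - k := by
    rw [Finset.sum_add_distrib, hj]
    simp
    ring
  have h2 : j i + (N : ℤ) ≤ ∑ m, (j m + (N : ℤ)) :=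
    Finset.single_le_sum (f := fun m => j m + (N : ℤ))
      (fun m _ => by linarith [hle m]) (Finset.mem_univ i)
  have h3 := hle i
  have h4 : (0 : ℤ) ≤ n * N := by positivity
  rw [Finset.mem_Icc]
  push_cast
  constructor <;> linarith

theorem finite_support_adjOrdered (k n : ℕ) (w : (Fin n → ℤ) → ℚ) (f : Fock) :
    (Function.support fun j : {j : Fin n → ℤ // ∑ i, j i = -(k : ℤ)} =>
      w j.1 • adjOrdered (List.ofFn j.1) f).Finite := by
  obtain ⟨M, hM⟩ := exists_box_adjOrdered k n f
  refine Set.Finite.of_finite_image (f := Subtype.val) ((Set.Finite.pi (ι := Fin n) (t := fun _ =>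
    Set.Icc (-(M : ℤ)) (M : ℤ)) fun _ => Set.finite_Icc _ _).subset ?_)
    Subtype.val_injective.injOn
  rintro _ ⟨⟨j, hj⟩, hne, rfl⟩ i _
  have := hM j hj (fun h => hne (by simp [h])) i
  simpa using this

/-! ### Sums over boxes and powers of the field -/

/-- The sum of all adjoint normally ordered products of length `n`, with indices in
`[-M, M]` of sum `s`. -/
def boxSum (n M : ℕ) (s : ℤ) : Module.End ℚ Fock :=
  ∑ j ∈ Fintype.piFinset fun _ : Fin n => Finset.Icc (-(M : ℤ)) (M : ℤ),
    if ∑ i, j i = s then adjOrdered (List.ofFn j) else 0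

theorem boxSum_apply (n M : ℕ) (s : ℤ) (f : Fock) : boxSum n M s f =
    ∑ j ∈ Fintype.piFinset fun _ : Fin n => Finset.Icc (-(M : ℤ)) (M : ℤ),
      if ∑ i, j i = s then adjOrdered (List.ofFn j) f else 0 := by
  rw [boxSum, LinearMap.sum_apply]
  refine Finset.sum_congr rfl fun j _ => ?_
  split_ifs <;> rfl

theorem boxSum_zero (M : ℕ) (s : ℤ) (f : Fock) : boxSum 0 M s f = if s = 0 then f else 0 := by
  rw [boxSum_apply]
  simp [eq_comm]

theorem sum_Icc_neg (M : ℕ) (F : ℤ → Fock) : ∑ a ∈ Finset.Icc (-(M : ℤ)) (M : ℤ), F a =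
    F 0 + ∑ m ∈ Finset.range M, (F (m + 1) + F (-(m + 1))) := by
  induction M with
  | zero => simp
  | succ M ih =>
    have : Finset.Icc (-((M + 1 : ℕ) : ℤ)) ((M + 1 : ℕ) : ℤ) =
        insert ((M : ℤ) + 1) (insert (-((M : ℤ) + 1)) (Finset.Icc (-(M : ℤ)) (M : ℤ))) := by
      ext a
      simp only [Finset.mem_insert, Finset.mem_Icc]
      push_cast
      omega
    rw [this, Finset.sum_insert, Finset.sum_insert, ih, Finset.sum_range_succ]
    · abel
    · simp only [Finset.mem_Icc]
      omega
    · simp only [Finset.mem_insert, Finset.mem_Icc]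
      omega

/-- The first index is split off: if positive it multiplies from outside, if negative it
differentiates `f` before the other factors act. The total `s` of the remaining indices shifts,
hence the inductions below over all `s`. -/
theorem boxSum_succ (n M : ℕ) (s : ℤ) (f : Fock) : boxSum (n + 1) M s f =
    ∑ m ∈ Finset.range M, (MvPolynomial.X m.succPNat * boxSum n M (s - (m + 1)) f +
      ((m + 1 : ℕ) : ℚ) • boxSum n M (s + (m + 1)) (MvPolynomial.pderiv m.succPNat f)) := by
  have h1 : boxSum (n + 1) M s f = ∑ a ∈ Finset.Icc (-(M : ℤ)) (M : ℤ),
      ∑ j ∈ Fintype.piFinset fun _ : Fin n => Finset.Icc (-(M : ℤ)) (M : ℤ),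
        if ∑ i, j i = s - a then adjOrdered (a :: List.ofFn j) f else 0 := by
    rw [boxSum_apply, ← Finset.sum_product']
    symm
    refine Finset.sum_nbij' (fun p => Fin.cons p.1 p.2) (fun j => (j 0, Fin.tail j)) ?_ ?_ ?_ ?_ ?_
    · rintro ⟨a, j⟩ h
      rw [Finset.mem_product, Fintype.mem_piFinset] at h
      rw [Fintype.mem_piFinset]
      intro i
      refine Fin.cases ?_ (fun i => ?_) i
      · exact h.1
      · exact h.2 i
    · intro j h
      rw [Fintype.mem_piFinset] at h
      rw [Finset.mem_product, Fintype.mem_piFinset]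
      exact ⟨h 0, fun i => h i.succ⟩
    · rintro ⟨a, j⟩ _
      simp
    · intro j _
      simp
    · rintro ⟨a, j⟩ _
      simp only [Fin.sum_univ_succ, Fin.cons_zero, Fin.cons_succ, List.ofFn_succ]
      congr 1
      exact propext ⟨fun h => by linarith, fun h => by linarith⟩
  rw [h1, sum_Icc_neg]
  simp only [adjOrdered_cons_zero, ite_self, Finset.sum_const_zero, zero_add]
  refine Finset.sum_congr rfl fun m _ => ?_
  have hm : ((m : ℤ) + 1) = ((m.succPNat : ℕ) : ℤ) := by simp
  rw [hm, boxSum_apply, boxSum_apply, Finset.mul_sum, Finset.smul_sum]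
  congr 1
  · refine Finset.sum_congr rfl fun j _ => ?_
    rw [adjOrdered_cons_pos, mul_ite, mul_zero]
  · refine Finset.sum_congr rfl fun j _ => ?_
    rw [adjOrdered_cons_neg, smul_ite, smul_zero, sub_neg_eq_add]
    rfl

/-- The coefficient of a power series at an integer, zero at negative integers. -/
def coeffInt {R : Type*} [CommSemiring R] (s : ℤ) : PowerSeries R →ₗ[R] R :=
  if 0 ≤ s then PowerSeries.coeff s.toNat else 0

theorem coeffInt_natCast {R : Type*} [CommSemiring R] (n : ℕ) (p : PowerSeries R) :
    coeffInt (n : ℤ) p = PowerSeries.coeff n p := by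
  simp [coeffInt]

theorem coeffInt_of_neg {R : Type*} [CommSemiring R] {s : ℤ} (hs : s < 0) (p : PowerSeries R) :
    coeffInt s p = 0 := by
  simp [coeffInt, not_le.2 hs]

theorem coeffInt_one {R : Type*} [CommSemiring R] (s : ℤ) :
    coeffInt s (1 : PowerSeries R) = if s = 0 then 1 else 0 := by
  rcases lt_or_ge s 0 with h | h
  · rw [coeffInt_of_neg h, if_neg h.ne]
  · lift s to ℕ using h
    rw [coeffInt_natCast, PowerSeries.coeff_one]
    simp

theorem coeffInt_C_mul_X_pow_mul {R : Type*} [CommSemiring R] (s : ℤ) (c : R) (m : ℕ)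
    (p : PowerSeries R) :
    coeffInt s (PowerSeries.C c * PowerSeries.X ^ m * p) = c * coeffInt (s - m) p := by
  rcases lt_or_ge s 0 with h | h
  · rw [coeffInt_of_neg h, coeffInt_of_neg (by omega), mul_zero]
  · lift s to ℕ using h
    rw [coeffInt_natCast, mul_assoc, PowerSeries.coeff_C_mul, PowerSeries.coeff_X_pow_mul']
    split_ifs with hm
    · rw [← Nat.cast_sub hm, coeffInt_natCast]
    · rw [coeffInt_of_neg (by omega)]

/-- The truncated field `∑_{0 < a ≤ M} p_a X^a`. -/
def truncField (M : ℕ) : PowerSeries Fock :=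
  ∑ m ∈ Finset.range M, PowerSeries.C (MvPolynomial.X m.succPNat) * PowerSeries.X ^ (m + 1)

theorem coeffInt_truncField_mul (M : ℕ) (s : ℤ) (p : PowerSeries Fock) :
    coeffInt s (truncField M * p) =
      ∑ m ∈ Finset.range M, MvPolynomial.X m.succPNat * coeffInt (s - (m + 1)) p := by
  rw [truncField, Finset.sum_mul, map_sum]
  refine Finset.sum_congr rfl fun m _ => ?_
  rw [coeffInt_C_mul_X_pow_mul]
  push_cast
  rfl

theorem boxSum_one (n M : ℕ) (s : ℤ) : boxSum n M s 1 = coeffInt s (truncField M ^ n) := by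
  induction n generalizing s with
  | zero => rw [boxSum_zero, pow_zero, coeffInt_one]
  | succ n ih =>
    rw [boxSum_succ, pow_succ', coeffInt_truncField_mul]
    refine Finset.sum_congr rfl fun m _ => ?_
    rw [ih, MvPolynomial.pderiv_one, map_zero, smul_zero, add_zero]

theorem sum_range_pderiv_X (M : ℕ) (l : ℕ+) (hl : (l : ℕ) ≤ M)
    (T : ℕ → Module.End ℚ Fock) (h : Fock) :
    ∑ m ∈ Finset.range M, ((m + 1 : ℕ) : ℚ) •
      T (m + 1) (h * MvPolynomial.pderiv m.succPNat (MvPolynomial.X l)) =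
        ((l : ℕ) : ℚ) • T l h := by
  classical
  have hpos := l.pos
  rw [Finset.sum_eq_single_of_mem ((l : ℕ) - 1) (by rw [Finset.mem_range]; omega)]
  · have h1 : ((l : ℕ) - 1).succPNat = l := PNat.eq (by simp; omega)
    rw [h1, MvPolynomial.pderiv_X_self, mul_one, Nat.sub_add_cancel hpos]
  · intro m _ hm
    rw [MvPolynomial.pderiv_X_of_ne, mul_zero, map_zero, smul_zero]
    rintro rfl
    simp at hm

/-- At most one derivative can act on `X l`. It has `n` possible positions and index `-l`, and the
other `n - 1` indices are positive with sum `s + l`. -/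
theorem boxSum_X (n M : ℕ) (s : ℤ) (l : ℕ+) (hl : (l : ℕ) ≤ M) :
    boxSum n M s (MvPolynomial.X l) = MvPolynomial.X l * coeffInt s (truncField M ^ n) +
      ((n : ℚ) * (l : ℕ)) • coeffInt (s + (l : ℕ)) (truncField M ^ (n - 1)) := by
  induction n generalizing s with
  | zero => simp [boxSum_zero, coeffInt_one]
  | succ n ih =>
    have h2 := sum_range_pderiv_X M l hl (fun m => boxSum n M (s + m)) 1
    simp only [one_mul, Nat.cast_add, Nat.cast_one] at h2
    rw [boxSum_succ, Finset.sum_add_distrib]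
    push_cast
    rw [h2, boxSum_one, pow_succ', coeffInt_truncField_mul]
    simp only [ih]
    have h3 : (n : ℚ) • coeffInt (s + (l : ℕ)) (truncField M ^ n) =
        ∑ m ∈ Finset.range M, (n : ℚ) • (MvPolynomial.X m.succPNat *
          coeffInt (s - (m + 1) + (l : ℕ)) (truncField M ^ (n - 1))) := by
      rcases n with _ | n
      · simp
      · rw [pow_succ', coeffInt_truncField_mul, Nat.add_sub_cancel, Finset.smul_sum]
        refine Finset.sum_congr rfl fun m _ => ?_
        rw [show s - (m + 1) + (l : ℕ) = s + (l : ℕ) - ((m : ℤ) + 1) by ring]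
    rw [add_mul, add_smul, one_mul, mul_comm (n : ℚ), mul_smul, h3, ← add_assoc, Finset.mul_sum,
      Finset.smul_sum, ← Finset.sum_add_distrib]
    congr 1
    refine Finset.sum_congr rfl fun m _ => ?_
    simp only [MvPolynomial.smul_eq_C_mul, map_mul]
    ring

/-- The last term collects the products with two derivatives, one for each variable, in `n(n-1)`
ordered positions. The other terms come from at most one derivative; the product with none is
counted twice by the first two and subtracted once. -/
theorem boxSum_X_mul_X (n M : ℕ) (s : ℤ) (l l' : ℕ+) (hl : (l : ℕ) ≤ M) (hl' : (l' : ℕ) ≤ M) :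
    boxSum n M s (MvPolynomial.X l * MvPolynomial.X l') =
      MvPolynomial.X l * boxSum n M s (MvPolynomial.X l') +
      MvPolynomial.X l' * boxSum n M s (MvPolynomial.X l) -
      MvPolynomial.X l * MvPolynomial.X l' * coeffInt s (truncField M ^ n) +
      ((n : ℚ) * (n - 1) * (l : ℕ) * (l' : ℕ)) •
        coeffInt (s + (l : ℕ) + (l' : ℕ)) (truncField M ^ (n - 2)) := by
  simp only [boxSum_X _ _ _ _ hl, boxSum_X _ _ _ _ hl']
  induction n generalizing s with
  | zero =>
    simp only [boxSum_zero, coeffInt_one, pow_zero]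
    split_ifs <;> simp [mul_comm]
  | succ n ih =>
    have h2 := sum_range_pderiv_X M l hl (fun m => boxSum n M (s + m)) (MvPolynomial.X l')
    have h2' := sum_range_pderiv_X M l' hl' (fun m => boxSum n M (s + m)) (MvPolynomial.X l)
    simp only [Nat.cast_add, Nat.cast_one] at h2 h2'
    rw [boxSum_succ]
    simp only [Derivation.leibniz, smul_eq_mul, map_add, smul_add, Finset.sum_add_distrib]
    push_cast
    rw [h2, h2', boxSum_X _ _ _ _ hl, boxSum_X _ _ _ _ hl', pow_succ', coeffInt_truncField_mul]
    simp only [ih]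
    have h3 : ∀ l : ℕ+, (n : ℚ) • coeffInt (s + (l : ℕ)) (truncField M ^ n) =
        ∑ m ∈ Finset.range M, (n : ℚ) • (MvPolynomial.X m.succPNat *
          coeffInt (s - (m + 1) + (l : ℕ)) (truncField M ^ (n - 1))) := by
      intro l
      rcases n with _ | n
      · simp
      · rw [pow_succ', coeffInt_truncField_mul, Nat.add_sub_cancel, Finset.smul_sum]
        refine Finset.sum_congr rfl fun m _ => ?_
        rw [show s - (m + 1) + (l : ℕ) = s + (l : ℕ) - ((m : ℤ) + 1) by ring]
    have h4 : ((n : ℚ) * (n - 1)) • coeffInt (s + (l : ℕ) + (l' : ℕ)) (truncField M ^ (n - 1)) =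
        ∑ m ∈ Finset.range M, ((n : ℚ) * (n - 1)) • (MvPolynomial.X m.succPNat *
          coeffInt (s - (m + 1) + (l : ℕ) + (l' : ℕ)) (truncField M ^ (n - 2))) := by
      rcases n with _ | _ | n
      · simp
      · simp
      · rw [show n + 1 + 1 - 1 = n + 1 from rfl, show n + 1 + 1 - 2 = n from rfl, pow_succ',
          coeffInt_truncField_mul, Finset.smul_sum]
        refine Finset.sum_congr rfl fun m _ => ?_
        rw [show s - (m + 1) + (l : ℕ) + (l' : ℕ) = s + (l : ℕ) + (l' : ℕ) - ((m : ℤ) + 1) by ring]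
    rw [show s + (l' : ℕ) + (l : ℕ) = s + (l : ℕ) + (l' : ℕ) by ring]
    have h3l := h3 l
    have h3l' := h3 l'
    simp only [MvPolynomial.smul_eq_C_mul] at h3l h3l' h4 ⊢
    -- Both sides are combinations of four sums over the split-off index: with neither variable
    -- differentiated, with one of them, or with both.
    have h5 : ∀ a b c d e : ℕ → Fock, ∀ u v w x : Fock, (∀ m, a m = u * b m + v * c m + w * d m +
        x * e m) → ∑ m ∈ Finset.range M, a m = u * ∑ m ∈ Finset.range M, b m +
        v * ∑ m ∈ Finset.range M, c m + w * ∑ m ∈ Finset.range M, d m +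
        x * ∑ m ∈ Finset.range M, e m := by
      intro a b c d e u v w x h
      simp only [h, Finset.sum_add_distrib, Finset.mul_sum]
    rw [h5 _ (fun m => MvPolynomial.X m.succPNat * coeffInt (s - (m + 1)) (truncField M ^ n))
      (fun m => MvPolynomial.C (n : ℚ) * (MvPolynomial.X m.succPNat *
        coeffInt (s - (m + 1) + (l' : ℕ)) (truncField M ^ (n - 1))))
      (fun m => MvPolynomial.C (n : ℚ) * (MvPolynomial.X m.succPNat *
        coeffInt (s - (m + 1) + (l : ℕ)) (truncField M ^ (n - 1))))
      (fun m => MvPolynomial.C ((n : ℚ) * (n - 1)) * (MvPolynomial.X m.succPNat *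
        coeffInt (s - (m + 1) + (l : ℕ) + (l' : ℕ)) (truncField M ^ (n - 2))))
      (MvPolynomial.X l * MvPolynomial.X l') (MvPolynomial.X l * MvPolynomial.C ((l' : ℕ) : ℚ))
      (MvPolynomial.X l' * MvPolynomial.C ((l : ℕ) : ℚ))
      (MvPolynomial.C ((l : ℕ) : ℚ) * MvPolynomial.C ((l' : ℕ) : ℚ)) (fun m => ?_),
      ← h3l', ← h3l, ← h4]
    · simp only [map_mul, map_add, map_sub, map_one]
      ring
    · simp only [map_mul, map_sub, map_one]
      ring

/-! ### Locally finite sums of normally ordered operators -/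

/-- The sum of all adjoint normally ordered products of length `n` and total index `-k`,
with weights `w`. -/
def weightedOp (k n : ℕ) (w : (Fin n → ℤ) → ℚ) : Module.End ℚ Fock where
  toFun f := ∑ᶠ j : {j : Fin n → ℤ // ∑ i, j i = -(k : ℤ)},
    w j.1 • adjOrdered (List.ofFn j.1) f
  map_add' f g := by
    rw [← finsum_add_distrib (finite_support_adjOrdered k n w f)
      (finite_support_adjOrdered k n w g)]
    simp only [map_add, smul_add]
  map_smul' c f := by
    rw [RingHom.id_apply, smul_finsum' c (finite_support_adjOrdered k n w f)]
    refine finsum_congr fun j => ?_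
    rw [map_smul, smul_comm]

theorem weightedOp_apply (k n : ℕ) (w : (Fin n → ℤ) → ℚ) (f : Fock) :
    weightedOp k n w f = ∑ᶠ j : {j : Fin n → ℤ // ∑ i, j i = -(k : ℤ)},
      w j.1 • adjOrdered (List.ofFn j.1) f := rfl

/-- One finite index set serves several polynomials at once, so differential-order identities pass
from single products to the infinite sum term by term. -/
theorem exists_weightedOp_eq_sum (k n : ℕ) (w : (Fin n → ℤ) → ℚ) (F : Finset Fock) :
    ∃ s : Finset {j : Fin n → ℤ // ∑ i, j i = -(k : ℤ)}, ∀ f ∈ F,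
      weightedOp k n w f = ∑ j ∈ s, w j.1 • adjOrdered (List.ofFn j.1) f := by
  classical
  refine ⟨F.biUnion fun f => (finite_support_adjOrdered k n w f).toFinset, fun f hf => ?_⟩
  rw [weightedOp_apply]
  refine finsum_eq_sum_of_support_subset _ fun j hj => ?_
  simp only [Finset.coe_biUnion, Set.mem_iUnion]
  exact ⟨f, hf, by simpa using hj⟩

theorem weightedOp_add (k n : ℕ) (w w' : (Fin n → ℤ) → ℚ) :
    weightedOp k n (w + w') = weightedOp k n w + weightedOp k n w' := by
  refine LinearMap.ext fun f => ?_
  rw [LinearMap.add_apply, weightedOp_apply, weightedOp_apply, weightedOp_apply,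
    ← finsum_add_distrib (finite_support_adjOrdered k n w f) (finite_support_adjOrdered k n w' f)]
  simp only [Pi.add_apply, add_smul]

theorem weightedOp_mem {k n : ℕ} {w : (Fin n → ℤ) → ℚ} {f : Fock} {S : Submodule ℚ Fock}
    (h : ∀ j : Fin n → ℤ, ∑ i, j i = -(k : ℤ) → w j ≠ 0 → adjOrdered (List.ofFn j) f ∈ S) :
    weightedOp k n w f ∈ S := by
  obtain ⟨s, hs⟩ := exists_weightedOp_eq_sum k n w {f}
  rw [hs f (Finset.mem_singleton_self f)]
  refine Submodule.sum_mem _ fun j _ => ?_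
  by_cases h0 : w j.1 = 0
  · rw [h0, zero_smul]
    exact zero_mem _
  · exact Submodule.smul_mem _ _ (h j.1 j.2 h0)

theorem weightedOp_congr {k n : ℕ} {w w' : (Fin n → ℤ) → ℚ} {f : Fock}
    (h : ∀ j : Fin n → ℤ, ∑ i, j i = -(k : ℤ) →
      w j • adjOrdered (List.ofFn j) f = w' j • adjOrdered (List.ofFn j) f) :
    weightedOp k n w f = weightedOp k n w' f := by
  rw [weightedOp_apply, weightedOp_apply]
  exact finsum_congr fun j => h j.1 j.2

theorem isFirstOrder_weightedOp {k n : ℕ} {w : (Fin n → ℤ) → ℚ}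
    (h : ∀ j, w j ≠ 0 → negCount (List.ofFn j) = 1) : IsFirstOrder (weightedOp k n w) := by
  classical
  intro f g
  obtain ⟨s, hs⟩ := exists_weightedOp_eq_sum k n w {f, g, f * g}
  rw [hs (f * g) (by simp), hs f (by simp), hs g (by simp), Finset.mul_sum, Finset.mul_sum,
    ← Finset.sum_add_distrib]
  refine Finset.sum_congr rfl fun j _ => ?_
  by_cases h0 : w j.1 = 0
  · simp [h0]
  · rw [isFirstOrder_adjOrdered (h _ h0), smul_add, mul_smul_comm, mul_smul_comm]

theorem isSecondOrder_weightedOp {k n : ℕ} {w : (Fin n → ℤ) → ℚ}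
    (h : ∀ j, w j ≠ 0 → negCount (List.ofFn j) = 2) : IsSecondOrder (weightedOp k n w) := by
  classical
  intro f g e
  obtain ⟨s, hs⟩ := exists_weightedOp_eq_sum k n w {f, g, e, f * g, f * e, g * e, f * g * e}
  rw [hs f (by simp), hs g (by simp), hs e (by simp), hs (f * g) (by simp), hs (f * e) (by simp),
    hs (g * e) (by simp), hs (f * g * e) (by simp)]
  simp only [Finset.mul_sum, ← Finset.sum_add_distrib, ← Finset.sum_sub_distrib]
  refine Finset.sum_congr rfl fun j _ => ?_
  by_cases h0 : w j.1 = 0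
  · simp [h0]
  · rw [isSecondOrder_adjOrdered (h _ h0)]
    simp only [MvPolynomial.smul_eq_C_mul]
    ring

/-- With constant weight one, the infinite sum acts on a given polynomial as a truncated one, whose
values are coefficients of powers of the field. -/
theorem exists_weightedOp_one_eq_boxSum (k n : ℕ) (f : Fock) : ∃ M₀ : ℕ, ∀ M, M₀ ≤ M →
    weightedOp k n 1 f = boxSum n M (-(k : ℤ)) f := by
  classical
  obtain ⟨M₀, hM₀⟩ := exists_box_adjOrdered k n f
  refine ⟨M₀, fun M hM => ?_⟩
  have h1 : weightedOp k n 1 f = ∑ᶠ j : Fin n → ℤ, if ∑ i, j i = -(k : ℤ) then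
      adjOrdered (List.ofFn j) f else 0 := by
    rw [weightedOp_apply]
    simp only [Pi.one_apply, one_smul]
    exact (finsum_subtype_eq_finsum_cond (f := fun j : Fin n → ℤ => adjOrdered (List.ofFn j) f)
      fun j => ∑ i, j i = -(k : ℤ)).trans (finsum_congr fun j => finsum_eq_if)
  rw [h1, boxSum_apply]
  refine finsum_eq_sum_of_support_subset _ fun j hj => ?_
  rw [Function.mem_support] at hj
  split_ifs at hj with hs
  · rw [Finset.mem_coe, Fintype.mem_piFinset]
    intro i
    have := hM₀ j hs hj i
    rw [Finset.mem_Icc] at this ⊢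
    constructor <;> omega
  · exact absurd rfl hj

/-! ### The adjoint of the leaky operator -/

/-- The adjoint of `(1 / r) F_r^k`. -/
def leakyAdj (k r : ℕ) : Module.End ℚ Fock :=
  ∑ n ∈ Finset.Icc 1 (r + 1), ((1 / (r : ℚ)) * (r ! : ℚ) * (1 / (n ! : ℚ))) •
    weightedOp k n (opCoeff r)

theorem pairing_leakyOp (k r : ℕ) (f g : Fock) :
    pairing f (((1 / (r : ℚ)) • leakyOp k r) g) = pairing (leakyAdj k r f) g := by
  have h : leakyOp k r g = (r ! : ℚ) • ∑ n ∈ Finset.Icc 1 (r + 1), (1 / (n ! : ℚ)) •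
      ∑ᶠ j : {j : Fin n → ℤ // ∑ i, j i = -(k : ℤ)}, opCoeff r j.1 • normalOrdered j.1 g := rfl
  have h2 : ∀ n, pairing f (∑ᶠ j : {j : Fin n → ℤ // ∑ i, j i = -(k : ℤ)},
      opCoeff r j.1 • normalOrdered j.1 g) = pairing (weightedOp k n (opCoeff r) f) g := by
    intro n
    rw [weightedOp_apply]
    change _ = pairing.flip g _
    have e1 := (pairing f).toAddMonoidHom.map_finsum (finite_support_normalOrdered k r n g)
    have e2 := (pairing.flip g).toAddMonoidHom.map_finsum
      (finite_support_adjOrdered k n (opCoeff r) f)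
    simp only [LinearMap.toAddMonoidHom_coe] at e1 e2
    rw [e1, e2]
    refine finsum_congr fun j => ?_
    rw [map_smul, map_smul, pairing_normalOrdered, LinearMap.flip_apply]
  rw [LinearMap.smul_apply, h, map_smul, map_smul, map_sum, leakyAdj, LinearMap.sum_apply,
    map_sum, LinearMap.sum_apply, Finset.smul_sum, Finset.smul_sum]
  refine Finset.sum_congr rfl fun n _ => ?_
  rw [map_smul, h2, LinearMap.smul_apply, map_smul, LinearMap.smul_apply]
  simp only [smul_eq_mul]
  ring

theorem pairing_leakyOp_pow (k r b : ℕ) (f g : Fock) :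
    pairing f ((((1 / (r : ℚ)) • leakyOp k r) ^ b) g) = pairing ((leakyAdj k r ^ b) f) g := by
  induction b generalizing f with
  | zero => rfl
  | succ b ih =>
    rw [pow_succ', Module.End.mul_apply, pairing_leakyOp, ih, pow_succ, Module.End.mul_apply]

theorem vev_eq_pairing (A : Module.End ℚ Fock) : vev A = pairing 1 (A 1) := by
  rw [vev, ← MvPolynomial.C_1, ← MvPolynomial.monomial_zero', pairing_monomial]
  simp [hallNorm, MvPolynomial.constantCoeff_eq]

theorem J_neg_pow_one (q : ℕ+) (d : ℕ) :
    (((1 / ((q : ℕ) : ℚ)) • J (-((q : ℕ) : ℤ))) ^ d) 1 =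
      ((1 / ((q : ℕ) : ℚ)) ^ d) • (MvPolynomial.monomial (Finsupp.single q d) 1 : Fock) := by
  induction d with
  | zero => simp
  | succ d ih =>
    rw [pow_succ', Module.End.mul_apply, ih, LinearMap.smul_apply, map_smul, J_neg_coe_apply,
      MvPolynomial.X, MvPolynomial.monomial_mul, ← Finsupp.single_add, one_mul, smul_smul,
      pow_succ', add_comm 1 d]

/-- The norm `q^d d!` of `p_q^d` cancels exactly the normalisation of the right profile. -/
theorem pairing_J_neg_pow (q : ℕ+) (d : ℕ) (f : Fock) :
    pairing f ((((1 / ((q : ℕ) : ℚ)) • J (-((q : ℕ) : ℤ))) ^ d) 1) / (d ! : ℚ) =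
      MvPolynomial.coeff (Finsupp.single q d) f := by
  have hq : ((q : ℕ) : ℚ) ≠ 0 := by exact_mod_cast q.pos.ne'
  have hd : (d ! : ℚ) ≠ 0 := by exact_mod_cast d.factorial_ne_zero
  rw [J_neg_pow_one, map_smul, pairing_comm, pairing_monomial, hallNorm,
    Finsupp.prod_single_index (by simp), smul_eq_mul, one_div, inv_pow]
  field_simp

theorem disconnectedNumber_singleton (k r b d : ℕ) (q l : ℕ+) :
    disconnectedNumber k r q [l] b d = 1 / ((l : ℕ) : ℚ) *
      MvPolynomial.coeff (Finsupp.single q d) ((leakyAdj k r ^ b) (MvPolynomial.X l)) := by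
  rw [disconnectedNumber, vev_eq_pairing, ← pairing_J_neg_pow]
  simp only [List.map_cons, List.map_nil, List.prod_cons, List.prod_nil, mul_one,
    Module.End.mul_apply, LinearMap.smul_apply, map_smul, smul_eq_mul]
  rw [← neg_neg ((l : ℕ) : ℤ), ← pairing_J, J_neg_coe_apply, mul_one, pairing_leakyOp_pow,
    mul_div_assoc]

theorem disconnectedNumber_pair (k r b d : ℕ) (q l m : ℕ+) :
    disconnectedNumber k r q [l, m] b d = 1 / (((l : ℕ) : ℚ) * (m : ℕ)) *
      MvPolynomial.coeff (Finsupp.single q d)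
        ((leakyAdj k r ^ b) (MvPolynomial.X l * MvPolynomial.X m)) := by
  rw [disconnectedNumber, vev_eq_pairing, ← pairing_J_neg_pow]
  simp only [List.map_cons, List.map_nil, List.prod_cons, List.prod_nil, mul_one,
    Module.End.mul_apply, LinearMap.smul_apply, map_smul, smul_eq_mul]
  rw [← neg_neg ((l : ℕ) : ℤ), ← pairing_J, J_neg_coe_apply, mul_one, ← neg_neg ((m : ℕ) : ℤ),
    ← pairing_J, J_neg_coe_apply, pairing_leakyOp_pow, mul_comm (MvPolynomial.X m)]
  ring

/-! ### Coefficients of the operator -/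

theorem constantCoeff_serS : PowerSeries.constantCoeff serS = 1 := by
  rw [← PowerSeries.coeff_zero_eq_constantCoeff_apply, serS, PowerSeries.coeff_mk]
  simp

theorem coeff_one_serS : PowerSeries.coeff 1 serS = 0 := by
  simp [serS]

theorem constantCoeff_prod_rescale_serS {n : ℕ} (j : Fin n → ℤ) :
    PowerSeries.constantCoeff (∏ i, PowerSeries.rescale (j i : ℚ) serS) = 1 := by
  rw [map_prod]
  refine Finset.prod_eq_one fun i _ => ?_
  rw [← PowerSeries.coeff_zero_eq_constantCoeff_apply, PowerSeries.coeff_rescale, pow_zero,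
    one_mul, PowerSeries.coeff_zero_eq_constantCoeff_apply, constantCoeff_serS]

theorem coeff_one_mul_eq_zero {f g : PowerSeries ℚ} (hf : PowerSeries.coeff 1 f = 0)
    (hg : PowerSeries.coeff 1 g = 0) : PowerSeries.coeff 1 (f * g) = 0 := by
  rw [PowerSeries.coeff_mul, Finset.Nat.antidiagonal_succ]
  simp [hf, hg]

theorem coeff_one_inv_serS : PowerSeries.coeff 1 serS⁻¹ = 0 := by
  have h := PowerSeries.mul_inv_cancel serS (by rw [constantCoeff_serS]; exact one_ne_zero)
  have h1 := congrArg (PowerSeries.coeff 1) h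
  rw [PowerSeries.coeff_mul, Finset.Nat.antidiagonal_succ] at h1
  simpa [coeff_one_serS, constantCoeff_serS, PowerSeries.coeff_one] using h1

theorem opCoeff_succ (r : ℕ) (j : Fin (r + 1) → ℤ) : opCoeff r j = 1 := by
  rw [opCoeff, Nat.sub_self, PowerSeries.coeff_zero_eq_constantCoeff_apply, map_mul,
    constantCoeff_prod_rescale_serS, PowerSeries.constantCoeff_inv, constantCoeff_serS]
  norm_num

/-- A coefficient of `u^1` is extracted from a product of even series. This creates the gap of two
between consecutive relevant degrees. -/
theorem opCoeff_self (r : ℕ) (j : Fin r → ℤ) : opCoeff r j = 0 := by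
  rw [opCoeff, Nat.add_sub_cancel_left]
  refine coeff_one_mul_eq_zero ?_ coeff_one_inv_serS
  refine Finset.prod_induction _ (fun f : PowerSeries ℚ => PowerSeries.coeff 1 f = 0)
    (fun f g => coeff_one_mul_eq_zero) (by simp [PowerSeries.coeff_one]) fun i _ => ?_
  rw [PowerSeries.coeff_rescale, coeff_one_serS, mul_zero]

/-! ### The leading and subleading parts of the operator -/

theorem sum_nonneg_of_negCount {l : List ℤ} (h : negCount l = 0) : 0 ≤ l.sum := by
  refine List.sum_nonneg fun a ha => ?_
  by_contra hlt
  exact absurd (List.countP_eq_zero.1 h a ha) (by simpa using hlt)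

/-- Nonnegative indices with nonpositive sum are all zero, and `J 0 = 0`. Since leaky vertices have
total index `-k ≤ 0`, they always contain a derivative. -/
theorem adjOrdered_eq_zero_of_negCount {l : List ℤ} (hl : l ≠ []) (h : negCount l = 0)
    (hs : l.sum ≤ 0) (f : Fock) : adjOrdered l f = 0 := by
  obtain _ | ⟨a, l⟩ := l
  · exact absurd rfl hl
  rcases int_cases_pnat a with rfl | ⟨i, rfl⟩ | ⟨i, rfl⟩
  · exact adjOrdered_cons_zero _ _
  · rw [negCount_cons_pos] at h
    have := sum_nonneg_of_negCount h
    have := i.pos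
    rw [List.sum_cons] at hs
    omega
  · rw [negCount_cons_neg] at h
    omega

/-- The part of the `n`-leg vertex with number of derivatives in `C`. -/
def negPart (k r n : ℕ) (C : Finset ℕ) : Module.End ℚ Fock :=
  weightedOp k n fun j => if negCount (List.ofFn j) ∈ C then opCoeff r j else 0

theorem ofFn_ne_nil {n : ℕ} (hn : 1 ≤ n) (j : Fin n → ℤ) : List.ofFn j ≠ [] := by
  intro h
  have := congrArg List.length h
  simp at this
  omega

theorem adjOrdered_ofFn_mem {k n : ℕ} {d e : ℤ} {f : Fock} (hf : f ∈ bihomogeneous d e)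
    (j : Fin n → ℤ) (hj : ∑ i, j i = -(k : ℤ)) : adjOrdered (List.ofFn j) f ∈
      bihomogeneous (d + n - 2 * negCount (List.ofFn j)) (e - k) := by
  have := adjOrdered_mem_bihomogeneous (List.ofFn j) hf
  rwa [List.length_ofFn, List.sum_ofFn, hj, ← sub_eq_add_neg] at this

theorem negPart_singleton_mem {k r n c : ℕ} {d e : ℤ} {f : Fock} (hf : f ∈ bihomogeneous d e) :
    negPart k r n {c} f ∈ bihomogeneous (d + n - 2 * c) (e - k) := by
  refine weightedOp_mem fun j hj hne => ?_
  have hc : negCount (List.ofFn j) = c := by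
    by_contra h
    exact hne (if_neg (by simpa using h))
  rw [← hc]
  exact adjOrdered_ofFn_mem hf j hj

theorem negPart_pair (k r n : ℕ) {c c' : ℕ} (h : c ≠ c') :
    negPart k r n {c, c'} = negPart k r n {c} + negPart k r n {c'} := by
  rw [negPart, negPart, negPart, ← weightedOp_add]
  congr 1
  funext j
  simp only [Finset.mem_insert, Finset.mem_singleton, Pi.add_apply]
  by_cases h1 : negCount (List.ofFn j) = c
  · simp [h1, h]
  · simp [h1]

theorem weightedOp_sub_negPart_mem {k r n : ℕ} (hn : 1 ≤ n) (C : Finset ℕ) {d e D : ℤ} {f : Fock}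
    (hf : f ∈ bihomogeneous d e) (hC : ∀ c : ℕ, 1 ≤ c → c ∉ C → d + n - 2 * c < D) :
    weightedOp k n (opCoeff r) f - negPart k r n C f ∈ degreeBelow D := by
  have h : weightedOp k n (opCoeff r) = negPart k r n C +
      weightedOp k n fun j => if negCount (List.ofFn j) ∈ C then 0 else opCoeff r j := by
    rw [negPart, ← weightedOp_add]
    congr 1
    funext j
    rw [Pi.add_apply]
    split_ifs <;> simp
  rw [h, LinearMap.add_apply, add_sub_cancel_left]
  refine weightedOp_mem fun j hj hne => ?_
  have hc : negCount (List.ofFn j) ∉ C := fun h => hne (if_pos h)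
  rcases Nat.eq_zero_or_pos (negCount (List.ofFn j)) with h0 | h0
  · rw [adjOrdered_eq_zero_of_negCount (ofFn_ne_nil hn j) h0]
    · exact zero_mem _
    · rw [List.sum_ofFn, hj]
      omega
  · exact bihomogeneous_le_degreeBelow (hC _ h0 hc) _ (adjOrdered_ofFn_mem hf j hj)

theorem isFirstOrder_negPart (k r n : ℕ) : IsFirstOrder (negPart k r n {1}) :=
  isFirstOrder_weightedOp fun j hne => by
    by_contra h
    exact hne (if_neg (by simpa using h))

theorem isSecondOrder_negPart (k r n : ℕ) : IsSecondOrder (negPart k r n {2}) :=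
  isSecondOrder_weightedOp fun j hne => by
    by_contra h
    exact hne (if_neg (by simpa using h))

/-- The numerical factor of the `n`-leg vertex in `(1 / r) F_r^k`. -/
def vertexFactor (r n : ℕ) : ℚ := (1 / (r : ℚ)) * (r ! : ℚ) * (1 / (n ! : ℚ))

/-- The leading part of `leakyAdj`: a derivation of degree `r - 1`. -/
def leadingOp (k r : ℕ) : Module.End ℚ Fock :=
  ∑ n ∈ Finset.Icc 1 (r + 1), vertexFactor r n •
    if n = r + 1 then negPart k r n {1} else 0

/-- The subleading part of `leakyAdj`: a second order operator of degree `r - 3`. -/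
def subleadingOp (k r : ℕ) : Module.End ℚ Fock :=
  ∑ n ∈ Finset.Icc 1 (r + 1), vertexFactor r n •
    if n = r + 1 then negPart k r n {2} else if n + 1 = r then negPart k r n {1} else 0

theorem leadingOp_eq (k r : ℕ) :
    leadingOp k r = vertexFactor r (r + 1) • negPart k r (r + 1) {1} := by
  rw [leadingOp, Finset.sum_eq_single_of_mem (r + 1) (by simp), if_pos rfl]
  intro n _ hn
  rw [if_neg hn, smul_zero]

theorem leadingOp_mem {k r : ℕ} {d e : ℤ} {f : Fock} (hf : f ∈ bihomogeneous d e) :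
    leadingOp k r f ∈ bihomogeneous (d + (r - 1)) (e - k) := by
  rw [leadingOp_eq]
  refine Submodule.smul_mem _ _ ?_
  convert negPart_singleton_mem (k := k) (r := r) (n := r + 1) (c := 1) hf using 2
  push_cast
  ring

theorem subleadingOp_mem {k r : ℕ} {d e : ℤ} {f : Fock} (hf : f ∈ bihomogeneous d e) :
    subleadingOp k r f ∈ bihomogeneous (d + (r - 3)) (e - k) := by
  rw [subleadingOp, LinearMap.sum_apply]
  refine Submodule.sum_mem _ fun n _ => Submodule.smul_mem _ _ ?_
  split_ifs with h1 h2
  · convert negPart_singleton_mem (k := k) (r := r) (n := n) (c := 2) hf using 2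
    subst h1
    push_cast
    ring
  · convert negPart_singleton_mem (k := k) (r := r) (n := n) (c := 1) hf using 2
    subst h2
    push_cast
    ring
  · exact zero_mem _

/-- Degree shifts are `n - 2c` with `1 ≤ c` and `n ≤ r + 1`. The value `r - 1` occurs only for `(n,
c) = (r+1, 1)`, and `r - 3` only for `(r+1, 2)` and `(r-1, 1)`. Everything else is lower, apart from
`n = r`. -/
theorem leakyAdj_sub_mem {k r : ℕ} {d e : ℤ} {f : Fock} (hf : f ∈ bihomogeneous d e) :
    leakyAdj k r f - leadingOp k r f - subleadingOp k r f ∈ degreeBelow (d + (r - 3)) := by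
  rw [leakyAdj, leadingOp, subleadingOp, LinearMap.sum_apply, LinearMap.sum_apply,
    LinearMap.sum_apply, ← Finset.sum_sub_distrib, ← Finset.sum_sub_distrib]
  refine Submodule.sum_mem _ fun n hn => ?_
  rw [Finset.mem_Icc] at hn
  simp only [LinearMap.smul_apply]
  rw [← vertexFactor, ← smul_sub, ← smul_sub]
  refine Submodule.smul_mem _ _ ?_
  split_ifs with h1 h2
  · rw [sub_sub, ← LinearMap.add_apply, ← negPart_pair _ _ _ (by norm_num)]
    refine weightedOp_sub_negPart_mem hn.1 _ hf fun c hc1 hc => ?_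
    simp only [Finset.mem_insert, Finset.mem_singleton] at hc
    omega
  · rw [LinearMap.zero_apply, sub_zero]
    refine weightedOp_sub_negPart_mem hn.1 _ hf fun c hc1 hc => ?_
    simp only [Finset.mem_singleton] at hc
    omega
  · rw [LinearMap.zero_apply, sub_zero, sub_zero]
    -- For `n = r` one derivative would give the shift `r - 2`, above the bound; these weights
    -- vanish identically.
    rcases eq_or_ne n r with rfl | h3
    · have : weightedOp k n (opCoeff n) f = 0 := by
        rw [weightedOp_apply]
        simp [opCoeff_self]
      rw [this]
      exact zero_mem _
    · have := weightedOp_sub_negPart_mem (k := k) (r := r) hn.1 ∅ (D := d + (r - 3)) hf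
        fun c hc1 _ => by omega
      rwa [show negPart k r n ∅ f = 0 by simp [negPart, weightedOp_apply], sub_zero] at this

theorem isFirstOrder_smul {T : Module.End ℚ Fock} (h : IsFirstOrder T) (c : ℚ) :
    IsFirstOrder (c • T) := by
  intro f g
  simp only [LinearMap.smul_apply, h f g, smul_add, mul_smul_comm]

theorem isSecondOrder_sum_smul (s : Finset ℕ) (c : ℕ → ℚ) (T : ℕ → Module.End ℚ Fock)
    (h : ∀ n, IsSecondOrder (T n)) : IsSecondOrder (∑ n ∈ s, c n • T n) := by
  intro f g e
  simp only [LinearMap.sum_apply, LinearMap.smul_apply, Finset.mul_sum, ← Finset.sum_add_distrib,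
    ← Finset.sum_sub_distrib]
  refine Finset.sum_congr rfl fun n _ => ?_
  rw [h n f g e]
  simp only [MvPolynomial.smul_eq_C_mul]
  ring

theorem isFirstOrder_leadingOp (k r : ℕ) : IsFirstOrder (leadingOp k r) := by
  rw [leadingOp_eq]
  exact isFirstOrder_smul (isFirstOrder_negPart _ _ _) _

theorem isSecondOrder_subleadingOp (k r : ℕ) : IsSecondOrder (subleadingOp k r) := by
  refine isSecondOrder_sum_smul _ _ _ fun n => ?_
  split_ifs
  · exact isSecondOrder_negPart _ _ _
  · exact (isFirstOrder_negPart _ _ _).isSecondOrder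
  · intro f g e
    simp

/-! ### Values on products of generators -/

/-- The field `∑_{a > 0} p_a X^a`. -/
def field : PowerSeries Fock :=
  PowerSeries.mk fun m => if 0 < m then MvPolynomial.X m.toPNat' else 0

theorem coeff_truncField (M m : ℕ) (h : m ≤ M) :
    PowerSeries.coeff m (truncField M) = PowerSeries.coeff m field := by
  rw [truncField, map_sum, field, PowerSeries.coeff_mk]
  simp only [PowerSeries.coeff_C_mul, PowerSeries.coeff_X_pow]
  rcases m with _ | m
  · simp
  · rw [Finset.sum_eq_single_of_mem m (by simp; omega)]
    · simp only [if_true, mul_one, if_pos (Nat.succ_pos m)]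
      rfl
    · intro b _ hb
      rw [if_neg (by omega), mul_zero]

theorem coeff_pow_congr {R : Type*} [CommRing R] {f g : PowerSeries R} {M : ℕ}
    (h : ∀ m ≤ M, PowerSeries.coeff m f = PowerSeries.coeff m g) (n : ℕ) {m : ℕ} (hm : m ≤ M) :
    PowerSeries.coeff m (f ^ n) = PowerSeries.coeff m (g ^ n) := by
  have h1 : (PowerSeries.X ^ (M + 1) : PowerSeries R) ∣ f - g := by
    rw [PowerSeries.X_pow_dvd_iff]
    intro m hm
    rw [map_sub, h m (by omega), sub_self]
  have h2 := PowerSeries.X_pow_dvd_iff.1 (h1.trans (sub_dvd_pow_sub_pow f g n)) m (by omega)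
  rwa [map_sub, sub_eq_zero] at h2

theorem coeffInt_truncField_pow (M n : ℕ) {s : ℤ} (h : s ≤ M) :
    coeffInt s (truncField M ^ n) = coeffInt s (field ^ n) := by
  rcases lt_or_ge s 0 with h0 | h0
  · rw [coeffInt_of_neg h0, coeffInt_of_neg h0]
  · lift s to ℕ using h0
    rw [coeffInt_natCast, coeffInt_natCast]
    exact coeff_pow_congr (M := M) (fun m hm => coeff_truncField M m hm) n (by omega)

theorem constantCoeff_field : PowerSeries.constantCoeff field = 0 := by
  rw [← PowerSeries.coeff_zero_eq_constantCoeff_apply, field, PowerSeries.coeff_mk]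
  simp

theorem coeffInt_field_pow_of_nonpos {s : ℤ} (hs : s ≤ 0) {n : ℕ} (hn : 1 ≤ n) :
    coeffInt s (field ^ n) = 0 := by
  rcases hs.lt_or_eq with h | rfl
  · exact coeffInt_of_neg h _
  · rw [← Nat.cast_zero, coeffInt_natCast, PowerSeries.coeff_zero_eq_constantCoeff_apply, map_pow,
      constantCoeff_field, zero_pow (by omega)]

/-- On a single variable the terms with no derivative or with several vanish, so restricting to one
derivative changes nothing and the constant-weight computation `boxSum_X` applies. -/
theorem negPart_one_X (k r : ℕ) (l : ℕ+) :
    negPart k r (r + 1) {1} (MvPolynomial.X l) =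
      (((r + 1 : ℕ) : ℚ) * (l : ℕ)) • coeffInt ((l : ℕ) - (k : ℤ)) (field ^ r) := by
  have h1 : negPart k r (r + 1) {1} (MvPolynomial.X l) =
      weightedOp k (r + 1) 1 (MvPolynomial.X l) := by
    refine weightedOp_congr fun j hj => ?_
    simp only [opCoeff_succ, Finset.mem_singleton, Pi.one_apply]
    split_ifs with hc
    · rfl
    · rcases Nat.lt_or_gt_of_ne hc with h | h
      · rw [adjOrdered_eq_zero_of_negCount (ofFn_ne_nil (by omega) j) (by omega)
          (by rw [List.sum_ofFn, hj]; omega), smul_zero, smul_zero]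
      · rw [adjOrdered_X h, smul_zero, smul_zero]
  obtain ⟨M, hM⟩ := exists_weightedOp_one_eq_boxSum k (r + 1) (MvPolynomial.X l)
  rw [h1, hM (M + (l : ℕ)) (by omega), boxSum_X _ _ _ _ (by omega), Nat.add_sub_cancel,
    coeffInt_truncField_pow _ _ (by omega), coeffInt_truncField_pow _ _ (by push_cast; omega),
    coeffInt_field_pow_of_nonpos (by omega) (by omega), mul_zero, zero_add, neg_add_eq_sub]

theorem leadingOp_X {k r : ℕ} (l : ℕ+) :
    leadingOp k r (MvPolynomial.X l) =
      (((l : ℕ) : ℚ) / r) • coeffInt ((l : ℕ) - (k : ℤ)) (field ^ r) := by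
  rw [leadingOp_eq, LinearMap.smul_apply, negPart_one_X, smul_smul, vertexFactor]
  congr 1
  have : (r ! : ℚ) ≠ 0 := by exact_mod_cast r.factorial_ne_zero
  rw [Nat.factorial_succ]
  push_cast
  field_simp

theorem negPart_two_X (k r : ℕ) (l : ℕ+) :
    negPart k r (r + 1) {2} (MvPolynomial.X l) = 0 := by
  have : negPart k r (r + 1) {2} (MvPolynomial.X l) = weightedOp k (r + 1) 0 (MvPolynomial.X l) := by
    refine weightedOp_congr fun j _ => ?_
    rw [Pi.zero_apply, zero_smul]
    split_ifs with hc
    · rw [adjOrdered_X (Finset.mem_singleton.1 hc).ge, smul_zero]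
    · rw [zero_smul]
  rw [this, weightedOp_apply]
  simp

/-- On a product of two variables the constant-weight operator is the sum of its first- and
second-order parts. The Leibniz rule for the first-order part accounts for all of `boxSum_X_mul_X`
except the term with two derivatives. -/
theorem negPart_two_X_mul_X {k r : ℕ} (l m : ℕ+) :
    negPart k r (r + 1) {2} (MvPolynomial.X l * MvPolynomial.X m) =
      (((r + 1 : ℕ) : ℚ) * r * (l : ℕ) * (m : ℕ)) •
        coeffInt ((l : ℕ) + (m : ℕ) - (k : ℤ)) (field ^ (r - 1)) := by
  have hT : ∀ f ∈ ({MvPolynomial.X l, MvPolynomial.X m, MvPolynomial.X l * MvPolynomial.X m} :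
      Set Fock), weightedOp k (r + 1) 1 f = negPart k r (r + 1) {1, 2} f := by
    intro f hf
    refine (weightedOp_congr fun j hj => ?_).symm
    simp only [opCoeff_succ, Finset.mem_insert, Finset.mem_singleton, Pi.one_apply]
    split_ifs with hc
    · rfl
    · rcases Nat.eq_zero_or_pos (negCount (List.ofFn j)) with h | h
      · rw [adjOrdered_eq_zero_of_negCount (ofFn_ne_nil (by omega) j) h
          (by rw [List.sum_ofFn, hj]; omega), smul_zero, smul_zero]
      · have h3 : 3 ≤ negCount (List.ofFn j) := by omega
        have : adjOrdered (List.ofFn j) f = 0 := by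
          rcases hf with rfl | rfl | rfl
          · exact adjOrdered_X (by omega) _
          · exact adjOrdered_X (by omega) _
          · exact adjOrdered_X_mul_X h3 _ _
        rw [this, smul_zero, smul_zero]
  obtain ⟨M₁, hM₁⟩ := exists_weightedOp_one_eq_boxSum k (r + 1) (MvPolynomial.X l)
  obtain ⟨M₂, hM₂⟩ := exists_weightedOp_one_eq_boxSum k (r + 1) (MvPolynomial.X m)
  obtain ⟨M₃, hM₃⟩ := exists_weightedOp_one_eq_boxSum k (r + 1)
    (MvPolynomial.X l * MvPolynomial.X m)
  have key := boxSum_X_mul_X (r + 1) (M₁ + M₂ + M₃ + (l : ℕ) + (m : ℕ)) (-(k : ℤ)) l m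
    (by omega) (by omega)
  rw [← hM₁ _ (by omega), ← hM₂ _ (by omega), ← hM₃ _ (by omega), hT _ (by simp), hT _ (by simp),
    hT _ (by simp), negPart_pair _ _ _ (by norm_num), LinearMap.add_apply, LinearMap.add_apply,
    LinearMap.add_apply, negPart_two_X, negPart_two_X, isFirstOrder_negPart,
    coeffInt_truncField_pow _ _ (by omega), coeffInt_truncField_pow _ _ (by push_cast; omega),
    coeffInt_field_pow_of_nonpos (by omega) (by omega), mul_zero, sub_zero, add_zero, add_zero,
    add_right_inj] at key
  rw [key, show r + 1 - 2 = r - 1 by omega,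
    show -(k : ℤ) + (l : ℕ) + (m : ℕ) = (l : ℕ) + (m : ℕ) - (k : ℤ) by ring]
  push_cast
  rw [add_sub_cancel_right]

theorem subleadingOp_X_mul_X {k r : ℕ} (hr : 1 ≤ r) (l m : ℕ+) :
    subleadingOp k r (MvPolynomial.X l * MvPolynomial.X m) =
      MvPolynomial.X l * subleadingOp k r (MvPolynomial.X m) +
      MvPolynomial.X m * subleadingOp k r (MvPolynomial.X l) +
      (((l : ℕ) : ℚ) * (m : ℕ)) •
        coeffInt ((l : ℕ) + (m : ℕ) - (k : ℤ)) (field ^ (r - 1)) := by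
  have h : ∀ n, (if n = r + 1 then negPart k r n {2} else if n + 1 = r then negPart k r n {1} else 0)
        (MvPolynomial.X l * MvPolynomial.X m) =
      MvPolynomial.X l * (if n = r + 1 then negPart k r n {2} else
        if n + 1 = r then negPart k r n {1} else 0) (MvPolynomial.X m) +
      MvPolynomial.X m * (if n = r + 1 then negPart k r n {2} else
        if n + 1 = r then negPart k r n {1} else 0) (MvPolynomial.X l) +
      if n = r + 1 then (((r + 1 : ℕ) : ℚ) * r * (l : ℕ) * (m : ℕ)) •
        coeffInt ((l : ℕ) + (m : ℕ) - (k : ℤ)) (field ^ (r - 1)) else 0 := by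
    intro n
    split_ifs with h1 h2
    · subst h1
      rw [negPart_two_X, negPart_two_X, negPart_two_X_mul_X, mul_zero, mul_zero, zero_add, zero_add]
    · rw [isFirstOrder_negPart, add_zero]
    · simp
  simp only [subleadingOp, LinearMap.sum_apply, LinearMap.smul_apply, h, smul_add,
    Finset.sum_add_distrib, Finset.mul_sum, mul_smul_comm]
  congr 1
  rw [Finset.sum_eq_single_of_mem (r + 1) (by simp), if_pos rfl, smul_smul, vertexFactor]
  · congr 1
    have : (r ! : ℚ) ≠ 0 := by exact_mod_cast r.factorial_ne_zero
    have : (r : ℚ) ≠ 0 := by exact_mod_cast (by omega : r ≠ 0)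
    rw [Nat.factorial_succ]
    push_cast
    field_simp
  · intro n _ hn
    rw [if_neg hn, smul_zero]

/-! ### The genus expansion of the powers of the operator -/

theorem leakyAdj_mem_degreeBelow {k r : ℕ} {D : ℤ} {f : Fock} (hf : f ∈ degreeBelow D) :
    leakyAdj k r f ∈ degreeBelow (D + (r - 1)) := by
  rw [f.as_sum, map_sum]
  refine Submodule.sum_mem _ fun s hs => ?_
  have hs' : degGrade s < D := by
    rw [degreeBelow, MvPolynomial.mem_restrictSupport_iff] at hf
    exact hf hs
  have hm : (MvPolynomial.monomial s (MvPolynomial.coeff s f) : Fock) ∈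
      bihomogeneous (degGrade s) (wtGrade s) := by
    rw [bihomogeneous, MvPolynomial.monomial_mem_restrictSupport]
    exact Or.inl ⟨rfl, rfl⟩
  have h1 := leakyAdj_sub_mem (k := k) (r := r) hm
  have h2 := leadingOp_mem (k := k) (r := r) hm
  have h3 := subleadingOp_mem (k := k) (r := r) hm
  have h4 := add_mem (add_mem (degreeBelow_mono (d' := D + (r - 1)) (by omega) h1)
    (bihomogeneous_le_degreeBelow (d' := D + (r - 1)) (by omega) _ h3))
    (bihomogeneous_le_degreeBelow (d' := D + (r - 1)) (by omega) _ h2)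
  rwa [sub_add_cancel, sub_add_cancel] at h4

theorem leakyAdj_pow_mem_degreeBelow {k r : ℕ} (b : ℕ) {D : ℤ} {f : Fock}
    (hf : f ∈ degreeBelow D) : (leakyAdj k r ^ b) f ∈ degreeBelow (D + b * (r - 1)) := by
  induction b generalizing D f with
  | zero => simpa using hf
  | succ b ih =>
    rw [pow_succ, Module.End.mul_apply]
    convert ih (leakyAdj_mem_degreeBelow hf) using 2
    push_cast
    ring

/-- The subleading part of the `b`-th power of `leakyAdj`. -/
def subleadingIter (k r : ℕ) : ℕ → Module.End ℚ Fock
  | 0 => 0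
  | b + 1 => subleadingIter k r b * leadingOp k r + leadingOp k r ^ b * subleadingOp k r

theorem leadingOp_pow_mem {k r : ℕ} (b : ℕ) {d e : ℤ} {f : Fock} (hf : f ∈ bihomogeneous d e) :
    (leadingOp k r ^ b) f ∈ bihomogeneous (d + b * (r - 1)) (e - b * k) := by
  induction b generalizing d e f with
  | zero => simpa using hf
  | succ b ih =>
    rw [pow_succ, Module.End.mul_apply]
    convert ih (leadingOp_mem hf) using 2 <;> push_cast <;> ring

theorem subleadingIter_mem {k r : ℕ} (b : ℕ) {d e : ℤ} {f : Fock} (hf : f ∈ bihomogeneous d e) :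
    subleadingIter k r b f ∈ bihomogeneous (d + b * (r - 1) - 2) (e - b * k) := by
  induction b generalizing d e f with
  | zero => exact zero_mem _
  | succ b ih =>
    rw [subleadingIter, LinearMap.add_apply, Module.End.mul_apply, Module.End.mul_apply]
    refine add_mem ?_ ?_
    · convert ih (leadingOp_mem hf) using 2 <;> push_cast <;> ring
    · convert leadingOp_pow_mem b (subleadingOp_mem hf) using 2 <;> push_cast <;> ring

/-- Each use of `subleadingOp` costs two degrees relative to `leadingOp`, so modulo lower degree it
may be used at most once among the `b` factors. -/
theorem leakyAdj_pow_sub_mem {k r : ℕ} (b : ℕ) {d e : ℤ} {f : Fock}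
    (hf : f ∈ bihomogeneous d e) :
    (leakyAdj k r ^ b) f - (leadingOp k r ^ b) f - subleadingIter k r b f ∈
      degreeBelow (d + b * (r - 1) - 2) := by
  induction b generalizing d e f with
  | zero =>
    have : (leakyAdj k r ^ 0) f - (leadingOp k r ^ 0) f - subleadingIter k r 0 f = 0 := by
      simp [subleadingIter]
    rw [this]
    exact zero_mem _
  | succ b ih =>
    have hv := leadingOp_mem (k := k) (r := r) hf
    have hs := subleadingOp_mem (k := k) (r := r) hf
    have h1 := ih hv
    have h2 := ih hs
    have h3 := subleadingIter_mem (k := k) (r := r) b hs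
    have h4 := leakyAdj_pow_mem_degreeBelow (k := k) (r := r) b
      (leakyAdj_sub_mem (k := k) (r := r) hf)
    set D : ℤ := d + ((b + 1 : ℕ) : ℤ) * (r - 1) - 2 with hD
    have hD' : D = d + (r - 3) + b * (r - 1) := by
      rw [hD]
      push_cast
      ring
    have h1' := degreeBelow_mono (d' := D) (by rw [hD']; linarith) h1
    have h2' := degreeBelow_mono (d' := D) (by rw [hD']; linarith) h2
    have h3' := bihomogeneous_le_degreeBelow (d' := D) (by rw [hD']; linarith) _ h3
    have h4' := degreeBelow_mono (d' := D) (by rw [hD']) h4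
    have := add_mem (add_mem h1' h2') (add_mem h3' h4')
    convert this using 1
    rw [pow_succ, pow_succ, subleadingIter]
    simp only [Module.End.mul_apply, LinearMap.add_apply, map_sub]
    abel

/-! ### Evaluation on the right profile -/

/-- The evaluation at `p_q = 1`, with all other variables zero. -/
def evalAt (q : ℕ+) : Fock →ₐ[ℚ] ℚ := MvPolynomial.aeval fun i => if i = q then 1 else 0

theorem evalAt_monomial (q : ℕ+) (s : ℕ+ →₀ ℕ) (c : ℚ) :
    evalAt q (MvPolynomial.monomial s c) = if s = Finsupp.single q (s q) then c else 0 := by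
  rw [evalAt, MvPolynomial.aeval_monomial, Algebra.algebraMap_self, RingHom.id_apply]
  split_ifs with h
  · rw [h, Finsupp.prod_single_index (by simp)]
    simp
  · have : ∃ i ∈ s.support, i ≠ q := by
      by_contra hne
      push Not at hne
      refine h (Finsupp.ext fun i => ?_)
      by_cases hi : i = q
      · simp [hi]
      · rw [Finsupp.single_eq_of_ne hi]
        by_contra h0
        exact hi (hne i (Finsupp.mem_support_iff.2 h0))
    obtain ⟨i, hi, hne⟩ := this
    rw [Finsupp.prod, Finset.prod_eq_zero hi, mul_zero]
    rw [if_neg hne, zero_pow (Finsupp.mem_support_iff.1 hi)]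

theorem degGrade_single (q : ℕ+) (n : ℕ) : degGrade (Finsupp.single q n) = n := by
  simp [degGrade]

theorem evalAt_eq_coeff {q : ℕ+} {d e : ℤ} {f : Fock} (hf : f ∈ bihomogeneous d e) {n : ℕ}
    (hn : (n : ℤ) = d) : evalAt q f = MvPolynomial.coeff (Finsupp.single q n) f := by
  rw [bihomogeneous, MvPolynomial.mem_restrictSupport_iff] at hf
  conv_lhs => rw [f.as_sum, map_sum]
  rw [Finset.sum_eq_single (Finsupp.single q n)]
  · rw [evalAt_monomial, if_pos (by simp)]
  · intro s hs hne
    rw [evalAt_monomial, if_neg]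
    intro h
    apply hne
    have h1 := (hf hs).1
    rw [h, degGrade_single, ← hn] at h1
    rw [h, Nat.cast_inj.1 h1]
  · intro h
    rw [MvPolynomial.notMem_support_iff.1 h, MvPolynomial.monomial_zero, map_zero]

theorem coeff_single_eq_zero {q : ℕ+} {d e : ℤ} {f : Fock} (hf : f ∈ bihomogeneous d e) {n : ℕ}
    (hn : (n : ℤ) ≠ d) : MvPolynomial.coeff (Finsupp.single q n) f = 0 := by
  by_contra h
  rw [bihomogeneous, mem_restrictSupport] at hf
  have := (hf _ h).1
  rw [degGrade_single] at this
  exact hn this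

theorem coeff_single_degreeBelow {q : ℕ+} {D : ℤ} {f : Fock} (hf : f ∈ degreeBelow D) {n : ℕ}
    (hn : D ≤ n) : MvPolynomial.coeff (Finsupp.single q n) f = 0 := by
  by_contra h
  rw [degreeBelow, mem_restrictSupport] at hf
  have h1 : degGrade (Finsupp.single q n) < D := hf _ h
  rw [degGrade_single] at h1
  omega

/-- Only pure powers of `p_q` survive the evaluation, and their energy is `q` times their degree.
Applied to iterates, this determines `b` from the left profile. -/
theorem evalAt_ne_zero {q : ℕ+} {d e : ℤ} {f : Fock} (hf : f ∈ bihomogeneous d e)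
    (h : evalAt q f ≠ 0) : 0 ≤ d ∧ e = (q : ℕ) * d := by
  rw [bihomogeneous, MvPolynomial.mem_restrictSupport_iff] at hf
  rw [f.as_sum, map_sum] at h
  obtain ⟨s, hs, hne⟩ := Finset.exists_ne_zero_of_sum_ne_zero h
  rw [evalAt_monomial] at hne
  split_ifs at hne with h1
  · obtain ⟨h2, h3⟩ := hf hs
    rw [h1] at h2 h3
    rw [degGrade_single] at h2
    rw [wtGrade, grade_single] at h3
    rw [← h2, ← h3]
    exact ⟨by positivity, rfl⟩
  · exact absurd rfl hne

/-! ### The genus zero functionals -/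

/-- Uniqueness for a possibly infinite system of linear differential equations: if derivatives of
members are controlled by members at the same order, induction on the order annihilates every
coefficient. -/
theorem powerSeries_family_eq_zero {ι : Type*} (A : ι → PowerSeries ℚ)
    (h0 : ∀ i, PowerSeries.constantCoeff (A i) = 0)
    (h : ∀ n, (∀ i, PowerSeries.coeff n (A i) = 0) →
      ∀ i, PowerSeries.coeff n (PowerSeries.derivative ℚ (A i)) = 0) (i : ι) : A i = 0 := by
  have key : ∀ n, ∀ i, PowerSeries.coeff n (A i) = 0 := by
    intro n
    induction n with
    | zero => intro i; rw [PowerSeries.coeff_zero_eq_constantCoeff_apply, h0]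
    | succ n ih =>
      intro i
      have := h n ih i
      rw [PowerSeries.coeff_derivative] at this
      exact (mul_eq_zero.1 this).resolve_right (by positivity)
  ext n
  rw [key, map_zero]

/-- The generating series of the leading parts. -/
def leadingSeries (k r : ℕ) (q : ℕ+) : Fock →ₗ[ℚ] PowerSeries ℚ where
  toFun f := PowerSeries.mk fun b => evalAt q ((leadingOp k r ^ b) f) / (b ! : ℚ)
  map_add' f g := by
    ext b
    simp only [map_add, PowerSeries.coeff_mk, add_div]
  map_smul' c f := by
    ext b
    simp only [map_smul, PowerSeries.coeff_mk, RingHom.id_apply, smul_eq_mul, mul_div_assoc]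

/-- The generating series of the subleading parts. -/
def subleadingSeries (k r : ℕ) (q : ℕ+) : Fock →ₗ[ℚ] PowerSeries ℚ where
  toFun f := PowerSeries.mk fun b => evalAt q (subleadingIter k r b f) / (b ! : ℚ)
  map_add' f g := by
    ext b
    simp only [map_add, PowerSeries.coeff_mk, add_div]
  map_smul' c f := by
    ext b
    simp only [map_smul, PowerSeries.coeff_mk, RingHom.id_apply, smul_eq_mul, mul_div_assoc]

variable (k r : ℕ) (q : ℕ+)

theorem coeff_leadingSeries (f : Fock) (b : ℕ) : PowerSeries.coeff b (leadingSeries k r q f) =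
    evalAt q ((leadingOp k r ^ b) f) / (b ! : ℚ) := by
  simp only [leadingSeries, LinearMap.coe_mk, AddHom.coe_mk, PowerSeries.coeff_mk]

theorem coeff_subleadingSeries (f : Fock) (b : ℕ) :
    PowerSeries.coeff b (subleadingSeries k r q f) =
      evalAt q (subleadingIter k r b f) / (b ! : ℚ) := by
  simp only [subleadingSeries, LinearMap.coe_mk, AddHom.coe_mk, PowerSeries.coeff_mk]

theorem constantCoeff_leadingSeries (f : Fock) :
    PowerSeries.constantCoeff (leadingSeries k r q f) = evalAt q f := by
  rw [← PowerSeries.coeff_zero_eq_constantCoeff_apply, coeff_leadingSeries]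
  simp

theorem constantCoeff_subleadingSeries (f : Fock) :
    PowerSeries.constantCoeff (subleadingSeries k r q f) = 0 := by
  rw [← PowerSeries.coeff_zero_eq_constantCoeff_apply, coeff_subleadingSeries]
  simp [subleadingIter]

theorem div_factorial_succ (x : ℚ) (b : ℕ) :
    x / ((b + 1)! : ℚ) * ((b : ℚ) + 1) = x / (b ! : ℚ) := by
  have : (b ! : ℚ) ≠ 0 := by exact_mod_cast b.factorial_ne_zero
  rw [Nat.factorial_succ]
  push_cast
  field_simp

theorem derivative_leadingSeries (f : Fock) :
    PowerSeries.derivative ℚ (leadingSeries k r q f) = leadingSeries k r q (leadingOp k r f) := by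
  ext b
  rw [PowerSeries.coeff_derivative, coeff_leadingSeries, coeff_leadingSeries, div_factorial_succ,
    pow_succ, Module.End.mul_apply]

theorem derivative_subleadingSeries (f : Fock) :
    PowerSeries.derivative ℚ (subleadingSeries k r q f) =
      subleadingSeries k r q (leadingOp k r f) + leadingSeries k r q (subleadingOp k r f) := by
  ext b
  rw [map_add, PowerSeries.coeff_derivative, coeff_leadingSeries, coeff_subleadingSeries,
    coeff_subleadingSeries, div_factorial_succ, ← add_div, ← map_add, subleadingIter]
  rfl

/-- The exponential of a derivation is multiplicative. The defect of multiplicativity vanishes at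
time zero, and its derivative is a sum of defects for other pairs. -/
theorem leadingSeries_mul (f g : Fock) :
    leadingSeries k r q (f * g) = leadingSeries k r q f * leadingSeries k r q g := by
  have := powerSeries_family_eq_zero
    (fun p : Fock × Fock => leadingSeries k r q (p.1 * p.2) -
      leadingSeries k r q p.1 * leadingSeries k r q p.2) ?_ ?_ (f, g)
  · exact sub_eq_zero.1 this
  · rintro ⟨f, g⟩
    simp [constantCoeff_leadingSeries]
  · rintro n ih ⟨f, g⟩
    have h : PowerSeries.derivative ℚ (leadingSeries k r q (f * g) -
        leadingSeries k r q f * leadingSeries k r q g) =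
        (leadingSeries k r q (f * leadingOp k r g) -
          leadingSeries k r q f * leadingSeries k r q (leadingOp k r g)) +
        (leadingSeries k r q (g * leadingOp k r f) -
          leadingSeries k r q g * leadingSeries k r q (leadingOp k r f)) := by
      rw [map_sub, Derivation.leibniz, derivative_leadingSeries, derivative_leadingSeries,
        derivative_leadingSeries, isFirstOrder_leadingOp, map_add, smul_eq_mul, smul_eq_mul]
      ring
    rw [h, map_add, ih (f, leadingOp k r g), ih (g, leadingOp k r f), add_zero]

theorem leadingOp_one : leadingOp k r 1 = 0 := by
  have := isFirstOrder_leadingOp k r 1 1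
  simpa using this

theorem leadingSeries_one : leadingSeries k r q 1 = 1 := by
  ext b
  rw [coeff_leadingSeries, PowerSeries.coeff_one]
  rcases b with _ | b
  · simp
  · rw [pow_succ, Module.End.mul_apply, leadingOp_one]
    simp

/-- The leading series as a ring homomorphism. -/
def leadingHom : Fock →+* PowerSeries ℚ where
  toFun := leadingSeries k r q
  map_one' := leadingSeries_one k r q
  map_mul' := leadingSeries_mul k r q
  map_zero' := map_zero _
  map_add' := map_add _

theorem leadingHom_apply (f : Fock) : leadingHom k r q f = leadingSeries k r q f := rfl

/-- The connected two-point series. -/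
def connectedSeries (f g : Fock) : PowerSeries ℚ :=
  subleadingSeries k r q (f * g) - subleadingSeries k r q f * leadingHom k r q g -
    leadingHom k r q f * subleadingSeries k r q g

theorem connectedSeries_comm (f g : Fock) :
    connectedSeries k r q f g = connectedSeries k r q g f := by
  rw [connectedSeries, connectedSeries, mul_comm f g]
  ring

theorem connectedSeries_add_left (f g h : Fock) : connectedSeries k r q (f + g) h =
    connectedSeries k r q f h + connectedSeries k r q g h := by
  simp only [connectedSeries, add_mul, map_add]
  ring

theorem connectedSeries_smul_left (c : ℚ) (f h : Fock) :
    connectedSeries k r q (c • f) h = c • connectedSeries k r q f h := by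
  simp only [connectedSeries, leadingHom_apply, smul_mul_assoc, map_smul, smul_sub]

theorem derivative_connectedSeries (f g : Fock) :
    PowerSeries.derivative ℚ (connectedSeries k r q f g) =
      connectedSeries k r q (leadingOp k r f) g + connectedSeries k r q f (leadingOp k r g) +
      leadingHom k r q (subleadingOp k r (f * g) - f * subleadingOp k r g -
        g * subleadingOp k r f) := by
  simp only [connectedSeries, map_sub, map_mul, Derivation.leibniz, smul_eq_mul, leadingHom_apply,
    derivative_leadingSeries, derivative_subleadingSeries, isFirstOrder_leadingOp k r _ _, map_add]
  rw [mul_comm g (leadingOp k r f)]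
  ring

/-- The defect `T` starts at zero. In its time derivative the source terms cancel exactly by the
second-order identity for `subleadingOp`, leaving defects of other triples. -/
theorem connectedSeries_mul_left (f g h : Fock) : connectedSeries k r q (f * g) h =
    leadingHom k r q f * connectedSeries k r q g h +
      leadingHom k r q g * connectedSeries k r q f h := by
  set T : Fock × Fock × Fock → PowerSeries ℚ := fun p =>
    connectedSeries k r q (p.1 * p.2.1) p.2.2 -
      leadingHom k r q p.1 * connectedSeries k r q p.2.1 p.2.2 -
      leadingHom k r q p.2.1 * connectedSeries k r q p.1 p.2.2 with hT
  have := powerSeries_family_eq_zero T ?_ ?_ (f, g, h)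
  · rw [hT] at this
    linear_combination this
  · rintro ⟨f, g, h⟩
    simp [hT, connectedSeries, constantCoeff_subleadingSeries]
  · rintro n ih ⟨f, g, h⟩
    have key : PowerSeries.derivative ℚ (T (f, g, h)) = T (leadingOp k r f, g, h) +
        T (f, leadingOp k r g, h) + T (f, g, leadingOp k r h) := by
      have h2 := isSecondOrder_subleadingOp k r f g h
      have h3 := congrArg (leadingHom k r q) h2
      simp only [map_add, map_sub, map_mul] at h3
      simp only [hT, map_sub, map_mul, Derivation.leibniz, smul_eq_mul,
        derivative_connectedSeries, isFirstOrder_leadingOp k r _ _, connectedSeries_add_left]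
      rw [show PowerSeries.derivative ℚ (leadingHom k r q f) = leadingHom k r q (leadingOp k r f)
        from derivative_leadingSeries k r q f,
        show PowerSeries.derivative ℚ (leadingHom k r q g) = leadingHom k r q (leadingOp k r g)
        from derivative_leadingSeries k r q g, mul_comm g (leadingOp k r f)]
      linear_combination h3
    rw [key, map_add, map_add, ih, ih, ih, add_zero, add_zero]

theorem connectedSeries_one_left (h : Fock) : connectedSeries k r q 1 h = 0 := by
  have := connectedSeries_mul_left k r q 1 1 h
  rw [mul_one, map_one, one_mul] at this
  linear_combination -this

/-! ### Evolution equations -/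

/-- The connected series applied to the coefficients of a power series. -/
def connectedMap (h : Fock) (p : PowerSeries Fock) : PowerSeries (PowerSeries ℚ) :=
  PowerSeries.mk fun m => connectedSeries k r q (PowerSeries.coeff m p) h

theorem connectedSeries_sum_left {ι : Type*} (s : Finset ι) (f : ι → Fock) (h : Fock) :
    connectedSeries k r q (∑ i ∈ s, f i) h = ∑ i ∈ s, connectedSeries k r q (f i) h := by
  classical
  induction s using Finset.induction_on with
  | empty =>
    rw [Finset.sum_empty, Finset.sum_empty, ← zero_smul ℚ (0 : Fock), connectedSeries_smul_left,
      zero_smul]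
  | insert i s hi ih => rw [Finset.sum_insert hi, Finset.sum_insert hi, connectedSeries_add_left, ih]

theorem connectedMap_mul (h : Fock) (p p' : PowerSeries Fock) :
    connectedMap k r q h (p * p') = PowerSeries.map (leadingHom k r q) p * connectedMap k r q h p' +
      PowerSeries.map (leadingHom k r q) p' * connectedMap k r q h p := by
  ext1 m
  rw [map_add, mul_comm (PowerSeries.map (leadingHom k r q) p'), connectedMap,
    PowerSeries.coeff_mk, PowerSeries.coeff_mul, connectedSeries_sum_left, PowerSeries.coeff_mul,
    PowerSeries.coeff_mul, ← Finset.sum_add_distrib]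
  refine Finset.sum_congr rfl fun i _ => ?_
  rw [connectedSeries_mul_left, PowerSeries.coeff_map, PowerSeries.coeff_map, connectedMap,
    connectedMap, PowerSeries.coeff_mk, PowerSeries.coeff_mk]
  ring

theorem connectedMap_pow (h : Fock) (p : PowerSeries Fock) (n : ℕ) :
    connectedMap k r q h (p ^ n) =
      (n : PowerSeries (PowerSeries ℚ)) * PowerSeries.map (leadingHom k r q) p ^ (n - 1) *
        connectedMap k r q h p := by
  induction n with
  | zero =>
    ext1 m
    rw [pow_zero, connectedMap, PowerSeries.coeff_mk, PowerSeries.coeff_one]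
    split_ifs
    · rw [connectedSeries_one_left]
      simp
    · rw [← zero_smul ℚ (0 : Fock), connectedSeries_smul_left]
      simp
  | succ n ih =>
    rw [pow_succ, connectedMap_mul, ih, map_pow, Nat.add_sub_cancel]
    rcases n with _ | n
    · simp
    · rw [Nat.add_sub_cancel]
      push_cast
      ring

theorem coeffInt_map {R S : Type*} [CommSemiring R] [CommSemiring S] (g : R →+* S) (s : ℤ)
    (p : PowerSeries R) : coeffInt s (PowerSeries.map g p) = g (coeffInt s p) := by
  rcases lt_or_ge s 0 with h | h
  · rw [coeffInt_of_neg h, coeffInt_of_neg h, map_zero]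
  · lift s to ℕ using h
    rw [coeffInt_natCast, coeffInt_natCast, PowerSeries.coeff_map]

theorem coeffInt_connectedMap (h : Fock) (s : ℤ) (p : PowerSeries Fock) :
    coeffInt s (connectedMap k r q h p) = connectedSeries k r q (coeffInt s p) h := by
  rcases lt_or_ge s 0 with h0 | h0
  · rw [coeffInt_of_neg h0, coeffInt_of_neg h0, ← zero_smul ℚ (0 : Fock),
      connectedSeries_smul_left, zero_smul]
  · lift s to ℕ using h0
    rw [coeffInt_natCast, coeffInt_natCast, connectedMap, PowerSeries.coeff_mk]

/-- The one-point field. -/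
def onePointField : PowerSeries (PowerSeries ℚ) := PowerSeries.map (leadingHom k r q) field

/-- The two-point field with one fixed leg. -/
def twoPointField (m : ℕ+) : PowerSeries (PowerSeries ℚ) :=
  connectedMap k r q (MvPolynomial.X m) field

theorem derivative_leadingHom_X (l : ℕ+) :
    PowerSeries.derivative ℚ (leadingHom k r q (MvPolynomial.X l)) =
      (((l : ℕ) : ℚ) / r) • coeffInt ((l : ℕ) - (k : ℤ)) (onePointField k r q ^ r) := by
  rw [leadingHom_apply, derivative_leadingSeries, leadingOp_X, map_smul, onePointField, ← map_pow,
    coeffInt_map, leadingHom_apply]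

theorem connectedSeries_leadingOp_X (hr : 1 ≤ r) (l m : ℕ+) :
    connectedSeries k r q (leadingOp k r (MvPolynomial.X l)) (MvPolynomial.X m) =
      ((l : ℕ) : ℚ) • coeffInt ((l : ℕ) - (k : ℤ))
        (onePointField k r q ^ (r - 1) * twoPointField k r q m) := by
  have hr' : (r : ℚ) ≠ 0 := by exact_mod_cast (by omega : r ≠ 0)
  rw [leadingOp_X, connectedSeries_smul_left, ← coeffInt_connectedMap, connectedMap_pow,
    mul_assoc, ← nsmul_eq_mul, map_nsmul, ← Nat.cast_smul_eq_nsmul ℚ, smul_smul,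
    div_mul_cancel₀ _ hr']
  rfl

/-- The first two terms linearise the one-point evolution in each argument. The last is the source:
the failure of `subleadingOp` to obey the Leibniz rule on two variables. -/
theorem derivative_connectedSeries_X (hr : 1 ≤ r) (l m : ℕ+) :
    PowerSeries.derivative ℚ (connectedSeries k r q (MvPolynomial.X l) (MvPolynomial.X m)) =
      ((l : ℕ) : ℚ) • coeffInt ((l : ℕ) - (k : ℤ))
        (onePointField k r q ^ (r - 1) * twoPointField k r q m) +
      ((m : ℕ) : ℚ) • coeffInt ((m : ℕ) - (k : ℤ))
        (onePointField k r q ^ (r - 1) * twoPointField k r q l) +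
      (((l : ℕ) : ℚ) * (m : ℕ)) • coeffInt ((l : ℕ) + (m : ℕ) - (k : ℤ))
        (onePointField k r q ^ (r - 1)) := by
  rw [derivative_connectedSeries, connectedSeries_leadingOp_X k r q hr,
    connectedSeries_comm k r q (MvPolynomial.X l), connectedSeries_leadingOp_X k r q hr,
    subleadingOp_X_mul_X hr]
  congr 1
  rw [add_sub_right_comm, add_sub_cancel_left, add_sub_cancel_left, leadingHom_apply, map_smul,
    onePointField, ← map_pow, coeffInt_map, leadingHom_apply]

/-! ### Genus zero numbers as coefficients of the functionals -/

theorem coeff_leakyAdj_pow {k r b n : ℕ} {q : ℕ+} {d e : ℤ} {f : Fock}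
    (hf : f ∈ bihomogeneous d e) (hn : d + b * (r - 1) - 2 ≤ n) :
    MvPolynomial.coeff (Finsupp.single q n) ((leakyAdj k r ^ b) f) =
      (if (n : ℤ) = d + b * (r - 1) then evalAt q ((leadingOp k r ^ b) f) else 0) +
      if (n : ℤ) = d + b * (r - 1) - 2 then evalAt q (subleadingIter k r b f) else 0 := by
  have h0 := coeff_single_degreeBelow (q := q) (leakyAdj_pow_sub_mem (k := k) (r := r) b hf) hn
  have h1 := leadingOp_pow_mem (k := k) (r := r) b hf
  have h2 := subleadingIter_mem (k := k) (r := r) b hf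
  rw [MvPolynomial.coeff_sub, MvPolynomial.coeff_sub, sub_sub, sub_eq_zero] at h0
  rw [h0]
  congr 1
  · split_ifs with h
    · rw [evalAt_eq_coeff h1 h]
    · exact coeff_single_eq_zero h1 h
  · split_ifs with h
    · rw [evalAt_eq_coeff h2 h]
    · exact coeff_single_eq_zero h2 h

/-- The values `n = A + 1` and `n = A - 1` are genus zero and genus one. The latter is needed
because the products subtracted in a genus-zero two-point number pair one factor of each kind. -/
theorem disconnectedNumber_one {k r b n A : ℕ} {q l : ℕ+} (hA : (A : ℤ) = b * (r - 1))
    (hn : A ≤ n + 1) :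
    disconnectedNumber k r q [l] b n = 1 / ((l : ℕ) : ℚ) *
      ((if n = A + 1 then evalAt q ((leadingOp k r ^ b) (MvPolynomial.X l)) else 0) +
      if n + 1 = A then evalAt q (subleadingIter k r b (MvPolynomial.X l)) else 0) := by
  rw [disconnectedNumber_singleton, coeff_leakyAdj_pow (X_mem_bihomogeneous l)
    (by rw [← hA]; omega), ← hA]
  congr 2
  · exact if_congr (by omega) rfl rfl
  · exact if_congr (by omega) rfl rfl

theorem cast_pred_mul {r : ℕ} (hr : 1 ≤ r) (b : ℕ) :
    (((r - 1) * b : ℕ) : ℤ) = (b : ℤ) * (r - 1) := by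
  push_cast [hr]
  ring

theorem genusZeroNumber₁_eq {k r : ℕ} (hr : 1 ≤ r) (q l : ℕ+) (b : ℕ) :
    genusZeroNumber₁ k r q l b / (b ! : ℚ) =
      PowerSeries.coeff b (leadingHom k r q (MvPolynomial.X l)) / ((l : ℕ) : ℚ) := by
  have h := cast_pred_mul hr b
  rw [genusZeroNumber₁, connectedNumber₁, disconnectedNumber_one h (by omega), if_pos rfl,
    if_neg (by omega), leadingHom_apply, coeff_leadingSeries]
  ring

theorem sum_antidiagonal_of_two {A B : ℕ} {f g : ℕ → ℚ} {f' g' : ℚ}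
    (hf : f A = 0) (hf₁ : ∀ i, A + 1 < i → f i = 0) (hg₁ : ∀ i, B + 1 < i → g i = 0)
    (hf₂ : ∀ i, i + 1 = A → f i = f') (hf₃ : A = 0 → f' = 0)
    (hg₂ : ∀ i, i + 1 = B → g i = g') (hg₃ : B = 0 → g' = 0) :
    ∑ δ ∈ Finset.HasAntidiagonal.antidiagonal (A + B), f δ.1 * g δ.2 =
      f (A + 1) * g' + f' * g (B + 1) := by
  -- For `A = 0` the truncated `A - 1` coincides with `A`; `f A = 0` and `f' = 0` make that term
  -- harmless. For `B = 0` the index `A + 1` lies outside the range, and `g' = 0`.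
  have h : ∀ i ∈ Finset.range (A + B).succ, f i * g (A + B - i) =
      (if i = A + 1 then f (A + 1) * g' else 0) + if i = A - 1 then f' * g (B + 1) else 0 := by
    intro i hi
    rw [Finset.mem_range] at hi
    rcases lt_trichotomy i A with h | rfl | h
    · rw [if_neg (by omega), zero_add]
      split_ifs with h2
      · rw [hf₂ i (by omega), show A + B - i = B + 1 by omega]
      · rw [hg₁ _ (by omega), mul_zero]
    · rw [if_neg (by omega), hf, zero_mul, zero_add]
      split_ifs with h2
      · rw [hf₃ (by omega), zero_mul]
      · rfl
    · rw [if_neg (show ¬ i = A - 1 by omega), add_zero]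
      split_ifs with h2
      · rw [h2, hg₂ _ (by omega)]
      · rw [hf₁ i (by omega), zero_mul]
  rw [Finset.Nat.sum_antidiagonal_eq_sum_range_succ (fun i j => f i * g j), Finset.sum_congr rfl h,
    Finset.sum_add_distrib, Finset.sum_ite_eq', Finset.sum_ite_eq', if_pos (show A - 1 ∈ Finset.range (A + B).succ by rw [Finset.mem_range]; omega)]
  congr 1
  split_ifs with h2
  · rfl
  · rw [Finset.mem_range] at h2
    rw [hg₃ (by omega), mul_zero]

theorem choose_div_factorial {b : ℕ} {β : ℕ × ℕ} (h : β ∈ Finset.HasAntidiagonal.antidiagonal b) :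
    (b.choose β.1 : ℚ) / (b ! : ℚ) = 1 / ((β.1 ! : ℚ) * (β.2 ! : ℚ)) := by
  rw [Finset.HasAntidiagonal.mem_antidiagonal] at h
  subst h
  have h := Nat.choose_mul_factorial_mul_factorial (Nat.le_add_right β.1 β.2)
  rw [Nat.add_sub_cancel_left] at h
  have h' : ((β.1 + β.2).choose β.1 : ℚ) * (β.1 ! : ℚ) * (β.2 ! : ℚ) = ((β.1 + β.2)! : ℚ) := by
    exact_mod_cast h
  have h1 : (β.1 ! : ℚ) ≠ 0 := by exact_mod_cast Nat.factorial_ne_zero _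
  have h2 : (β.2 ! : ℚ) ≠ 0 := by exact_mod_cast Nat.factorial_ne_zero _
  have h3 : ((β.1 + β.2)! : ℚ) ≠ 0 := by exact_mod_cast Nat.factorial_ne_zero _
  field_simp
  linarith

theorem evalAt_subleadingIter_X {k r b : ℕ} {q l : ℕ+} (h : (b : ℤ) * (r - 1) = 0) :
    evalAt q (subleadingIter k r b (MvPolynomial.X l)) = 0 := by
  by_contra hne
  have := (evalAt_ne_zero (subleadingIter_mem (k := k) (r := r) b (X_mem_bihomogeneous l)) hne).1
  omega

/-- The degree `(r-1) b` is two below the top for a product of two variables, so the disconnected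
number sees only `subleadingIter`. The binomial sum over `β` is the Cauchy product of the
exponential generating series. -/
theorem genusZeroNumber₂_eq {k r : ℕ} (hr : 1 ≤ r) (q l m : ℕ+) (b : ℕ) :
    genusZeroNumber₂ k r q l m b / (b ! : ℚ) =
      PowerSeries.coeff b (connectedSeries k r q (MvPolynomial.X l) (MvPolynomial.X m)) /
        (((l : ℕ) : ℚ) * (m : ℕ)) := by
  have hb := cast_pred_mul hr b
  have hX := X_mul_mem_bihomogeneous (X_mem_bihomogeneous m) l
  have h1 : disconnectedNumber k r q [l, m] b ((r - 1) * b) = 1 / (((l : ℕ) : ℚ) * (m : ℕ)) *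
      evalAt q (subleadingIter k r b (MvPolynomial.X l * MvPolynomial.X m)) := by
    rw [disconnectedNumber_pair, coeff_leakyAdj_pow hX (by push_cast [← hb]; linarith),
      if_neg (by push_cast [← hb]; linarith), if_pos (by push_cast [← hb]; ring), zero_add]
  have h2 : ∀ β ∈ Finset.HasAntidiagonal.antidiagonal b,
      ∑ δ ∈ Finset.HasAntidiagonal.antidiagonal ((r - 1) * b),
        disconnectedNumber k r q [l] β.1 δ.1 * disconnectedNumber k r q [m] β.2 δ.2 =
      1 / (((l : ℕ) : ℚ) * (m : ℕ)) *
        (evalAt q ((leadingOp k r ^ β.1) (MvPolynomial.X l)) *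
          evalAt q (subleadingIter k r β.2 (MvPolynomial.X m)) +
        evalAt q (subleadingIter k r β.1 (MvPolynomial.X l)) *
          evalAt q ((leadingOp k r ^ β.2) (MvPolynomial.X m))) := by
    intro β hβ
    rw [Finset.HasAntidiagonal.mem_antidiagonal] at hβ
    have e1 := cast_pred_mul hr β.1
    have e2 := cast_pred_mul hr β.2
    have hsum : (r - 1) * b = (r - 1) * β.1 + (r - 1) * β.2 := by rw [← hβ, mul_add]
    rw [hsum]
    clear hsum hb h1
    generalize (r - 1) * β.1 = A at *
    generalize (r - 1) * β.2 = B at *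
    rw [sum_antidiagonal_of_two (A := A) (B := B)
      (f := disconnectedNumber k r q [l] β.1) (g := disconnectedNumber k r q [m] β.2)
      (f' := 1 / ((l : ℕ) : ℚ) * evalAt q (subleadingIter k r β.1 (MvPolynomial.X l)))
      (g' := 1 / ((m : ℕ) : ℚ) * evalAt q (subleadingIter k r β.2 (MvPolynomial.X m))),
      disconnectedNumber_one e1 (by omega), disconnectedNumber_one e2 (by omega), if_pos rfl,
      if_neg (by omega), if_pos rfl, if_neg (by omega)]
    · ring
    · rw [disconnectedNumber_one e1 (by omega), if_neg (by omega), if_neg (by omega), add_zero,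
        mul_zero]
    · intro i hi
      rw [disconnectedNumber_one e1 (by omega), if_neg (by omega), if_neg (by omega), add_zero,
        mul_zero]
    · intro i hi
      rw [disconnectedNumber_one e2 (by omega), if_neg (by omega), if_neg (by omega), add_zero,
        mul_zero]
    · intro i hi
      rw [disconnectedNumber_one e1 (by omega), if_neg (by omega), if_pos hi, zero_add]
    · intro h0
      rw [evalAt_subleadingIter_X (by rw [← e1, h0]; rfl), mul_zero]
    · intro i hi
      rw [disconnectedNumber_one e2 (by omega), if_neg (by omega), if_pos hi, zero_add]
    · intro h0
      rw [evalAt_subleadingIter_X (by rw [← e2, h0]; rfl), mul_zero]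
  rw [genusZeroNumber₂, connectedNumber₂, h1, connectedSeries, map_sub, map_sub,
    coeff_subleadingSeries, PowerSeries.coeff_mul, PowerSeries.coeff_mul, sub_sub,
    ← Finset.sum_add_distrib, sub_div, sub_div, Finset.sum_div, Finset.sum_div]
  congr 1
  · ring
  · refine Finset.sum_congr rfl fun β hβ => ?_
    have h3 := choose_div_factorial hβ
    simp only [mul_assoc]
    rw [← Finset.mul_sum, h2 β hβ, mul_div_right_comm, h3, leadingHom_apply, leadingHom_apply,
      coeff_leadingSeries, coeff_leadingSeries, coeff_subleadingSeries, coeff_subleadingSeries]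
    ring

/-! ### Supports of the genus zero series -/

theorem coeff_leadingHom_X_ne_zero {k r b : ℕ} (hr : 1 ≤ r) {q l : ℕ+}
    (h : PowerSeries.coeff b (leadingHom k r q (MvPolynomial.X l)) ≠ 0) :
    ((q : ℕ) * (r - 1) + k) * b + q = (l : ℕ) := by
  rw [leadingHom_apply, coeff_leadingSeries] at h
  have := (evalAt_ne_zero (leadingOp_pow_mem (k := k) (r := r) b (X_mem_bihomogeneous l))
    (left_ne_zero_of_mul h)).2
  zify [hr]
  linarith

theorem coeff_subleadingSeries_ne_zero {k r b : ℕ} {q : ℕ+} {d e : ℤ} {f : Fock}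
    (hf : f ∈ bihomogeneous d e)
    (h : PowerSeries.coeff b (subleadingSeries k r q f) ≠ 0) :
    e - b * k = (q : ℕ) * (d + b * (r - 1) - 2) := by
  rw [coeff_subleadingSeries] at h
  exact (evalAt_ne_zero (subleadingIter_mem b hf) (left_ne_zero_of_mul h)).2

theorem coeff_mul_X_ne_zero {k r b : ℕ} (hr : 1 ≤ r) {q l m : ℕ+}
    (h : PowerSeries.coeff b (leadingHom k r q (MvPolynomial.X l) *
      subleadingSeries k r q (MvPolynomial.X m)) ≠ 0) :
    ((q : ℕ) * (r - 1) + k) * b = (l : ℕ) + (m : ℕ) := by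
  rw [PowerSeries.coeff_mul] at h
  obtain ⟨β, hβ, hne⟩ := Finset.exists_ne_zero_of_sum_ne_zero h
  rw [Finset.HasAntidiagonal.mem_antidiagonal] at hβ
  have h1 := coeff_leadingHom_X_ne_zero hr (left_ne_zero_of_mul hne)
  have h2 := coeff_subleadingSeries_ne_zero (X_mem_bihomogeneous m) (right_ne_zero_of_mul hne)
  subst hβ
  zify [hr] at h1 ⊢
  linarith

theorem coeff_connectedSeries_X_ne_zero {k r b : ℕ} (hr : 1 ≤ r) {q l m : ℕ+}
    (h : PowerSeries.coeff b (connectedSeries k r q (MvPolynomial.X l) (MvPolynomial.X m)) ≠ 0) :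
    ((q : ℕ) * (r - 1) + k) * b = (l : ℕ) + (m : ℕ) := by
  by_contra hne
  apply h
  have h1 : PowerSeries.coeff b (subleadingSeries k r q (MvPolynomial.X l * MvPolynomial.X m)) = 0 := by
    by_contra h0
    have h2 := coeff_subleadingSeries_ne_zero
      (X_mul_mem_bihomogeneous (X_mem_bihomogeneous m) l) h0
    apply hne
    zify [hr]
    linarith
  have h2 : PowerSeries.coeff b (leadingHom k r q (MvPolynomial.X l) *
      subleadingSeries k r q (MvPolynomial.X m)) = 0 := by
    by_contra h0
    exact hne (coeff_mul_X_ne_zero hr h0)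
  have h3 : PowerSeries.coeff b (leadingHom k r q (MvPolynomial.X m) *
      subleadingSeries k r q (MvPolynomial.X l)) = 0 := by
    by_contra h0
    exact hne ((coeff_mul_X_ne_zero hr h0).trans (add_comm _ _))
  rw [connectedSeries, map_sub, map_sub, h1, h2, mul_comm, h3]
  norm_num

/-! ### Specialisation of the time variable -/

/-- At time one, differentiation in time becomes multiplication by a linear function of the profile:
Euler's identity for a polynomial whose exponents satisfy a linear relation. -/
theorem eval_one_derivative {p : Polynomial ℚ} {N c : ℚ}
    (h : ∀ b : ℕ, p.coeff b ≠ 0 → N * b = c) :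
    N * (Polynomial.derivative p).eval 1 = c * p.eval 1 := by
  rw [Polynomial.derivative_eval, Polynomial.eval_eq_sum, Polynomial.sum, Polynomial.sum,
    Finset.mul_sum, Finset.mul_sum]
  refine Finset.sum_congr rfl fun b hb => ?_
  rw [← h b (Polynomial.mem_support_iff.1 hb)]
  simp only [one_pow, mul_one]
  ring

theorem coe_trunc_of_support {A : PowerSeries ℚ} {n : ℕ}
    (h : ∀ b, PowerSeries.coeff b A ≠ 0 → b < n) :
    ((PowerSeries.trunc n A : Polynomial ℚ) : PowerSeries ℚ) = A := by
  ext b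
  rw [Polynomial.coeff_coe, PowerSeries.coeff_trunc]
  split_ifs with hb
  · rfl
  · by_contra hne
    exact hb (h b fun h0 => hne h0.symm)

theorem eval_one_trunc (A : PowerSeries ℚ) (n : ℕ) :
    (PowerSeries.trunc n A).eval 1 = ∑ b ∈ Finset.range n, PowerSeries.coeff b A := by
  rw [Polynomial.eval, PowerSeries.eval₂_trunc_eq_sum_range]
  simp

theorem sum_range_eq_sum_filter {A : PowerSeries ℚ} {n : ℕ} {p : ℕ → Prop} [DecidablePred p]
    (h : ∀ b, PowerSeries.coeff b A ≠ 0 → p b) :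
    ∑ b ∈ Finset.range n, PowerSeries.coeff b A =
      ∑ b ∈ (Finset.range n).filter p, PowerSeries.coeff b A := by
  rw [Finset.sum_filter_of_ne fun b _ hb => h b hb]

section

variable (k r : ℕ) (q : ℕ+)

/-- The one-point field with polynomial coefficients in the time variable. -/
def onePointPoly : PowerSeries (Polynomial ℚ) :=
  PowerSeries.mk fun l => PowerSeries.trunc (l + 1) (PowerSeries.coeff l (onePointField k r q))

/-- The two-point field with polynomial coefficients in the time variable. -/
def twoPointPoly (m : ℕ+) : PowerSeries (Polynomial ℚ) :=
  PowerSeries.mk fun l =>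
    PowerSeries.trunc (l + (m : ℕ) + 1) (PowerSeries.coeff l (twoPointField k r q m))

theorem coeff_field_zero : PowerSeries.coeff 0 field = 0 := by
  simp [field]

theorem coeff_field_coe (l : ℕ+) : PowerSeries.coeff (l : ℕ) field = MvPolynomial.X l := by
  rw [field, PowerSeries.coeff_mk, if_pos l.pos, PNat.coe_toPNat']

theorem coeff_onePointField_zero : PowerSeries.coeff 0 (onePointField k r q) = 0 := by
  rw [onePointField, PowerSeries.coeff_map, coeff_field_zero, map_zero]

theorem coeff_onePointField_coe (l : ℕ+) : PowerSeries.coeff (l : ℕ) (onePointField k r q) =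
    leadingHom k r q (MvPolynomial.X l) := by
  rw [onePointField, PowerSeries.coeff_map, coeff_field_coe]

theorem coeff_twoPointField_zero (m : ℕ+) : PowerSeries.coeff 0 (twoPointField k r q m) = 0 := by
  rw [twoPointField, connectedMap, PowerSeries.coeff_mk, coeff_field_zero,
    ← zero_smul ℚ (0 : Fock), connectedSeries_smul_left, zero_smul]

theorem coeff_twoPointField_coe (l m : ℕ+) : PowerSeries.coeff (l : ℕ) (twoPointField k r q m) =
    connectedSeries k r q (MvPolynomial.X l) (MvPolynomial.X m) := by
  rw [twoPointField, connectedMap, PowerSeries.coeff_mk, coeff_field_coe]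

variable {k r q}

theorem coeff_onePointField_ne_zero (hr : 1 ≤ r) {b l : ℕ}
    (h : PowerSeries.coeff b (PowerSeries.coeff l (onePointField k r q)) ≠ 0) :
    ((q : ℕ) * (r - 1) + k) * b + q = l := by
  rcases Nat.eq_zero_or_pos l with rfl | hl
  · simp [coeff_onePointField_zero] at h
  · lift l to ℕ+ using hl
    rw [coeff_onePointField_coe] at h
    exact coeff_leadingHom_X_ne_zero hr h

theorem coeff_twoPointField_ne_zero (hr : 1 ≤ r) {b l : ℕ} {m : ℕ+}
    (h : PowerSeries.coeff b (PowerSeries.coeff l (twoPointField k r q m)) ≠ 0) :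
    ((q : ℕ) * (r - 1) + k) * b = l + (m : ℕ) := by
  rcases Nat.eq_zero_or_pos l with rfl | hl
  · simp [coeff_twoPointField_zero] at h
  · lift l to ℕ+ using hl
    rw [coeff_twoPointField_coe] at h
    exact coeff_connectedSeries_X_ne_zero hr h

/-- From `N b + q = l` with `N ≥ 1` it follows that `b ≤ l`, so truncation loses nothing. Passing to
polynomials in time makes evaluation at time one a ring homomorphism. -/
theorem map_onePointPoly (hr : 1 ≤ r) (hN : 1 ≤ (q : ℕ) * (r - 1) + k) :
    PowerSeries.map Polynomial.coeToPowerSeries.ringHom (onePointPoly k r q) =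
      onePointField k r q := by
  ext1 l
  rw [PowerSeries.coeff_map, onePointPoly, PowerSeries.coeff_mk,
    Polynomial.coeToPowerSeries.ringHom_apply]
  refine coe_trunc_of_support fun b hb => ?_
  have := coeff_onePointField_ne_zero hr hb
  nlinarith

theorem map_twoPointPoly (hr : 1 ≤ r) (hN : 1 ≤ (q : ℕ) * (r - 1) + k) (m : ℕ+) :
    PowerSeries.map Polynomial.coeToPowerSeries.ringHom (twoPointPoly k r q m) =
      twoPointField k r q m := by
  ext1 l
  rw [PowerSeries.coeff_map, twoPointPoly, PowerSeries.coeff_mk,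
    Polynomial.coeToPowerSeries.ringHom_apply]
  refine coe_trunc_of_support fun b hb => ?_
  have := coeff_twoPointField_ne_zero hr hb
  nlinarith

/-- Setting the time variable to one. -/
def atOne : PowerSeries (Polynomial ℚ) →+* PowerSeries ℚ :=
  PowerSeries.map (Polynomial.evalRingHom (1 : ℚ))

theorem coeff_atOne_onePointPoly (hr : 1 ≤ r) (l : ℕ) :
    PowerSeries.coeff l (atOne (onePointPoly k r q)) = l * PowerSeries.coeff l (W01 k r q) := by
  rw [atOne, PowerSeries.coeff_map, onePointPoly, PowerSeries.coeff_mk,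
    Polynomial.coe_evalRingHom, eval_one_trunc,
    sum_range_eq_sum_filter fun b hb => coeff_onePointField_ne_zero hr hb, W01,
    PowerSeries.coeff_mk, Finset.mul_sum]
  refine Finset.sum_congr rfl fun b _ => ?_
  rcases Nat.eq_zero_or_pos l with rfl | hl
  · simp [coeff_onePointField_zero]
  · lift l to ℕ+ using hl
    have : ((l : ℕ) : ℚ) ≠ 0 := by exact_mod_cast l.pos.ne'
    rw [coeff_onePointField_coe, genusZeroNumber₁_eq hr]
    field_simp

theorem atOne_onePointPoly (hr : 1 ≤ r) :
    atOne (onePointPoly k r q) = PowerSeries.X * serY k r q := by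
  ext l
  rw [coeff_atOne_onePointPoly hr]
  rcases l with _ | l
  · simp
  · rw [PowerSeries.coeff_succ_X_mul, serY, PowerSeries.coeff_derivative]
    push_cast
    ring

/-- The coefficients of `W_{0,2}`. -/
def coeffW02 (k r q l m : ℕ) : ℚ :=
  W02 k r q (Finsupp.single 0 l + Finsupp.single 1 m)

theorem coeff_atOne_twoPointPoly (hr : 1 ≤ r) (l : ℕ) (m : ℕ+) :
    PowerSeries.coeff l (atOne (twoPointPoly k r q m)) =
      (m : ℕ) * (l * coeffW02 k r q l m) := by
  rw [atOne, PowerSeries.coeff_map, twoPointPoly, PowerSeries.coeff_mk,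
    Polynomial.coe_evalRingHom, eval_one_trunc,
    sum_range_eq_sum_filter fun b hb => coeff_twoPointField_ne_zero hr hb]
  rcases Nat.eq_zero_or_pos l with rfl | hl
  · simp [coeff_twoPointField_zero]
  · lift l to ℕ+ using hl
    have h1 : ((l : ℕ) : ℚ) ≠ 0 := by exact_mod_cast l.pos.ne'
    have h2 : ((m : ℕ) : ℚ) ≠ 0 := by exact_mod_cast m.pos.ne'
    have e0 : (Finsupp.single 0 (l : ℕ) + Finsupp.single 1 (m : ℕ) : Fin 2 →₀ ℕ) 0 =
         (l : ℕ) := by simp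
    have e1 : (Finsupp.single 0 (l : ℕ) + Finsupp.single 1 (m : ℕ) : Fin 2 →₀ ℕ) 1 =
         (m : ℕ) := by simp
    rw [coeffW02, W02, e0, e1, if_pos ⟨l.pos, m.pos⟩, Finset.mul_sum, Finset.mul_sum]
    refine Finset.sum_congr rfl fun b _ => ?_
    rw [coeff_twoPointField_coe, genusZeroNumber₂_eq hr]
    field_simp

theorem derivative_onePointPoly (hr : 1 ≤ r) (hN : 1 ≤ (q : ℕ) * (r - 1) + k) (l : ℕ+) :
    Polynomial.derivative (PowerSeries.coeff (l : ℕ) (onePointPoly k r q)) =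
      Polynomial.C (((l : ℕ) : ℚ) / r) *
        coeffInt ((l : ℕ) - (k : ℤ)) (onePointPoly k r q ^ r) := by
  have hinj : Function.Injective (Polynomial.coeToPowerSeries.ringHom (R := ℚ)) :=
    Polynomial.coe_injective ℚ
  apply hinj
  have h1 := derivative_leadingHom_X k r q l
  rw [← coeff_onePointField_coe, ← map_onePointPoly hr hN, PowerSeries.coeff_map, ← map_pow,
    coeffInt_map, PowerSeries.smul_eq_C_mul] at h1
  rw [map_mul]
  simp only [Polynomial.coeToPowerSeries.ringHom_apply, PowerSeries.derivative_coe,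
    Polynomial.coe_C] at h1 ⊢
  exact h1

theorem derivative_twoPointPoly (hr : 1 ≤ r) (hN : 1 ≤ (q : ℕ) * (r - 1) + k) (l m : ℕ+) :
    Polynomial.derivative (PowerSeries.coeff (l : ℕ) (twoPointPoly k r q m)) =
      Polynomial.C ((l : ℕ) : ℚ) * coeffInt ((l : ℕ) - (k : ℤ))
        (onePointPoly k r q ^ (r - 1) * twoPointPoly k r q m) +
      Polynomial.C ((m : ℕ) : ℚ) * coeffInt ((m : ℕ) - (k : ℤ))
        (onePointPoly k r q ^ (r - 1) * twoPointPoly k r q l) +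
      Polynomial.C (((l : ℕ) : ℚ) * (m : ℕ)) * coeffInt ((l : ℕ) + (m : ℕ) - (k : ℤ))
        (onePointPoly k r q ^ (r - 1)) := by
  have hinj : Function.Injective (Polynomial.coeToPowerSeries.ringHom (R := ℚ)) :=
    Polynomial.coe_injective ℚ
  apply hinj
  have h1 := derivative_connectedSeries_X k r q hr l m
  rw [← coeff_twoPointField_coe, ← map_onePointPoly hr hN, ← map_twoPointPoly hr hN,
    ← map_twoPointPoly hr hN, PowerSeries.coeff_map, ← map_pow, ← map_mul, ← map_mul,
    coeffInt_map, coeffInt_map, coeffInt_map, PowerSeries.smul_eq_C_mul,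
    PowerSeries.smul_eq_C_mul, PowerSeries.smul_eq_C_mul] at h1
  rw [map_add, map_add, map_mul Polynomial.coeToPowerSeries.ringHom,
    map_mul Polynomial.coeToPowerSeries.ringHom, map_mul Polynomial.coeToPowerSeries.ringHom]
  simp only [Polynomial.coeToPowerSeries.ringHom_apply, PowerSeries.derivative_coe,
    Polynomial.coe_C] at h1 ⊢
  exact h1

theorem coeff_polynomial_of_trunc {A : PowerSeries ℚ} {n b : ℕ}
    (h : (PowerSeries.trunc n A).coeff b ≠ 0) : PowerSeries.coeff b A ≠ 0 := by
  rw [PowerSeries.coeff_trunc] at h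
  split_ifs at h with hb
  · exact h
  · exact absurd rfl h

theorem coeffInt_sub_natCast {R : Type*} [CommSemiring R] (l k : ℕ) (p : PowerSeries R) :
    coeffInt ((l : ℤ) - k) p = PowerSeries.coeff l (PowerSeries.X ^ k * p) := by
  have := coeffInt_C_mul_X_pow_mul (l : ℤ) 1 k p
  rw [map_one, one_mul, one_mul] at this
  rw [← this, coeffInt_natCast]

/-! ### Recursions for the one- and two-point functions at time one -/

theorem one_point_coeff (hr : 1 ≤ r) (hN : 1 ≤ (q : ℕ) * (r - 1) + k) (l : ℕ) :
    ((l : ℚ) - (q : ℕ)) * PowerSeries.coeff l (PowerSeries.X * serY k r q) =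
      (((q : ℕ) * (r - 1) + k : ℕ) : ℚ) * ((l : ℚ) / r *
        PowerSeries.coeff l (PowerSeries.X ^ k * (PowerSeries.X * serY k r q) ^ r)) := by
  rcases Nat.eq_zero_or_pos l with rfl | hl
  · simp
  · lift l to ℕ+ using hl
    have h1 := congrArg (Polynomial.eval 1) (derivative_onePointPoly hr hN l)
    rw [Polynomial.eval_mul, Polynomial.eval_C, ← Polynomial.coe_evalRingHom, ← coeffInt_map,
      map_pow, ← atOne, atOne_onePointPoly hr, coeffInt_sub_natCast] at h1
    rw [← h1, Polynomial.coe_evalRingHom, eval_one_derivative (c := ((l : ℕ) : ℚ) - (q : ℕ)),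
      ← atOne_onePointPoly hr, atOne, PowerSeries.coeff_map]
    · rfl
    · intro b hb
      rw [onePointPoly, PowerSeries.coeff_mk] at hb
      have := coeff_onePointField_ne_zero hr (coeff_polynomial_of_trunc hb)
      rw [← this]
      push_cast
      ring

theorem one_point_equation (hr : 1 ≤ r) (hN : 1 ≤ (q : ℕ) * (r - 1) + k) :
    PowerSeries.X * PowerSeries.derivative ℚ (PowerSeries.X * serY k r q) -
      PowerSeries.C ((q : ℕ) : ℚ) * (PowerSeries.X * serY k r q) =
    PowerSeries.C ((((q : ℕ) * (r - 1) + k : ℕ) : ℚ) / r) *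
      (PowerSeries.X * PowerSeries.derivative ℚ
        (PowerSeries.X ^ k * (PowerSeries.X * serY k r q) ^ r)) := by
  have hD : ∀ (f : PowerSeries ℚ) (l : ℕ),
      PowerSeries.coeff l (PowerSeries.X * PowerSeries.derivative ℚ f) =
        l * PowerSeries.coeff l f := by
    intro f l
    rcases l with _ | l
    · simp
    · rw [PowerSeries.coeff_succ_X_mul, PowerSeries.coeff_derivative]
      push_cast
      ring
  ext l
  rw [map_sub, PowerSeries.coeff_C_mul, PowerSeries.coeff_C_mul, hD, hD, ← sub_mul,
    one_point_coeff hr hN]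
  ring

/-- The series `∑_j j W_{jm} X^j`. -/
def rowW02 (k r q m : ℕ) : PowerSeries ℚ :=
  PowerSeries.mk fun j => j * coeffW02 k r q j m

theorem atOne_twoPointPoly (hr : 1 ≤ r) (m : ℕ+) :
    atOne (twoPointPoly k r q m) = PowerSeries.C ((m : ℕ) : ℚ) * rowW02 k r q m := by
  ext l
  rw [coeff_atOne_twoPointPoly hr, PowerSeries.coeff_C_mul, rowW02, PowerSeries.coeff_mk]

theorem two_point_equation (hr : 1 ≤ r) (hN : 1 ≤ (q : ℕ) * (r - 1) + k) (l m : ℕ+) :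
    (((l : ℕ) : ℚ) + (m : ℕ)) * coeffW02 k r q l m = (((q : ℕ) * (r - 1) + k : ℕ) : ℚ) *
      (PowerSeries.coeff (l : ℕ)
        (PowerSeries.X ^ k * (PowerSeries.X * serY k r q) ^ (r - 1) * rowW02 k r q m) +
      PowerSeries.coeff (m : ℕ)
        (PowerSeries.X ^ k * (PowerSeries.X * serY k r q) ^ (r - 1) * rowW02 k r q l) +
      PowerSeries.coeff ((l : ℕ) + (m : ℕ))
        (PowerSeries.X ^ k * (PowerSeries.X * serY k r q) ^ (r - 1))) := by
  have h1 := congrArg (Polynomial.eval 1) (derivative_twoPointPoly hr hN l m)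
  have hcast : ((l : ℕ) : ℤ) + (m : ℕ) = ((((l : ℕ) + (m : ℕ) : ℕ)) : ℤ) := by push_cast; rfl
  simp only [Polynomial.eval_add, Polynomial.eval_mul, Polynomial.eval_C] at h1
  simp only [← Polynomial.coe_evalRingHom] at h1
  rw [← coeffInt_map, ← coeffInt_map, ← coeffInt_map,
    ← atOne, map_mul atOne, map_mul atOne, map_pow atOne, atOne_onePointPoly hr, atOne_twoPointPoly hr,
    atOne_twoPointPoly hr, hcast, coeffInt_sub_natCast, coeffInt_sub_natCast,
    coeffInt_sub_natCast, mul_left_comm _ (PowerSeries.C _), mul_left_comm _ (PowerSeries.C _),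
    mul_left_comm _ (PowerSeries.C _), mul_left_comm _ (PowerSeries.C _),
    PowerSeries.coeff_C_mul, PowerSeries.coeff_C_mul, Polynomial.coe_evalRingHom,
    ← mul_assoc, ← mul_assoc] at h1
  have h2 := eval_one_derivative (p := PowerSeries.coeff (l : ℕ) (twoPointPoly k r q m))
    (N := (((q : ℕ) * (r - 1) + k : ℕ) : ℚ)) (c := ((l : ℕ) : ℚ) + (m : ℕ)) ?_
  · have h3 : (PowerSeries.coeff (l : ℕ) (twoPointPoly k r q m)).eval 1 =
        (m : ℕ) * ((l : ℕ) * coeffW02 k r q l m) := by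
      rw [← coeff_atOne_twoPointPoly hr, atOne, PowerSeries.coeff_map]
      rfl
    rw [h3, h1] at h2
    have e1 : ((l : ℕ) : ℚ) ≠ 0 := by exact_mod_cast l.pos.ne'
    have e2 : ((m : ℕ) : ℚ) ≠ 0 := by exact_mod_cast m.pos.ne'
    apply mul_left_cancel₀ (mul_ne_zero e1 e2)
    simp only [← mul_assoc] at h2 ⊢
    linear_combination -h2
  · intro b hb
    rw [twoPointPoly, PowerSeries.coeff_mk] at hb
    have := coeff_twoPointField_ne_zero hr (coeff_polynomial_of_trunc hb)
    rw [← Nat.cast_add, ← this]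
    push_cast
    ring

end

/-! ### Bidifferentials and transport equations -/

section

open MvPowerSeries (pderiv)

theorem coeff_atVar (i : Fin 2) (f : PowerSeries ℚ) (e : Fin 2 →₀ ℕ) :
    MvPowerSeries.coeff e (atVar i f) =
      if e = Finsupp.single i (e i) then PowerSeries.coeff (e i) f else 0 :=
  PowerSeries.coeff_subst_single i f e

theorem atVar_mul (i : Fin 2) (f g : PowerSeries ℚ) :
    atVar i (f * g) = atVar i f * atVar i g :=
  PowerSeries.subst_mul (PowerSeries.HasSubst.X i) f g

theorem atVar_sub (i : Fin 2) (f g : PowerSeries ℚ) :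
    atVar i (f - g) = atVar i f - atVar i g :=
  PowerSeries.subst_sub (PowerSeries.HasSubst.X i) f g

theorem atVar_X (i : Fin 2) : atVar i PowerSeries.X = MvPowerSeries.X i :=
  PowerSeries.subst_X (PowerSeries.HasSubst.X i)

theorem pderiv_atVar_self (i : Fin 2) (f : PowerSeries ℚ) :
    pderiv ℚ i (atVar i f) = atVar i (PowerSeries.derivative ℚ f) := by
  ext e
  rw [MvPowerSeries.coeff_pderiv, coeff_atVar, coeff_atVar, PowerSeries.coeff_derivative]
  have h : e + Finsupp.single i 1 = Finsupp.single i ((e + Finsupp.single i 1 : Fin 2 →₀ ℕ) i) ↔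
      e = Finsupp.single i (e i) := by
    rw [Finsupp.add_apply, Finsupp.single_eq_same, Finsupp.single_add, add_left_inj]
  rw [if_congr h rfl rfl, Finsupp.add_apply, Finsupp.single_eq_same]
  split_ifs <;> simp

theorem pderiv_atVar_of_ne {i j : Fin 2} (h : i ≠ j) (f : PowerSeries ℚ) :
    pderiv ℚ i (atVar j f) = 0 := by
  ext e
  rw [MvPowerSeries.coeff_pderiv, coeff_atVar, if_neg, zero_mul, map_zero]
  intro he
  have := DFunLike.congr_fun he i
  simp [Finsupp.single_eq_of_ne h] at this

theorem mvPowerSeries_pderiv_comm (i j : Fin 2) (F : MvPowerSeries (Fin 2) ℚ) :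
    pderiv ℚ i (pderiv ℚ j F) = pderiv ℚ j (pderiv ℚ i F) := by
  ext s
  simp only [MvPowerSeries.coeff_pderiv, Finsupp.add_apply]
  by_cases h : i = j
  · subst h; rfl
  · rw [Finsupp.single_eq_of_ne h, Finsupp.single_eq_of_ne (Ne.symm h), add_right_comm]
    push_cast
    ring

theorem coeff_X_mul_eq (i : Fin 2) (F : MvPowerSeries (Fin 2) ℚ) (e : Fin 2 →₀ ℕ) :
    MvPowerSeries.coeff e (MvPowerSeries.X i * F) =
      if e i = 0 then 0 else MvPowerSeries.coeff (e - Finsupp.single i 1) F := by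
  rw [MvPowerSeries.X_def, MvPowerSeries.coeff_monomial_mul, one_mul]
  have h : Finsupp.single i 1 ≤ e ↔ ¬ e i = 0 := by
    rw [Finsupp.single_le_iff]
    omega
  by_cases h0 : e i = 0
  · rw [if_neg (fun h1 => h.1 h1 h0), if_pos h0]
  · rw [if_pos (h.2 h0), if_neg h0]

theorem coeff_pderiv_X_mul (i : Fin 2) (F : MvPowerSeries (Fin 2) ℚ) (e : Fin 2 →₀ ℕ) :
    MvPowerSeries.coeff e (pderiv ℚ i (MvPowerSeries.X i * F)) =
      (e i + 1) * MvPowerSeries.coeff e F := by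
  rw [MvPowerSeries.coeff_pderiv, coeff_X_mul_eq, if_neg (by simp), add_tsub_cancel_right,
    mul_comm]

theorem coeff_X_mul_pderiv (i : Fin 2) (F : MvPowerSeries (Fin 2) ℚ) (e : Fin 2 →₀ ℕ) :
    MvPowerSeries.coeff e (MvPowerSeries.X i * pderiv ℚ i F) =
      e i * MvPowerSeries.coeff e F := by
  rw [coeff_X_mul_eq, MvPowerSeries.coeff_pderiv]
  split_ifs with h
  · simp [h]
  · have h1 : e - Finsupp.single i 1 + Finsupp.single i 1 = e :=
      tsub_add_cancel_of_le (by rw [Finsupp.single_le_iff]; omega)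
    have h2 := DFunLike.congr_fun h1 i
    rw [Finsupp.add_apply, Finsupp.single_eq_same] at h2
    rw [h1, mul_comm, ← h2]
    push_cast
    rfl

/-- The divided difference `(f(X_1) - f(X_2)) / (X_1 - X_2)`. -/
def dividedDifference (f : PowerSeries ℚ) : MvPowerSeries (Fin 2) ℚ :=
  fun e => PowerSeries.coeff (e 0 + e 1 + 1) f

theorem coeff_dividedDifference (f : PowerSeries ℚ) (e : Fin 2 →₀ ℕ) :
    MvPowerSeries.coeff e (dividedDifference f) = PowerSeries.coeff (e 0 + e 1 + 1) f := rfl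

theorem eq_single_zero_iff (e : Fin 2 →₀ ℕ) : e = Finsupp.single 0 (e 0) ↔ e 1 = 0 := by
  constructor
  · intro h
    rw [h]
    simp
  · intro h
    ext i
    fin_cases i <;> simp [h]

theorem eq_single_one_iff (e : Fin 2 →₀ ℕ) : e = Finsupp.single 1 (e 1) ↔ e 0 = 0 := by
  constructor
  · intro h
    rw [h]
    simp
  · intro h
    ext i
    fin_cases i <;> simp [h]

theorem sub_mul_dividedDifference (f : PowerSeries ℚ) :
    (MvPowerSeries.X 0 - MvPowerSeries.X 1) * dividedDifference f = atVar 0 f - atVar 1 f := by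
  ext e
  rw [sub_mul, map_sub, map_sub, coeff_X_mul_eq, coeff_X_mul_eq, coeff_dividedDifference,
    coeff_dividedDifference, coeff_atVar, coeff_atVar, if_congr (eq_single_zero_iff e) rfl rfl,
    if_congr (eq_single_one_iff e) rfl rfl]
  simp only [Finsupp.tsub_apply, Finsupp.single_eq_same,
    Finsupp.single_eq_of_ne (show (1 : Fin 2) ≠ 0 by decide),
    Finsupp.single_eq_of_ne (show (0 : Fin 2) ≠ 1 by decide), tsub_zero]
  rcases Nat.eq_zero_or_pos (e 0) with h0 | h0 <;> rcases Nat.eq_zero_or_pos (e 1) with h1 | h1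
  · simp [h0, h1]
  · rw [if_pos h0, if_neg h1.ne', if_neg h1.ne', if_pos h0,
      show e 0 + (e 1 - 1) + 1 = e 1 by omega]
  · rw [if_neg h0.ne', if_pos h1, if_pos h1, if_neg h0.ne',
      show e 0 - 1 + e 1 + 1 = e 0 by omega]
  · rw [if_neg h0.ne', if_neg h1.ne', if_neg h1.ne', if_neg h0.ne',
      show e 0 - 1 + e 1 + 1 = e 0 + (e 1 - 1) + 1 by omega, sub_self, sub_self]

/-- Without `H₀` and `H₁` the operator multiplies the coefficient at `e` by `e 0 + e 1 + 2 > 0`. The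
perturbations involve only coefficients of `C` of lower total degree, so induction on the degree
applies. -/
theorem transport_unique {H₀ H₁ C : MvPowerSeries (Fin 2) ℚ}
    (h₀ : MvPowerSeries.constantCoeff H₀ = 0) (h₁ : MvPowerSeries.constantCoeff H₁ = 0)
    (h : pderiv ℚ 0 (MvPowerSeries.X 0 * ((1 - H₀) * C)) +
      pderiv ℚ 1 (MvPowerSeries.X 1 * ((1 - H₁) * C)) = 0) : C = 0 := by
  have key : ∀ n : ℕ, ∀ e : Fin 2 →₀ ℕ, e.degree = n → MvPowerSeries.coeff e C = 0 := by
    intro n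
    induction n using Nat.strong_induction_on with
    | _ n ih =>
      intro e he
      have hH : ∀ H : MvPowerSeries (Fin 2) ℚ, MvPowerSeries.constantCoeff H = 0 →
          MvPowerSeries.coeff e (H * C) = 0 := by
        intro H hH
        classical
        rw [MvPowerSeries.coeff_mul]
        refine Finset.sum_eq_zero fun p hp => ?_
        rw [Finset.HasAntidiagonal.mem_antidiagonal] at hp
        by_cases h0 : p.1 = 0
        · rw [h0, MvPowerSeries.coeff_zero_eq_constantCoeff_apply, hH, zero_mul]
        · rw [ih p.2.degree _ _ rfl, mul_zero]
          have h1 : p.1.degree ≠ 0 := by rwa [Ne, Finsupp.degree_eq_zero_iff]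
          have h2 := congrArg Finsupp.degree hp
          rw [map_add] at h2
          omega
      have h2 := congrArg (MvPowerSeries.coeff e) h
      rw [map_add, coeff_pderiv_X_mul, coeff_pderiv_X_mul, sub_mul, sub_mul, one_mul, map_sub,
        map_sub, hH _ h₀, hH _ h₁, sub_zero, ← add_mul, LinearMap.map_zero] at h2
      exact (mul_eq_zero.1 h2).resolve_left (by positivity)
  ext e
  rw [key _ e rfl, map_zero]

theorem X_sub_X_ne_zero :
    (MvPowerSeries.X 0 - MvPowerSeries.X 1 : MvPowerSeries (Fin 2) ℚ) ≠ 0 := by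
  rw [sub_ne_zero, Ne, MvPowerSeries.X_inj]
  decide

theorem constantCoeff_atVar (i : Fin 2) (f : PowerSeries ℚ) :
    MvPowerSeries.constantCoeff (atVar i f) = PowerSeries.constantCoeff f := by
  rw [← MvPowerSeries.coeff_zero_eq_constantCoeff_apply, coeff_atVar]
  simp

/-- The comparison is between `W` and `log E`, where `E = (z_1 - z_2)/(X_1 - X_2)`; both satisfy the
transport equation up to terms killed by the mixed derivative. -/
theorem mixedDifferential_eq_bidifferential {H z : PowerSeries ℚ} {W : MvPowerSeries (Fin 2) ℚ}
    (hH : PowerSeries.constantCoeff H = 0) (hz₁ : PowerSeries.coeff 1 z ≠ 0)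
    (hz : PowerSeries.X * (1 - H) * PowerSeries.derivative ℚ z = z)
    (hW : atVar 0 (PowerSeries.X * (1 - H)) * pderiv ℚ 0 W +
      atVar 1 (PowerSeries.X * (1 - H)) * pderiv ℚ 1 W =
        dividedDifference (PowerSeries.X * H) - atVar 0 H - atVar 1 H) :
    toFrac (mixedDifferential W) = bidifferential z - bidifferential PowerSeries.X := by
  have h01 : (0 : Fin 2) ≠ 1 := by decide
  have h10 : (1 : Fin 2) ≠ 0 := by decide
  set D : MvPowerSeries (Fin 2) ℚ := MvPowerSeries.X 0 - MvPowerSeries.X 1 with hD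
  set E := dividedDifference z with hE
  set K := dividedDifference (PowerSeries.X * H) with hK
  set M₀ := atVar 0 (PowerSeries.X * (1 - H)) with hM₀
  set M₁ := atVar 1 (PowerSeries.X * (1 - H)) with hM₁
  have hDne : D ≠ 0 := X_sub_X_ne_zero
  have hDE : D * E = atVar 0 z - atVar 1 z := sub_mul_dividedDifference z
  have hDK : D * K = atVar 0 (PowerSeries.X * H) - atVar 1 (PowerSeries.X * H) :=
    sub_mul_dividedDifference _
  have hD0 : pderiv ℚ 0 D = 1 := by
    rw [hD, map_sub, MvPowerSeries.pderiv_X_self, MvPowerSeries.pderiv_X_of_ne h10, sub_zero]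
  have hD1 : pderiv ℚ 1 D = -1 := by
    rw [hD, map_sub, MvPowerSeries.pderiv_X_self, MvPowerSeries.pderiv_X_of_ne h01, zero_sub]
  have hz0 : pderiv ℚ 0 (atVar 0 z) = E + D * pderiv ℚ 0 E := by
    have := congrArg (pderiv ℚ 0) hDE
    rw [Derivation.leibniz, hD0, map_sub, pderiv_atVar_of_ne h01] at this
    simp only [smul_eq_mul] at this
    linear_combination -this
  have hz1 : pderiv ℚ 1 (atVar 1 z) = E - D * pderiv ℚ 1 E := by
    have := congrArg (pderiv ℚ 1) hDE
    rw [Derivation.leibniz, hD1, map_sub, pderiv_atVar_of_ne h10] at this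
    simp only [smul_eq_mul] at this
    linear_combination this
  have hE01 : D * pderiv ℚ 1 (pderiv ℚ 0 E) = pderiv ℚ 0 E - pderiv ℚ 1 E := by
    have := congrArg (pderiv ℚ 1) hz0
    rw [mvPowerSeries_pderiv_comm, pderiv_atVar_of_ne h10, map_zero, map_add, Derivation.leibniz,
      hD1] at this
    simp only [smul_eq_mul] at this
    linear_combination -this
  have hMz0 : M₀ * pderiv ℚ 0 (atVar 0 z) = atVar 0 z := by
    rw [hM₀, pderiv_atVar_self, ← atVar_mul, hz]
  have hMz1 : M₁ * pderiv ℚ 1 (atVar 1 z) = atVar 1 z := by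
    rw [hM₁, pderiv_atVar_self, ← atVar_mul, hz]
  have hM : M₀ - M₁ = D - D * K := by
    rw [hDK, hM₀, hM₁, hD, mul_sub, mul_one, atVar_sub, atVar_sub, atVar_X, atVar_X]
    ring
  -- Subtracting the equations for the two copies of `z` gives the transport equation for `D * E`;
  -- the part due to `D` is removed using `hM`.
  have hPDE : M₀ * pderiv ℚ 0 E + M₁ * pderiv ℚ 1 E = K * E := by
    apply mul_left_cancel₀ hDne
    rw [hz0] at hMz0
    rw [hz1] at hMz1
    linear_combination hMz0 - hMz1 - hDE - E * hM
  have hEinv : E * E⁻¹ = 1 := by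
    refine MvPowerSeries.mul_inv_cancel _ ?_
    rw [← MvPowerSeries.coeff_zero_eq_constantCoeff_apply, hE, coeff_dividedDifference]
    simpa using hz₁
  have hEne : E ≠ 0 := left_ne_zero_of_mul (hEinv.trans_ne one_ne_zero)
  -- The series `a` and `b` play the role of the partial derivatives of `log E`. The series `E` is
  -- invertible because its constant term is the linear coefficient of `z`.
  set a := pderiv ℚ 0 E * E⁻¹ with ha
  set b := pderiv ℚ 1 E * E⁻¹ with hb
  have haE : a * E = pderiv ℚ 0 E := by rw [ha, mul_assoc, mul_comm _ E, hEinv, mul_one]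
  have hbE : b * E = pderiv ℚ 1 E := by rw [hb, mul_assoc, mul_comm _ E, hEinv, mul_one]
  have hab : M₀ * a + M₁ * b = K := by
    apply mul_right_cancel₀ hEne
    rw [← hPDE, ← haE, ← hbE]
    ring
  have haE' : pderiv ℚ 1 a * E ^ 2 = E * pderiv ℚ 1 (pderiv ℚ 0 E) -
      pderiv ℚ 0 E * pderiv ℚ 1 E := by
    have := congrArg (pderiv ℚ 1) haE
    rw [Derivation.leibniz] at this
    simp only [smul_eq_mul] at this
    linear_combination E * this - pderiv ℚ 1 E * haE
  have hbE' : pderiv ℚ 0 b * E ^ 2 = E * pderiv ℚ 1 (pderiv ℚ 0 E) -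
      pderiv ℚ 0 E * pderiv ℚ 1 E := by
    have := congrArg (pderiv ℚ 0) hbE
    rw [Derivation.leibniz, mvPowerSeries_pderiv_comm] at this
    simp only [smul_eq_mul] at this
    linear_combination E * this - pderiv ℚ 0 E * hbE
  have hsym : pderiv ℚ 0 b = pderiv ℚ 1 a :=
    mul_right_cancel₀ (pow_ne_zero 2 hEne) (hbE'.trans haE'.symm)
  have hM01 : pderiv ℚ 1 M₀ = 0 := pderiv_atVar_of_ne h10 _
  have hM10 : pderiv ℚ 0 M₁ = 0 := pderiv_atVar_of_ne h01 _
  -- Each `Mᵢ` depends on one variable only, so differentiating in both variables leaves an equation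
  -- in the common mixed derivative alone, in the form required by `transport_unique`.
  have hmix : ∀ u v w : MvPowerSeries (Fin 2) ℚ, M₀ * u + M₁ * v = w →
      pderiv ℚ 0 v = pderiv ℚ 1 u →
      pderiv ℚ 0 (M₀ * pderiv ℚ 1 u) + pderiv ℚ 1 (M₁ * pderiv ℚ 1 u) =
        pderiv ℚ 0 (pderiv ℚ 1 w) := by
    intro u v w h1 h2
    have h3 : pderiv ℚ 1 (M₀ * u) = M₀ * pderiv ℚ 1 u := by
      rw [Derivation.leibniz, hM01]
      simp
    have h4 : pderiv ℚ 0 (M₁ * v) = M₁ * pderiv ℚ 1 u := by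
      rw [Derivation.leibniz, hM10, h2]
      simp
    rw [← h1, map_add, map_add, h3, mvPowerSeries_pderiv_comm 0 1 (M₁ * v), h4]
  have e1 := hmix a b K hab hsym
  have e2 := hmix _ _ _ hW (mvPowerSeries_pderiv_comm 0 1 W)
  have e3 : pderiv ℚ 0 (pderiv ℚ 1 (K - atVar 0 H - atVar 1 H)) = pderiv ℚ 0 (pderiv ℚ 1 K) := by
    rw [map_sub, map_sub, map_sub, map_sub, pderiv_atVar_of_ne h10, map_zero,
      mvPowerSeries_pderiv_comm 0 1 (atVar 1 H), pderiv_atVar_of_ne h01, map_zero, sub_zero,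
      sub_zero]
  have hC : pderiv ℚ 1 (pderiv ℚ 0 W) - pderiv ℚ 1 a = 0 := by
    apply transport_unique (H₀ := atVar 0 H) (H₁ := atVar 1 H)
    · rw [constantCoeff_atVar, hH]
    · rw [constantCoeff_atVar, hH]
    · have f0 : M₀ = MvPowerSeries.X 0 * (1 - atVar 0 H) := by
        rw [hM₀, mul_sub, mul_one, atVar_sub, atVar_mul, atVar_X]
        ring
      have f1 : M₁ = MvPowerSeries.X 1 * (1 - atVar 1 H) := by
        rw [hM₁, mul_sub, mul_one, atVar_sub, atVar_mul, atVar_X]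
        ring
      rw [← mul_assoc, ← mul_assoc, ← f0, ← f1, mul_sub, mul_sub, map_sub, map_sub]
      rw [e3, ← e1] at e2
      linear_combination e2
  have hfin : mixedDifferential W = pderiv ℚ 1 a := by
    rw [mixedDifferential, mvPowerSeries_pderiv_comm]
    exact sub_eq_zero.1 hC
  have hnum : pderiv ℚ 1 a * (D ^ 2 * E ^ 2) = pderiv ℚ 0 (atVar 0 z) * pderiv ℚ 1 (atVar 1 z) -
      E ^ 2 := by
    rw [hz0, hz1]
    linear_combination D ^ 2 * haE' + D * E * hE01
  have hinj : Function.Injective toFrac := IsFractionRing.injective _ _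
  have hD' : toFrac D ≠ 0 := by
    rwa [Ne, map_eq_zero_iff _ hinj]
  have hE' : toFrac E ≠ 0 := by
    rwa [Ne, map_eq_zero_iff _ hinj]
  clear_value a
  have hnum' := congrArg toFrac hnum
  simp only [RingHom.map_mul, RingHom.map_sub, RingHom.map_pow] at hnum'
  rw [hfin, bidifferential, bidifferential, ← map_sub, ← map_sub, ← hDE, atVar_X, atVar_X, ← hD,
    MvPowerSeries.pderiv_X_self, MvPowerSeries.pderiv_X_self, map_one, one_mul, map_mul]
  field_simp
  linear_combination hnum'

end

/-! ### The series `z` and the two-point function -/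

section

open PowerSeries (derivative)

theorem coeff_powerSeries_X_mul_derivative (f : PowerSeries ℚ) (n : ℕ) :
    PowerSeries.coeff n (PowerSeries.X * derivative ℚ f) = n * PowerSeries.coeff n f := by
  cases n with
  | zero => simp
  | succ n =>
    rw [PowerSeries.coeff_succ_X_mul, PowerSeries.coeff_derivative, mul_comm]
    push_cast
    rfl

theorem succ_mul_choose_succ (a : ℚ) (n : ℕ) :
    (n + 1) * Ring.choose a (n + 1) = (a - n) * Ring.choose a n := by
  have := Ring.choose_smul_choose a (Nat.le_add_right n 1)
  rw [Nat.choose_succ_self_right, Nat.add_sub_cancel_left, Ring.choose_one_right,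
    nsmul_eq_mul] at this
  push_cast at this
  rw [this, mul_comm]

/-- This first-order equation is uniform in `k`: the exponential solves it for `k = 0`, and for `k >
0` it is the recursion of the binomial coefficients. -/
theorem derivative_powerFactor (k : ℕ) {r : ℕ} (hr : 1 ≤ r) :
    derivative ℚ (powerFactor k r) * (1 - PowerSeries.C ((k : ℚ) / r) * PowerSeries.X) =
      powerFactor k r := by
  rcases Nat.eq_zero_or_pos k with rfl | hk
  · simp [powerFactor, PowerSeries.derivative_exp]
  · have hk' : (k : ℚ) ≠ 0 := by positivity
    have hr' : (r : ℚ) ≠ 0 := by positivity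
    have h : derivative ℚ (powerFactor k r) *
        (1 - PowerSeries.C ((k : ℚ) / r) * PowerSeries.X) = derivative ℚ (powerFactor k r) -
          PowerSeries.C ((k : ℚ) / r) * (PowerSeries.X * derivative ℚ (powerFactor k r)) := by
      ring
    rw [h, powerFactor, if_neg hk.ne']
    ext n
    rw [map_sub, PowerSeries.coeff_C_mul, coeff_powerSeries_X_mul_derivative,
      PowerSeries.coeff_derivative, PowerSeries.coeff_rescale, PowerSeries.coeff_rescale,
      PowerSeries.binomialSeries_coeff, PowerSeries.binomialSeries_coeff, smul_eq_mul, smul_eq_mul,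
      mul_one, mul_one, pow_succ]
    have h1 := succ_mul_choose_succ (-((r : ℚ) / k)) n
    have h2 : ((k : ℚ) / r) * ((r : ℚ) / k) = 1 := by field_simp
    linear_combination (-((k : ℚ) / r)) ^ n * (-((k : ℚ) / r)) * h1 +
      (-((k : ℚ) / r)) ^ n * Ring.choose (-((r : ℚ) / k)) n * h2

theorem constantCoeff_powerFactor (k r : ℕ) :
    PowerSeries.constantCoeff (powerFactor k r) = 1 := by
  rw [powerFactor]
  split_ifs
  · simp
  · rw [← PowerSeries.coeff_zero_eq_constantCoeff_apply, PowerSeries.coeff_rescale,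
      PowerSeries.binomialSeries_coeff]
    simp

theorem cast_mul_pow_pred_mul {R : Type*} [CommRing R] (a : R) (n : ℕ) :
    (n : R) * a ^ (n - 1) * a = n * a ^ n := by
  cases n with
  | zero => simp
  | succ n => rw [Nat.add_sub_cancel, pow_succ, mul_assoc]

theorem X_mul_derivative_X_pow_mul_pow (y : PowerSeries ℚ) (k s : ℕ) :
    PowerSeries.X * derivative ℚ (PowerSeries.X ^ k * y ^ s) =
      (k : PowerSeries ℚ) * (PowerSeries.X ^ k * y ^ s) +
        PowerSeries.X ^ k * ((s : PowerSeries ℚ) * y ^ (s - 1)) * (PowerSeries.X * derivative ℚ y) := by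
  have h := cast_mul_pow_pred_mul (PowerSeries.X : PowerSeries ℚ) k
  rw [Derivation.leibniz, Derivation.leibniz_pow, Derivation.leibniz_pow,
    PowerSeries.derivative_X]
  simp only [smul_eq_mul, nsmul_eq_mul, mul_one]
  linear_combination y ^ s * h

end

/-! ### The differential equation satisfied by `z` -/

section

open PowerSeries (derivative)

variable {k r : ℕ} {q : ℕ+}

/-- The series `Y^{r-1} X^{r-1+k}`. -/
def innerSeries (k r q : ℕ) : PowerSeries ℚ :=
  PowerSeries.X ^ k * (PowerSeries.X * serY k r q) ^ (r - 1)

theorem constantCoeff_innerSeries (q : ℕ) (h : k = 0 → 2 ≤ r) :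
    PowerSeries.constantCoeff (innerSeries k r q) = 0 := by
  rw [innerSeries, map_mul, map_pow, map_pow, map_mul, PowerSeries.constantCoeff_X, zero_mul]
  rcases Nat.eq_zero_or_pos k with hk | hk
  · rw [zero_pow (n := r - 1) (by have := h hk; omega), mul_zero]
  · rw [zero_pow hk.ne', zero_mul]

/-- With `y = XY` and `G` the inner series, `one_point_equation` reads `(1 - N G) X y' = (q + (k/r)
N G) y`. Inserting this into the logarithmic derivative of `G = X^k y^(r-1)` and using `q(r-1) + k =
N` gives the result; the combination is arranged without dividing by `y`. -/
theorem one_sub_mul_X_mul_derivative_innerSeries (hr : 1 ≤ r) (hN : 1 ≤ (q : ℕ) * (r - 1) + k) :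
    (1 - (((q : ℕ) * (r - 1) + k : ℕ) : PowerSeries ℚ) * innerSeries k r q) *
        (PowerSeries.X * derivative ℚ (innerSeries k r q)) =
      (((q : ℕ) * (r - 1) + k : ℕ) : PowerSeries ℚ) * innerSeries k r q *
        (1 - PowerSeries.C ((k : ℚ) / r) * innerSeries k r q) := by
  have h1 := one_point_equation (k := k) (q := q) hr hN
  set y := PowerSeries.X * serY k r q with hy
  obtain ⟨s, rfl⟩ : ∃ s, r = s + 1 := ⟨r - 1, by omega⟩
  rw [innerSeries, ← hy]
  rw [Nat.add_sub_cancel] at h1 ⊢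
  rw [X_mul_derivative_X_pow_mul_pow] at h1 ⊢
  rw [Nat.add_sub_cancel] at h1
  have hs := cast_mul_pow_pred_mul y s
  have hC1 : PowerSeries.C ((((q : ℕ) * s + k : ℕ) : ℚ) / (s + 1 : ℕ)) * ((s + 1 : ℕ) : PowerSeries ℚ) =
      (((q : ℕ) * s + k : ℕ) : PowerSeries ℚ) := by
    rw [← map_natCast (PowerSeries.C (R := ℚ)) (s + 1), ← map_mul,
      div_mul_cancel₀ _ (by positivity), map_natCast]
  have hC2 : PowerSeries.C ((k : ℚ) / (s + 1 : ℕ)) * ((s + 1 : ℕ) : PowerSeries ℚ) =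
      (k : PowerSeries ℚ) := by
    rw [← map_natCast (PowerSeries.C (R := ℚ)) (s + 1), ← map_mul,
      div_mul_cancel₀ _ (by positivity), map_natCast]
  have hC3 : PowerSeries.C ((((q : ℕ) * s + k : ℕ) : ℚ) / (s + 1 : ℕ)) * (k : PowerSeries ℚ) =
      PowerSeries.C ((k : ℚ) / (s + 1 : ℕ)) * (((q : ℕ) * s + k : ℕ) : PowerSeries ℚ) := by
    rw [← map_natCast (PowerSeries.C (R := ℚ)) k, ← map_natCast (PowerSeries.C (R := ℚ)),
      ← map_mul, ← map_mul]
    congr 1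
    ring
  rw [map_natCast] at h1
  set c := PowerSeries.C ((((q : ℕ) * s + k : ℕ) : ℚ) / (s + 1 : ℕ)) with hc
  set e := PowerSeries.C ((k : ℚ) / (s + 1 : ℕ)) with he
  set N := (((q : ℕ) * s + k : ℕ) : PowerSeries ℚ) with hNdef
  set P := (PowerSeries.X : PowerSeries ℚ) ^ k with hP
  set D := PowerSeries.X * derivative ℚ y with hD
  have hN' : N = (q : ℕ) * s + k := by rw [hNdef]; push_cast; rfl
  have h2 : (1 - N * (P * y ^ s)) * D = ((q : ℕ) + e * N * (P * y ^ s)) * y := by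
    rw [pow_succ] at h1
    linear_combination h1 + P * y ^ s * D * hC1 + P * y ^ s * y * hC3
  push_cast at hC2
  linear_combination P * ((s : PowerSeries ℚ) * y ^ (s - 1)) * h2 +
    P * ((q : ℕ) + e * N * (P * y ^ s)) * hs - P * y ^ s * hN' + N * (P * y ^ s) ^ 2 * hC2

theorem serZ_eq (k r q : ℕ) :
    serZ k r q = PowerSeries.X * (powerFactor k r).subst (innerSeries k r q) := by
  rw [serZ, innerSeries, mul_pow, pow_add]
  congr 2
  ring

theorem coeff_one_serZ (q : ℕ) (h : k = 0 → 2 ≤ r) : PowerSeries.coeff 1 (serZ k r q) = 1 := by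
  have hG : PowerSeries.constantCoeff (innerSeries k r q) = 0 := constantCoeff_innerSeries q h
  have hS := PowerSeries.HasSubst.of_constantCoeff_zero' hG
  rw [serZ_eq, PowerSeries.coeff_succ_X_mul, PowerSeries.coeff_subst' hS, finsum_eq_single _ 0]
  · simp [constantCoeff_powerFactor]
  · intro n hn
    simp [hG, hn]

/-- In the product rule for `z = X f(G)`, the factor `1 - (k/r) G` coming from `G'` is absorbed by
the equation for `f`, and the two terms in `N G` cancel. -/
theorem X_mul_one_sub_mul_derivative_serZ (hr : 1 ≤ r) (h : k = 0 → 2 ≤ r)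
    (hN : 1 ≤ (q : ℕ) * (r - 1) + k) :
    PowerSeries.X * (1 - (((q : ℕ) * (r - 1) + k : ℕ) : PowerSeries ℚ) * innerSeries k r q) *
      derivative ℚ (serZ k r q) = serZ k r q := by
  have hS : PowerSeries.HasSubst (innerSeries k r q) :=
    PowerSeries.HasSubst.of_constantCoeff_zero' (constantCoeff_innerSeries q h)
  have h1 := one_sub_mul_X_mul_derivative_innerSeries hr hN
  have h2 := congrArg (PowerSeries.subst (innerSeries k r q)) (derivative_powerFactor k hr)
  rw [PowerSeries.subst_mul hS, PowerSeries.subst_sub hS, PowerSeries.subst_mul hS,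
    PowerSeries.subst_X hS, PowerSeries.subst_C, ← map_one PowerSeries.C,
    PowerSeries.subst_C] at h2
  change _ * (PowerSeries.C 1 - PowerSeries.C _ * _) = _ at h2
  rw [map_one] at h2
  rw [serZ_eq, Derivation.leibniz, PowerSeries.derivative_subst hS, PowerSeries.derivative_X]
  simp only [smul_eq_mul, mul_one]
  set f := PowerSeries.subst (innerSeries k r q) (powerFactor k r)
  set f' := PowerSeries.subst (innerSeries k r q) (derivative ℚ (powerFactor k r))
  set N := (((q : ℕ) * (r - 1) + k : ℕ) : PowerSeries ℚ)
  linear_combination PowerSeries.X * f' * h1 + PowerSeries.X * N * innerSeries k r q * h2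

end

/-! ### The transport equation satisfied by `W02` -/

section

open MvPowerSeries (pderiv)

/-- Multiplication by a series in one variable acts on each row separately, so two-variable
coefficients reduce to the one-variable ones of `two_point_equation`. -/
theorem coeff_atVar_mul (i : Fin 2) (g : PowerSeries ℚ) (F : MvPowerSeries (Fin 2) ℚ)
    (e : Fin 2 →₀ ℕ) :
    MvPowerSeries.coeff e (atVar i g * F) = PowerSeries.coeff (e i)
      (g * PowerSeries.mk fun j => MvPowerSeries.coeff (e.update i j) F) := by
  classical
  rw [MvPowerSeries.coeff_mul, PowerSeries.coeff_mul]
  symm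
  refine Finset.sum_of_injOn (fun p => (Finsupp.single i p.1, e.update i p.2)) ?_ ?_ ?_ ?_
  · rintro ⟨a, b⟩ - ⟨a', b'⟩ - hp
    have h1 := DFunLike.congr_fun (congrArg Prod.fst hp) i
    have h2 := DFunLike.congr_fun (congrArg Prod.snd hp) i
    simp at h1 h2
    rw [h1, h2]
  · rintro ⟨a, b⟩ hp
    rw [Finset.mem_coe, Finset.HasAntidiagonal.mem_antidiagonal] at hp ⊢
    ext j
    by_cases hj : j = i
    · subst hj
      simpa using hp
    · simp [Finsupp.single_eq_of_ne hj, hj]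
  · rintro ⟨a, b⟩ hp hn
    rw [Finset.HasAntidiagonal.mem_antidiagonal] at hp
    rw [coeff_atVar, if_neg, zero_mul]
    intro ha
    apply hn
    refine ⟨(a i, b i), ?_, ?_⟩
    · rw [Finset.mem_coe, Finset.HasAntidiagonal.mem_antidiagonal]
      exact DFunLike.congr_fun hp i
    · refine Prod.ext ha.symm ?_
      ext j
      by_cases hj : j = i
      · subst hj
        simp
      · have h1 := DFunLike.congr_fun hp j
        have h2 := DFunLike.congr_fun ha j
        rw [Finsupp.single_eq_of_ne hj] at h2
        simp only [Finsupp.add_apply] at h1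
        simp only [Finsupp.update_apply, if_neg hj]
        simp only at h2
        omega
  · rintro ⟨a, b⟩ -
    rw [coeff_atVar, PowerSeries.coeff_mk]
    simp

theorem coeff_W02_update_zero (k r q : ℕ) (e : Fin 2 →₀ ℕ) (j : ℕ) :
    MvPowerSeries.coeff (e.update 0 j) (W02 k r q) = coeffW02 k r q j (e 1) := by
  rw [coeffW02]
  change W02 k r q _ = _
  congr 1
  ext i
  fin_cases i <;> simp

theorem coeff_W02_update_one (k r q : ℕ) (e : Fin 2 →₀ ℕ) (j : ℕ) :
    MvPowerSeries.coeff (e.update 1 j) (W02 k r q) = coeffW02 k r q (e 0) j := by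
  rw [coeffW02]
  change W02 k r q _ = _
  congr 1
  ext i
  fin_cases i <;> simp

variable {k r : ℕ} {q : ℕ+}

theorem coeffW02_zero_left (k r q m : ℕ) : coeffW02 k r q 0 m = 0 := by
  simp [coeffW02, W02]

theorem coeffW02_zero_right (k r q m : ℕ) : coeffW02 k r q m 0 = 0 := by
  simp [coeffW02, W02]

theorem coeffW02_comm (hr : 1 ≤ r) (l m : ℕ) : coeffW02 k r q l m = coeffW02 k r q m l := by
  rcases Nat.eq_zero_or_pos l with rfl | hl
  · rw [coeffW02_zero_left, coeffW02_zero_right]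
  rcases Nat.eq_zero_or_pos m with rfl | hm
  · rw [coeffW02_zero_left, coeffW02_zero_right]
  lift l to ℕ+ using hl
  lift m to ℕ+ using hm
  have h : ∀ l m : ℕ+, coeffW02 k r q l m =
      ∑ b ∈ (Finset.range ((l + m : ℕ) + 1)).filter
        (fun b => ((q : ℕ) * (r - 1) + k) * b = (l + m : ℕ)),
        genusZeroNumber₂ k r q l m b / (b ! : ℚ) := by
    intro l m
    rw [coeffW02, W02, if_pos]
    · simp
    · simp
      exact ⟨l.pos, m.pos⟩
  rw [h, h, add_comm (m : ℕ)]
  refine Finset.sum_congr rfl fun b _ => ?_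
  rw [genusZeroNumber₂_eq hr, genusZeroNumber₂_eq hr, connectedSeries_comm, mul_comm (l : ℚ)]

theorem W02_transport (hr : 1 ≤ r) (h : k = 0 → 2 ≤ r) (hN : 1 ≤ (q : ℕ) * (r - 1) + k)
    {H : PowerSeries ℚ}
    (hH : H = (((q : ℕ) * (r - 1) + k : ℕ) : PowerSeries ℚ) * innerSeries k r q) :
    atVar 0 (PowerSeries.X * (1 - H)) * pderiv ℚ 0 (W02 k r q) +
      atVar 1 (PowerSeries.X * (1 - H)) * pderiv ℚ 1 (W02 k r q) =
        dividedDifference (PowerSeries.X * H) - atVar 0 H - atVar 1 H := by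
  have hH0 : PowerSeries.coeff 0 H = 0 := by
    rw [hH, PowerSeries.coeff_zero_eq_constantCoeff_apply, map_mul,
      constantCoeff_innerSeries (q : ℕ) h, mul_zero]
  have hW : ∀ i : Fin 2, atVar i (PowerSeries.X * (1 - H)) * pderiv ℚ i (W02 k r q) =
      MvPowerSeries.X i * pderiv ℚ i (W02 k r q) -
        atVar i H * (MvPowerSeries.X i * pderiv ℚ i (W02 k r q)) := by
    intro i
    rw [mul_sub, mul_one, atVar_sub, atVar_mul, atVar_X]
    ring
  ext e
  have he0 : MvPowerSeries.coeff e (W02 k r q) = coeffW02 k r q (e 0) (e 1) := by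
    rw [← coeff_W02_update_zero]
    simp
  rw [hW, hW, map_add, map_sub, map_sub, map_sub, map_sub, coeff_atVar_mul, coeff_atVar_mul,
    coeff_X_mul_pderiv, coeff_X_mul_pderiv, coeff_dividedDifference, PowerSeries.coeff_succ_X_mul,
    coeff_atVar, coeff_atVar, if_congr (eq_single_zero_iff e) rfl rfl,
    if_congr (eq_single_one_iff e) rfl rfl, he0]
  simp only [coeff_X_mul_pderiv, coeff_W02_update_zero, coeff_W02_update_one, Finsupp.update_apply,
    if_pos]
  generalize e 0 = l
  generalize e 1 = m
  -- At interior exponents this is `two_point_equation`. When `l` or `m` is zero the left side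
  -- vanishes, as `W02` has no such terms, and the subtracted copies of `H` cancel the divided
  -- difference.
  rcases Nat.eq_zero_or_pos l with rfl | hl
  · rcases Nat.eq_zero_or_pos m with rfl | hm
    · simp [coeffW02_zero_left, hH0]
    · simp [coeffW02_zero_left, PowerSeries.coeff_mul, hm.ne']
  · rcases Nat.eq_zero_or_pos m with rfl | hm
    · simp [coeffW02_zero_right, PowerSeries.coeff_mul, hl.ne']
    · lift l to ℕ+ using hl
      lift m to ℕ+ using hm
      rw [if_neg m.ne_zero, if_neg l.ne_zero]
      have h1 := two_point_equation (k := k) (q := q) hr hN l m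
      have hrow : (PowerSeries.mk fun j => (j : ℚ) * coeffW02 k r q l j) = rowW02 k r q l := by
        ext j
        rw [rowW02, PowerSeries.coeff_mk, PowerSeries.coeff_mk, coeffW02_comm hr]
      have hrow' : (PowerSeries.mk fun j => (j : ℚ) * coeffW02 k r q j m) = rowW02 k r q m := rfl
      have hH' : H = PowerSeries.C (((q : ℕ) * (r - 1) + k : ℕ) : ℚ) * innerSeries k r q := by
        rw [hH, map_natCast]
      rw [hrow, hrow', hH', mul_assoc, mul_assoc, PowerSeries.coeff_C_mul, PowerSeries.coeff_C_mul,
        PowerSeries.coeff_C_mul, innerSeries]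
      linear_combination h1

end

end

end LeakyHurwitz

theorem mainTheorem10 (k r q : ℕ) (hr : 1 ≤ r) (hq : 1 ≤ q) (hk : k = 0 → 2 ≤ r) :
    LeakyHurwitz.toFrac (LeakyHurwitz.mixedDifferential (LeakyHurwitz.W02 k r q)) =
      LeakyHurwitz.bidifferential (LeakyHurwitz.serZ k r q) -
        LeakyHurwitz.bidifferential PowerSeries.X := by
  lift q to ℕ+ using hq
  -- If `k = 0`, positivity comes from `r ≥ 2`. Positivity of this number bounds `b` by the profile.
  have hN : 1 ≤ (q : ℕ) * (r - 1) + k := by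
    rcases Nat.eq_zero_or_pos k with h | h
    · have := Nat.mul_pos q.pos (show 0 < r - 1 by have := hk h; omega)
      omega
    · omega
  refine LeakyHurwitz.mixedDifferential_eq_bidifferential ?_ ?_
    (LeakyHurwitz.X_mul_one_sub_mul_derivative_serZ hr hk hN)
    (LeakyHurwitz.W02_transport hr hk hN rfl)
  · rw [map_mul, LeakyHurwitz.constantCoeff_innerSeries (q : ℕ) hk, mul_zero]
  · rw [LeakyHurwitz.coeff_one_serZ (q : ℕ) hk]
    exact one_ne_zero
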